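/- **Setting.** Let $H_0$ be a self-adjoint operator with dense domain $D$ in a complex Hilbert space $\mathcal H$, and let $\mathcal A_0$ be a real vector space of symmetric operators on $D$ that are relatively compact with respect to $H_0$ (for instance restrictions to $D$ of relatively compact self-adjoint operators). Put $\mathcal A=H_0+\mathcal A_0$. Let $\lambda\in\mathbb R$ lie outside the essential spectrum of $H_0$. The resonance set $\mathcal R(\lambda)$ is the set of $H\in\mathcal A$ that have $\lambda$ as an eigenvalue. Fix $H\in\mathcal R(\lambda)$ with eigenspace $\mathcal V=\ker(H-\lambda)$, a real number $r$, and $V\in\mathcal A_0$ that is regular at $H$, i.e. the line $H+\mathbb RV$ is not contained in $\mathcal R(\lambda)$. Put $H_s=H+(s-r)V$, and let $A(s)$ be the bounded extension of $(H_s-\lambda)^{-1}V$. A vector $\chi$ is a resonance vector if $(1+(r-s)A(s))^n\chi=0$ for some $n\ge1$ and some (equivalently, any) $s\in\mathbb C$ for which $A(s)$ is defined; the least such $n$ is the order of $\chi$. The order of $V$ at $H$ is the least $d\ge1$ such that all resonance vectors satisfy this equation with $n=d$. Let $\mathbf A=\frac1{2\pi i}\oint (s-r)A(s)\,ds$ over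 a small circle around $r$; a resonance vector $\chi$ has depth at least $n$ if $\chi\in\operatorname{im}\mathbf A^n$. Norms of operators from $D$ to $\mathcal H$ refer to the graph norm of $H_0$ on $D$, and paths are considered near $s=r$. A resonant path is a real-analytic path $P(s)\in\mathcal R(\lambda)$; an eigenpath of an analytic path $P$ is a real-analytic $\chi(s)\neq0$ with $P(s)\chi(s)=\lambda\chi(s)$. A path $P$ is tangent to $V$ at $H$ to order at least $k$, with coefficients $c_j\in\mathbb R$, if $$P(s)=H+(s-r)V+\sum_{j=2}^{k-1}c_j(s-r)^jV+O((s-r)^k),\qquad s\to r;$$ it is standard if this holds with all $c_j=0$. The direction $V$ is tangent to $\mathcal R(\lambda)$ at $H$ to order at least $k$ if some resonant path is tangent to $V$ at $H$ to order at least $k$. For an eigenvector $0\ne\chi\in\mathcal V$ let $W_\chi=\langle\chi,\cdot\rangle\chi$. We say that the resonance curve $\gamma_\chi$ exists if there is a real-analytic $b$ near $0$ with $b(0)=0$ such that, for all real $(a,t)$ near $(0,0)$ with $a\ne0$, $\lambda$ is an eigenvalue of $H+aV+tW_\chi$ if and only if $t=b(a)$; then $\gamma_\chi$ is the curve $a\mapsto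 H+aV+b(a)W_\chi$ in the plane $H+\mathbb RV+\mathbb RW_\chi$. The direction $V$ is tangent to $\gamma_\chi$ to order at least $k$ if $b(a)=O(a^k)$ as $a\to0$. **Theorem.** Let $k\ge1$. 1. Let $P$ be a resonant path tangent to $V$ at $H$ to order at least $k$ with coefficients $c_j$. Then $P$ has an eigenpath, $V$ has order at least $k$, and for every eigenpath $\chi(s)$ of $P$: the vectors $\chi(r),\chi'(r),\dots,\chi^{(k-1)}(r)$ have orders $1,2,\dots,k$ respectively; for $0\le n\le k-1$, $$\mathbf A\chi^{(n)}(r)=n\chi^{(n-1)}(r)+\sum_{j=2}^{n}j!\binom nj c_j\,\chi^{(n-j)}(r)$$ (where the first term is $0$ for $n=0$); and $\chi(r)$ has depth at least $k-1$. 2. Suppose that $W_\chi\in\mathcal A_0$ for every $\chi\in\mathcal V$. Then $V$ is tangent to $\mathcal R(\lambda)$ at $H$ to order at least $k$ if and only if the order of $V$ at $H$ is at least $k$. 3. Let $\mathcal D$ be the set of eigenvectors $0\neq\chi\in\mathcal V$ of depth at least $k-1$. - (a) There is an open set $O\subset\mathcal H$ such that $\mathcal D\cap O$ is dense in $\mathcal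 D$ and, for every $\chi\in\mathcal D\cap O$, the curve $\gamma_\chi$ exists and $V$ is tangent to it to order at least $k$. - (b) If $\dim\mathcal V=1$, the same holds for every $\chi\in\mathcal D$. - (c) If $\chi\in\mathcal D$, the curve $\gamma_\chi$ exists, and some eigenpath along $\gamma_\chi$ (parametrised by $a=s-r$) has a value at $s=r$ collinear to $\chi$, then $V$ is tangent to $\gamma_\chi$ to order at least $k$. - (d) Let $0\ne\chi\in\mathcal V$ be such that $\gamma_\chi$ exists and $V$ is tangent to it to order at least $k$. Let $P(s)=H+\alpha(s)V+b(\alpha(s))W_\chi$ with $\alpha$ real-analytic near $r$, $\alpha(r)=0$, $\alpha'(r)\ne0$, and let $\eta(s)=\sum_j(s-r)^j\eta_j$ be an eigenpath of $P$. Then $\eta_0,\dots,\eta_{k-1}$ have orders $1,\dots,k$; for $0\le j\le k-1$, $\mathbf A\eta_j$ is a linear combination of $\eta_0,\dots,\eta_{j-1}$ (so $\mathbf A\eta_0=0$); if $P$ is standard, then $\mathbf A\eta_j=\eta_{j-1}$ for $1\le j\le k-1$; and for $0\le j\le k-2$ the vector $\eta_j$ has depth at least $1$, lies in $D$, and $V\eta_j\perp\mathcal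 V$. -/

import Mathlib

open Filter Topology

noncomputable section

/-! All operators below are defined on one fixed domain `D`, the domain of the unperturbed
self-adjoint operator; a perturbation enters only through its restriction to `D`. -/

namespace Resonance

variable {E : Type*} [NormedAddCommGroup E] [InnerProductSpace ℂ E] [CompleteSpace E]
variable {D : Submodule ℂ E}

/-- `R` is the (bounded, everywhere defined) resolvent `(T - z)⁻¹`. -/
def IsResolvent (T : D →ₗ[ℂ] E) (z : ℂ) (R : E →L[ℂ] E) : Prop :=
  (∀ y : E, ∃ h : R y ∈ D, T ⟨R y, h⟩ - z • R y = y) ∧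
    ∀ x : D, R (T x - z • (x : E)) = (x : E)

/-- `A` is the bounded operator `R_z(T) V`, that is, the (unique, as `D` will be dense) continuous
extension of `x ↦ (T - z)⁻¹ (V x)`, `x ∈ D`, to the whole space. -/
def IsResolventMul (T V : D →ₗ[ℂ] E) (z : ℂ) (A : E →L[ℂ] E) : Prop :=
  ∃ R : E →L[ℂ] E, IsResolvent T z R ∧ ∀ x : D, A (x : E) = R (V x)

open Classical in
/-- The operator `R_z(T) V`; the value `0` is used where the resolvent does not exist. -/
def resolventMul (T V : D →ₗ[ℂ] E) (z : ℂ) : E →L[ℂ] E :=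
  if h : ∃ A, IsResolventMul T V z A then h.choose else 0

/-- `V` is symmetric on `D` and relatively compact with respect to `T`. A self-adjoint operator
whose domain contains `D` is symmetric on `D`. -/
def IsDirection (T V : D →ₗ[ℂ] E) : Prop :=
  (∀ x y : D, inner ℂ (V x) (y : E) = inner ℂ (x : E) (V y)) ∧
    ∃ (z : ℂ) (K : E →L[ℂ] E), IsResolventMul T V z K ∧ IsCompactOperator K

/-- `T - z`, as a linear map on `D`. -/
def shift (T : D →ₗ[ℂ] E) (z : ℂ) : D →ₗ[ℂ] E := T - z • D.subtype

/-- The essential spectrum: the `z` for which `T - z` is not a Fredholm operator. -/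
def essentialSpectrum (T : D →ₗ[ℂ] E) : Set ℂ :=
  {z | ¬ (FiniteDimensional ℂ (LinearMap.ker (shift T z)) ∧
      IsClosed (LinearMap.range (shift T z) : Set E) ∧
      FiniteDimensional ℂ (E ⧸ LinearMap.range (shift T z)))}

/-- `χ` lies in the eigenspace of `T` at the real number `lam` (`χ = 0` is allowed). -/
def InEigenspace (T : D →ₗ[ℂ] E) (lam : ℝ) (χ : E) : Prop :=
  ∃ h : χ ∈ D, T ⟨χ, h⟩ = (lam : ℂ) • χ

/-- `lam` is an eigenvalue of `T`. -/
def IsResonant (T : D →ₗ[ℂ] E) (lam : ℝ) : Prop :=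
  ∃ χ : E, χ ≠ 0 ∧ InEigenspace T lam χ

/-- The straight line `H + sV` is not contained in the resonance set. -/
def IsRegular (H V : D →ₗ[ℂ] E) (lam : ℝ) : Prop :=
  ∃ s : ℝ, ¬ IsResonant (H + s • V) lam

/-! ### Resonance vectors, their order and depth. Here `H = H_r` sits at the parameter `r`. -/

/-- The line `H_s = H + (s - r) V`, with a complex parameter `s`. -/
def line (H V : D →ₗ[ℂ] E) (r : ℝ) (s : ℂ) : D →ₗ[ℂ] E := H + (s - (r : ℂ)) • V

/-- `A_λ(s) = (H_s - λ)⁻¹ V`. -/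
def opA (H V : D →ₗ[ℂ] E) (lam r : ℝ) (s : ℂ) : E →L[ℂ] E :=
  resolventMul (line H V r s) V (lam : ℂ)

/-- The resonance equation of order `k`: `(1 + (r - s) A_λ(s)) ^ k χ = 0` for some `s` at which
`A_λ(s)` exists. -/
def ResonanceEq (H V : D →ₗ[ℂ] E) (lam r : ℝ) (k : ℕ) (χ : E) : Prop :=
  ∃ s : ℂ, (∃ A, IsResolventMul (line H V r s) V (lam : ℂ) A) ∧
    ((1 + ((r : ℂ) - s) • opA H V lam r s) ^ k) χ = 0

/-- Resonance vectors. -/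
def IsResonanceVector (H V : D →ₗ[ℂ] E) (lam r : ℝ) (χ : E) : Prop :=
  ∃ k : ℕ, 1 ≤ k ∧ ResonanceEq H V lam r k χ

/-- The resonance vector `χ` has order `n`. -/
def HasOrder (H V : D →ₗ[ℂ] E) (lam r : ℝ) (χ : E) (n : ℕ) : Prop :=
  IsLeast {k : ℕ | ResonanceEq H V lam r k χ} n

/-- The order of the direction `V` at `H`: the least positive integer `d` such that every
resonance vector solves the resonance equation of order `d`. -/
def directionOrder (H V : D →ₗ[ℂ] E) (lam r : ℝ) : ℕ :=
  sInf {d : ℕ | 1 ≤ d ∧ ∀ χ, IsResonanceVector H V lam r χ → ResonanceEq H V lam r d χ}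

/-- The nilpotent operator `(2πi)⁻¹ ∮ (s - r) A_λ(s) ds` over a circle around `r` containing no
other resonance point; the integral is the same for all small radii `ε`. -/
def nilpotentA (H V : D →ₗ[ℂ] E) (lam r : ℝ) : E →L[ℂ] E :=
  limUnder (𝓝[>] (0 : ℝ)) fun ε =>
    (2 * (Real.pi : ℂ) * Complex.I)⁻¹ •
      ∮ s in C((r : ℂ), ε), (s - (r : ℂ)) • opA H V lam r s

/-- The resonance vector `χ` has depth at least `k`. -/
def DepthAtLeast (H V : D →ₗ[ℂ] E) (lam r : ℝ) (k : ℕ) (χ : E) : Prop :=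
  IsResonanceVector H V lam r χ ∧ ∃ f : E, ((nilpotentA H V lam r) ^ k) f = χ

/-! ### Paths of operators and tangency -/

/-- The path `P` is real-analytic near `r`: `s ↦ P(s) (T - i)⁻¹` is analytic in operator norm. -/
def IsAnalyticPathAt (T : D →ₗ[ℂ] E) (P : ℝ → D →ₗ[ℂ] E) (r : ℝ) : Prop :=
  ∃ B : ℝ → E →L[ℂ] E, AnalyticAt ℝ B r ∧
    ∀ᶠ s in 𝓝 r, ∀ x : D, B s (T x - Complex.I • (x : E)) = P s x

/-- `P` is (near `r`) an analytic path in the affine space `T + A₀`, all of whose points are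
`lam`-resonant. -/
def IsResonantPath (T : D →ₗ[ℂ] E) (A₀ : Submodule ℝ (D →ₗ[ℂ] E)) (lam r : ℝ)
    (P : ℝ → D →ₗ[ℂ] E) : Prop :=
  IsAnalyticPathAt T P r ∧ ∀ᶠ s in 𝓝 r, P s - T ∈ A₀ ∧ IsResonant (P s) lam

/-- `χ` is an analytic path of eigenvectors of `P` for the eigenvalue `lam`. -/
def IsResonantEigenpath (P : ℝ → D →ₗ[ℂ] E) (lam r : ℝ) (χ : ℝ → E) : Prop :=
  AnalyticAt ℝ χ r ∧ ∀ᶠ s in 𝓝 r, χ s ≠ 0 ∧ InEigenspace (P s) lam (χ s)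

/-- `P(s) = H + (s-r) V + ∑_{2 ≤ j < k} c_j (s-r)^j V + O((s-r)^k)` as `s → r`, where the error
is measured in the norm of operators from `D`, with the graph norm of `T`, to `E`. -/
def IsTangentPath (T H V : D →ₗ[ℂ] E) (r : ℝ) (k : ℕ) (c : ℕ → ℝ) (P : ℝ → D →ₗ[ℂ] E) : Prop :=
  ∃ C : ℝ, ∀ᶠ s in 𝓝 r, ∀ x : D,
    ‖P s x - (H x + (s - r) • V x + ∑ j ∈ Finset.Ico 2 k, (c j * (s - r) ^ j) • V x)‖
      ≤ C * |s - r| ^ k * (‖(x : E)‖ + ‖T x‖)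

/-- `V` is tangent at `H` to the resonance set in `T + A₀` to order at least `k`. -/
def IsTangentToOrder (T : D →ₗ[ℂ] E) (A₀ : Submodule ℝ (D →ₗ[ℂ] E)) (H V : D →ₗ[ℂ] E)
    (lam r : ℝ) (k : ℕ) : Prop :=
  ∃ (P : ℝ → D →ₗ[ℂ] E) (c : ℕ → ℝ), IsResonantPath T A₀ lam r P ∧ IsTangentPath T H V r k c P

/-! ### The resonance curve of an eigenvector -/

/-- The rank one direction `W = ⟨χ, ·⟩ χ`. -/
def rankOne (D : Submodule ℂ E) (χ : E) : D →ₗ[ℂ] E :=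
  ((innerSL ℂ χ).smulRight χ).toLinearMap ∘ₗ D.subtype

/-- The point `H + aV + tW` of the plane `H + ℝV + ℝW`, `W = ⟨χ, ·⟩ χ`. -/
def planePoint (H V : D →ₗ[ℂ] E) (χ : E) (a t : ℝ) : D →ₗ[ℂ] E :=
  H + a • V + t • rankOne D χ

/-- The resonance curve `γ_χ` exists and is the curve `a ↦ H + aV + b(a)W`: near `H`, the resonant
points of the plane `H + ℝV + ℝW` outside the line `H + ℝW` are exactly the points of this
analytic curve through `H`. -/
def IsResonanceCurve (H V : D →ₗ[ℂ] E) (lam : ℝ) (χ : E) (b : ℝ → ℝ) : Prop :=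
  AnalyticAt ℝ b 0 ∧ b 0 = 0 ∧
    ∀ᶠ p : ℝ × ℝ in 𝓝 (0 : ℝ × ℝ), p.1 ≠ 0 →
      (IsResonant (planePoint H V χ p.1 p.2) lam ↔ p.2 = b p.1)

/-- The curve `γ_χ` in the parametrisation given by `α`. -/
def curvePath (H V : D →ₗ[ℂ] E) (χ : E) (b α : ℝ → ℝ) (s : ℝ) : D →ₗ[ℂ] E :=
  planePoint H V χ (α s) (b (α s))

/-- `V` is tangent to the curve `γ_χ` to order at least `k` (in the parametrisation by `s - r`
the curve is `H + (s - r) V + O((s - r)^k)`). -/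
def IsTangentToCurve (T H V : D →ₗ[ℂ] E) (χ : E) (b : ℝ → ℝ) (r : ℝ) (k : ℕ) : Prop :=
  IsTangentPath T H V r k 0 (curvePath H V χ b fun s => s - r)

/-- Eigenvectors of `H` of depth at least `n`. -/
def deepEigenvectors (H V : D →ₗ[ℂ] E) (lam r : ℝ) (n : ℕ) : Set E :=
  {χ | χ ≠ 0 ∧ InEigenspace H lam χ ∧ DepthAtLeast H V lam r n χ}

/-- The Taylor coefficient `χ_j = χ^{(j)}(r) / j!`. -/
def taylorCoeff (χ : ℝ → E) (r : ℝ) (j : ℕ) : E :=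
  ((j.factorial : ℝ)⁻¹) • iteratedDeriv j χ r

end Resonance

end

/-! Let `P` be the orthogonal projection onto the eigenspace of `H` at `lam`, and let `S` be the
inverse of H - λ + P. The operator `B` = VS and its adjoint `C`, the extension of SV, are bounded,
and S(H + zV - λ) = 1 - P + zC on the domain, while (H + zV - λ)S = 1 - P + zB everywhere. The line
of unbounded operators is thus replaced by a linear pencil of bounded ones, a finite-rank
perturbation of 1 + zC. Regularity of V isolates the resonance, so the pencil has an inverse
z^{-(n+1)} M(z) near 0, with M analytic and M(0) ≠ 0 (`exists_isCore`).

Orders and depths are read off from the coefficients of M. With Q = 1 - P, resonance vectors are the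
ends of chains, Q mapping each link into the C-image of the previous space (`resonanceEq_iff`). The
nilpotent operator 𝐀 steps down a chain: Qx = -C𝐀x (`nil_mem_pred`, `nilpotentA_eq`). If a path
agrees with H + p(s)V up to O((s-r)^k), applying S to the eigenvalue equation gives (Q + p(s)C)χ(s)
= O((s-r)^k). Comparing Taylor coefficients yields the triangular system 𝐀χ_i = p_1 χ_{i-1} + ... +
p_i χ_0, hence 𝐀^i χ_i = p_1^i χ_0 ≠ 0: this contains the orders, the formula for 𝐀 and the depth
(`eigenpath_relation`, `of_triangular`, `nil_pow_triangular`).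

For the converse, λ is an eigenvalue of H + aV + tW_χ exactly when 1 + t⟨χ, (H + aV - λ)⁻¹χ⟩ = 0,
and the resolvent is a^{-(n+1)} M(a)S. Hence t = -a^{n+1}/⟨χ, M(a)Sχ⟩, which is analytic and
O(a^{n+1}) once ⟨χ, M(0)Sχ⟩ ≠ 0 (`exists_isResonanceCurve`). This condition is open. It is dense
among deep eigenvectors because M(0)S is symmetric and nonzero, and its range lies in the eigenspace
at maximal depth, so that small multiples of its values may be added
(`deepEigenvectors_subset_closure`). These curves are the resonant paths needed for the equivalence
of tangency and order. When only the initial value of the eigenpath is known to be collinear to χ,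
the eigenpath is paired with polynomial approximate eigenvectors built from a chain above χ
(`collinear_curve`). -/

noncomputable section
set_option linter.unusedSectionVars false

namespace Resonance

/-! ### Taylor coefficients and residues of analytic functions. -/

section Taylor

variable {𝕜 : Type*} [RCLike 𝕜] {F G : Type*} [NormedAddCommGroup F] [NormedSpace 𝕜 F]
  [NormedAddCommGroup G] [NormedSpace 𝕜 G]

/-- The Taylor coefficient `f^{(n)}(x) / n!`. -/
def taylorAt (𝕜 : Type*) [RCLike 𝕜] {F : Type*} [NormedAddCommGroup F] [NormedSpace 𝕜 F]
    (f : 𝕜 → F) (x : 𝕜) (n : ℕ) : F :=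
  ((n.factorial : 𝕜)⁻¹) • iteratedDeriv n f x

lemma taylorAt_congr {f g : 𝕜 → F} {x : 𝕜} (h : f =ᶠ[𝓝 x] g) (n : ℕ) :
    taylorAt 𝕜 f x n = taylorAt 𝕜 g x n := by
  unfold taylorAt
  rw [(h.iteratedDeriv n).eq_of_nhds]

@[simp] lemma taylorAt_zero (f : 𝕜 → F) (x : 𝕜) : taylorAt 𝕜 f x 0 = f x := by
  simp [taylorAt]

lemma taylorAt_const (v : F) (x : 𝕜) (n : ℕ) :
    taylorAt 𝕜 (fun _ => v) x n = if n = 0 then v else 0 := by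
  unfold taylorAt
  rw [iteratedDeriv_const]
  split_ifs with h
  · simp [h]
  · simp

variable [CompleteSpace F]

lemma taylorAt_add {f g : 𝕜 → F} {x : 𝕜} (hf : AnalyticAt 𝕜 f x) (hg : AnalyticAt 𝕜 g x) (n : ℕ) :
    taylorAt 𝕜 (fun s => f s + g s) x n = taylorAt 𝕜 f x n + taylorAt 𝕜 g x n := by
  unfold taylorAt
  rw [iteratedDeriv_fun_add hf.contDiffAt hg.contDiffAt, smul_add]

lemma taylorAt_clm {f : 𝕜 → F} {x : 𝕜} (L : F →L[𝕜] G) (hf : AnalyticAt 𝕜 f x) (n : ℕ) :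
    taylorAt 𝕜 (fun s => L (f s)) x n = L (taylorAt 𝕜 f x n) := by
  have h := L.iteratedFDeriv_comp_left (f := f) (x := x) (n := n) hf.contDiffAt le_rfl
  unfold taylorAt
  rw [map_smul, iteratedDeriv_eq_iteratedFDeriv, iteratedDeriv_eq_iteratedFDeriv]
  change _ • (iteratedFDeriv 𝕜 n (L ∘ f) x) _ = _
  rw [h]
  rfl

lemma taylorAt_smul {f : 𝕜 → 𝕜} {g : 𝕜 → F} {x : 𝕜} (hf : AnalyticAt 𝕜 f x)
    (hg : AnalyticAt 𝕜 g x) (n : ℕ) :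
    taylorAt 𝕜 (fun s => f s • g s) x n =
      ∑ i ∈ Finset.range (n + 1), taylorAt 𝕜 f x i • taylorAt 𝕜 g x (n - i) := by
  have h := iteratedDerivWithin_smul (n := n) (f := f) (g := g) (s := Set.univ) (x := x)
    (Set.mem_univ _) uniqueDiffOn_univ hf.contDiffAt.contDiffWithinAt
    hg.contDiffAt.contDiffWithinAt
  simp only [iteratedDerivWithin_univ] at h
  unfold taylorAt
  change _ • iteratedDeriv n (f • g) x = _
  rw [h, Finset.smul_sum]
  refine Finset.sum_congr rfl fun i hi => ?_
  have hi' : i ≤ n := Nat.lt_succ_iff.1 (Finset.mem_range.1 hi)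
  have hc : ((n.choose i : ℕ) : 𝕜) * i.factorial * (n - i).factorial = n.factorial := by
    exact_mod_cast Nat.choose_mul_factorial_mul_factorial hi'
  have h1 : (n.factorial : 𝕜) ≠ 0 := by exact_mod_cast n.factorial_ne_zero
  have h2 : (i.factorial : 𝕜) ≠ 0 := by exact_mod_cast i.factorial_ne_zero
  have h3 : ((n - i).factorial : 𝕜) ≠ 0 := by exact_mod_cast (n - i).factorial_ne_zero
  rw [← Nat.cast_smul_eq_nsmul 𝕜, smul_smul, smul_smul, smul_eq_mul, smul_smul]
  congr 1
  rw [← hc] at h1 ⊢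
  have h4 : ((n.choose i : ℕ) : 𝕜) ≠ 0 := by
    intro h0
    simp [h0] at h1
  field_simp

lemma taylorAt_sub_const (x : 𝕜) (n : ℕ) :
    taylorAt 𝕜 (fun s => s - x) x n = if n = 1 then 1 else 0 := by
  unfold taylorAt
  rw [iteratedDeriv_fun_sub (by fun_prop) (by fun_prop), iteratedDeriv_fun_id,
    iteratedDeriv_const]
  rcases n with _ | _ | n <;> simp

lemma taylorAt_sub_smul_succ {g : 𝕜 → F} {x : 𝕜} (hg : AnalyticAt 𝕜 g x) (n : ℕ) :
    taylorAt 𝕜 (fun s => (s - x) • g s) x (n + 1) = taylorAt 𝕜 g x n := by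
  rw [taylorAt_smul (by fun_prop) hg, Finset.sum_eq_single 1]
  · simp [taylorAt_sub_const]
  · intro b _ hb
    simp [taylorAt_sub_const, hb]
  · simp

lemma taylorAt_pow_smul (v : F) (x : 𝕜) (j n : ℕ) :
    taylorAt 𝕜 (fun s => (s - x) ^ j • v) x n = if n = j then v else 0 := by
  induction j generalizing n with
  | zero => simp [taylorAt_const]
  | succ j ih =>
    have h : (fun s : 𝕜 => (s - x) ^ (j + 1) • v) = fun s => (s - x) • ((s - x) ^ j • v) := by
      funext s
      rw [smul_smul, pow_succ']
    rw [h]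
    cases n with
    | zero => simp
    | succ n => rw [taylorAt_sub_smul_succ (by fun_prop), ih]; simp

lemma taylorAt_sum {ι : Type*} (u : Finset ι) {f : ι → 𝕜 → F} {x : 𝕜}
    (hf : ∀ i ∈ u, AnalyticAt 𝕜 (f i) x) (n : ℕ) :
    taylorAt 𝕜 (fun s => ∑ i ∈ u, f i s) x n = ∑ i ∈ u, taylorAt 𝕜 (f i) x n := by
  unfold taylorAt
  rw [iteratedDeriv_fun_sum (fun i hi => (hf i hi).contDiffAt), Finset.smul_sum]

/-- If the order of vanishing were m < k, dividing by (s-x)^m would force the nonzero leading value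
to be 0 in the limit. -/
lemma taylorAt_eq_zero_of_isBigO {f : 𝕜 → F} {x : 𝕜} {k : ℕ}
    (hf : AnalyticAt 𝕜 f x) (h : f =O[𝓝 x] fun s => (s - x) ^ k) {n : ℕ} (hn : n < k) :
    taylorAt 𝕜 f x n = 0 := by
  have key : (k : ℕ∞) ≤ analyticOrderAt f x := by
    by_contra hlt
    push Not at hlt
    obtain ⟨m, hm⟩ := ENat.ne_top_iff_exists.1 (ne_top_of_lt hlt)
    rw [← hm] at hlt
    have hmk : m < k := by exact_mod_cast hlt
    obtain ⟨g, hg, hg0, hfg⟩ := hf.analyticOrderAt_eq_natCast.1 hm.symm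
    have h1 : (fun s => (s - x) ^ m • g s) =O[𝓝 x] fun s => (s - x) ^ k :=
      h.congr' hfg EventuallyEq.rfl
    have h2 : Tendsto g (𝓝[≠] x) (𝓝 0) := by
      obtain ⟨c, hc⟩ := h1.bound
      have h3 : Tendsto (fun s : 𝕜 => c * ‖s - x‖ ^ (k - m)) (𝓝[≠] x) (𝓝 0) := by
        have : Continuous fun s : 𝕜 => c * ‖s - x‖ ^ (k - m) := by fun_prop
        have h4 := this.tendsto x
        simp only [sub_self, norm_zero, zero_pow (Nat.sub_ne_zero_of_lt hmk), mul_zero] at h4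
        exact h4.mono_left nhdsWithin_le_nhds
      refine squeeze_zero_norm' ?_ h3
      filter_upwards [hc.filter_mono nhdsWithin_le_nhds, self_mem_nhdsWithin] with s hs hne
      have hpos : 0 < ‖s - x‖ := norm_pos_iff.2 (sub_ne_zero.2 hne)
      rw [norm_smul, norm_pow, norm_pow, ← Nat.sub_add_cancel hmk.le, pow_add] at hs
      have hp : 0 < ‖s - x‖ ^ m := pow_pos hpos m
      refine le_of_mul_le_mul_left ?_ hp
      calc _ ≤ _ := hs
        _ = _ := by ring
    exact hg0 (tendsto_nhds_unique
      (hg.continuousAt.tendsto.mono_left (nhdsWithin_le_nhds (s := {x}ᶜ))) h2)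
  unfold taylorAt
  rw [(natCast_le_analyticOrderAt_iff_iteratedDeriv_eq_zero hf).1 key n hn, smul_zero]

lemma isBigO_of_taylorAt_eq_zero {f : 𝕜 → F} {x : 𝕜} {k : ℕ}
    (hf : AnalyticAt 𝕜 f x) (h : ∀ n < k, taylorAt 𝕜 f x n = 0) :
    f =O[𝓝 x] fun s => (s - x) ^ k := by
  have key : (k : ℕ∞) ≤ analyticOrderAt f x := by
    rw [natCast_le_analyticOrderAt_iff_iteratedDeriv_eq_zero hf]
    intro i hi
    have := h i hi
    unfold taylorAt at this
    exact (smul_eq_zero.1 this).resolve_left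
      (inv_ne_zero (by exact_mod_cast i.factorial_ne_zero))
  obtain ⟨g, hg, hfg⟩ := (natCast_le_analyticOrderAt hf).1 key
  have h1 : (fun s => (s - x) ^ k • g s) =O[𝓝 x] fun s => (s - x) ^ k • (1 : 𝕜) :=
    (Asymptotics.isBigO_refl _ _).smul (hg.continuousAt.isBigO_one 𝕜)
  exact (h1.congr' (EventuallyEq.symm hfg) EventuallyEq.rfl).congr_right (by simp)

/-- Cauchy's formula. The integral is constant for small radii, so the limit defining `nilpotentA`
is a Taylor coefficient. -/
lemma eventually_circleIntegral_eq_taylorAt {F : Type*} [NormedAddCommGroup F] [NormedSpace ℂ F]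
    [CompleteSpace F] {f G : ℂ → F} {r : ℂ} {n : ℕ} (hG : AnalyticAt ℂ G r)
    (hf : ∀ᶠ s in 𝓝[≠] r, f s = ((s - r) ^ (n + 1))⁻¹ • G s) :
    ∀ᶠ ε in 𝓝[>] (0 : ℝ), (2 * (Real.pi : ℂ) * Complex.I)⁻¹ • (∮ s in C(r, ε), f s) =
      taylorAt ℂ G r n := by
  have h1 : ∀ᶠ s in 𝓝 r, AnalyticAt ℂ G s ∧ (s ≠ r → f s = ((s - r) ^ (n + 1))⁻¹ • G s) :=
    hG.eventually_analyticAt.and (eventually_nhdsWithin_iff.1 hf)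
  obtain ⟨δ, hδ, hball⟩ := Metric.eventually_nhds_iff_ball.1 h1
  filter_upwards [Ioo_mem_nhdsGT hδ] with ε hε
  have hd : DifferentiableOn ℂ G (Metric.closedBall r ε) := fun s hs =>
    (hball s (Metric.closedBall_subset_ball hε.2 hs)).1.differentiableAt.differentiableWithinAt
  have h2 := hd.circleIntegral_one_div_sub_center_pow_smul hε.1 n
  rw [circleIntegral.integral_congr (g := fun z => (1 / (z - r) ^ (n + 1)) • G z) hε.1.le, h2,
    smul_smul, taylorAt]
  · congr 1
    field_simp [Complex.two_pi_I_ne_zero]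
  · intro s hs
    have hs' : s ∈ Metric.ball r δ :=
      Metric.closedBall_subset_ball hε.2 (Metric.sphere_subset_closedBall hs)
    simp only [one_div]
    refine (hball s hs').2 ?_
    rintro rfl
    simp at hs
    exact hε.1.ne hs

end Taylor

/-! ### Meromorphic inverses of finite-rank perturbations. -/

section FiniteRank

variable {X : Type*} [NormedAddCommGroup X] [NormedSpace ℂ X]

lemma analyticAt_det {ι : Type*} [Fintype ι] [DecidableEq ι] {m : ℂ → Matrix ι ι ℂ} {z₀ : ℂ}
    (hm : ∀ i j, AnalyticAt ℂ (fun z => m z i j) z₀) : AnalyticAt ℂ (fun z => (m z).det) z₀ := by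
  simp only [Matrix.det_apply]
  refine Finset.analyticAt_fun_sum _ fun σ _ => ?_
  simp only [Units.smul_def, zsmul_eq_mul]
  exact analyticAt_const.mul (Finset.analyticAt_fun_prod _ fun i _ => hm _ _)

lemma analyticAt_adjugate {ι : Type*} [Fintype ι] [DecidableEq ι] {m : ℂ → Matrix ι ι ℂ} {z₀ : ℂ}
    (hm : ∀ i j, AnalyticAt ℂ (fun z => m z i j) z₀) (i j : ι) :
    AnalyticAt ℂ (fun z => (m z).adjugate i j) z₀ := by
  simp only [Matrix.adjugate_apply]
  refine analyticAt_det fun a b => ?_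
  by_cases h : a = j
  · subst h
    simpa using analyticAt_const
  · simpa [Matrix.updateRow_ne h] using hm a b

lemma analyticAt_ringInverse {𝕜 : Type*} [NontriviallyNormedField 𝕜] {A : Type*} [NormedRing A]
    [NormedAlgebra 𝕜 A] [CompleteSpace A] {U : 𝕜 → A} {z₀ : 𝕜} (hU : AnalyticAt 𝕜 U z₀)
    (hU0 : IsUnit (U z₀)) : AnalyticAt 𝕜 (fun z => Ring.inverse (U z)) z₀ := by
  obtain ⟨u, hu⟩ := hU0
  have h : AnalyticAt 𝕜 Ring.inverse (U z₀) := hu ▸ analyticAt_inverse u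
  exact h.comp hU

/-- A finite rank perturbation of an analytic family of invertible operators has, near each point,
an "adjugate" with a scalar analytic "determinant", whose zeros are points of non-injectivity. -/
lemma exists_analytic_adjugate [CompleteSpace X] {ι : Type*} [Fintype ι] {e : ι → X}
    {φ : ι → X →L[ℂ] ℂ} (he : ∀ v : ι → ℂ, ∑ i, v i • e i = 0 → v = 0) {P : X →L[ℂ] X}
    (hP : ∀ x, P x = ∑ i, φ i x • e i) {U : ℂ → X →L[ℂ] X} {z₀ : ℂ} (hU : AnalyticAt ℂ U z₀)
    (hU0 : IsUnit (U z₀)) :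
    ∃ (δ : ℂ → ℂ) (Θ : ℂ → X →L[ℂ] X), AnalyticAt ℂ δ z₀ ∧ AnalyticAt ℂ Θ z₀ ∧
      ∀ᶠ z in 𝓝 z₀, (U z - P) * Θ z = δ z • 1 ∧ Θ z * (U z - P) = δ z • 1 ∧
        (δ z = 0 → ∃ x, x ≠ 0 ∧ (U z - P) x = 0) := by
  classical
  set Y : ℂ → X →L[ℂ] X := fun z => Ring.inverse (U z) with hY
  have hYa : AnalyticAt ℂ Y z₀ := analyticAt_ringInverse hU hU0
  -- The matrix of 1 - P U⁻¹ on the span of the `e i`; its determinant is the perturbation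
  -- determinant of U - P.
  let m : ℂ → Matrix ι ι ℂ := fun z => Matrix.of fun i j => (if i = j then 1 else 0) - φ i (Y z (e j))
  have hm : ∀ i j, AnalyticAt ℂ (fun z => m z i j) z₀ := fun i j => by
    have h1 : AnalyticAt ℂ (fun z => (φ i) ((ContinuousLinearMap.apply ℂ X (e j)) (Y z))) z₀ :=
      ((φ i).analyticAt _).comp (((ContinuousLinearMap.apply ℂ X (e j)).analyticAt _).comp hYa)
    exact analyticAt_const.sub h1
  -- The Woodbury formula for (U - P)⁻¹ multiplied by det m, which replaces m⁻¹ by the adjugate and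
  -- keeps the family analytic.
  let Θ : ℂ → X →L[ℂ] X := fun z => (m z).det • Y z +
    ∑ i, ∑ j, (m z).adjugate i j • (Y z * (φ j).smulRight (e i) * Y z)
  refine ⟨fun z => (m z).det, Θ, analyticAt_det hm, ?_, ?_⟩
  · refine ((analyticAt_det hm).smul hYa).add (Finset.analyticAt_fun_sum _ fun i _ =>
      Finset.analyticAt_fun_sum _ fun j _ => (analyticAt_adjugate hm i j).smul ?_)
    exact (hYa.mul analyticAt_const).mul hYa
  · have hunit : ∀ᶠ z in 𝓝 z₀, IsUnit (U z) :=
      hU.continuousAt.eventually (Units.isOpen.mem_nhds hU0)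
    filter_upwards [hunit] with z hz
    have hUY : ∀ x, U z (Y z x) = x := fun x => by
      have := Ring.mul_inverse_cancel _ hz
      exact congrArg (fun T : X →L[ℂ] X => T x) this
    have hYU : ∀ x, Y z (U z x) = x := fun x => by
      have := Ring.inverse_mul_cancel _ hz
      exact congrArg (fun T : X →L[ℂ] X => T x) this
    have hcomb : ∀ w : ι → ℂ, ∑ i, w i • (e i - P (Y z (e i))) = ∑ k, (m z).mulVec w k • e k := by
      intro w
      have hPY : ∀ j, e j - P (Y z (e j)) = ∑ i, m z i j • e i := fun j => by
        simp [m, hP, sub_smul, Finset.sum_sub_distrib]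
      simp only [hPY, Finset.smul_sum, smul_smul, Matrix.mulVec, dotProduct, Finset.sum_smul]
      rw [Finset.sum_comm]
      simp only [mul_comm]
    have hφY : ∀ x, (fun i => φ i (Y z (U z x - P x))) = (m z).mulVec fun j => φ j x := fun x => by
      funext i
      rw [map_sub, hYU, hP]
      simp only [map_sub, map_sum, map_smul, smul_eq_mul, m, Matrix.mulVec, dotProduct, Matrix.of_apply, sub_mul,
        ite_mul, one_mul, zero_mul, Finset.sum_sub_distrib, Finset.sum_ite_eq, Finset.mem_univ, if_true]
      simp_rw [mul_comm (φ i _)]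
    have hΘ : ∀ x, Θ z x = (m z).det • Y z x +
        ∑ i, (m z).adjugate.mulVec (fun j => φ j (Y z x)) i • Y z (e i) := fun x => by
      simp [Θ, Matrix.mulVec, dotProduct, Finset.sum_smul, smul_smul]
    refine ⟨?_, ?_, ?_⟩
    · ext x
      have h1 : (U z - P) (Θ z x) = (m z).det • (x - P (Y z x)) +
          ∑ i, (m z).adjugate.mulVec (fun j => φ j (Y z x)) i • (e i - P (Y z (e i))) := by
        rw [hΘ]
        simp [hUY, map_sum, Finset.sum_sub_distrib, smul_sub]
        abel
      change (U z - P) (Θ z x) = (m z).det • x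
      rw [h1, hcomb, Matrix.mulVec_mulVec, Matrix.mul_adjugate, Matrix.smul_mulVec,
        Matrix.one_mulVec, hP]
      simp [smul_sub, Finset.smul_sum, smul_smul]
    · ext x
      change Θ z (U z x - P x) = (m z).det • x
      rw [hΘ, hφY, Matrix.mulVec_mulVec, Matrix.adjugate_mul, Matrix.smul_mulVec,
        Matrix.one_mulVec, map_sub, hYU, hP]
      simp [smul_sub, Finset.smul_sum, smul_smul]
    · intro hdet
      obtain ⟨v, hv, hmv⟩ := Matrix.exists_mulVec_eq_zero_iff.2 hdet
      refine ⟨Y z (∑ j, v j • e j), fun h0 => hv (he v ?_), ?_⟩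
      · rw [← hUY (∑ j, v j • e j), h0, map_zero]
      · have : (U z - P) (Y z (∑ j, v j • e j)) = ∑ j, v j • (e j - P (Y z (e j))) := by
          simp [hUY, map_sum, smul_sub, Finset.sum_sub_distrib]
        rw [this, hcomb, hmv]
        simp

/-- An operator family with an analytic adjugate, invertible off a point where it is not injective,
has an inverse with a pole there. -/
lemma exists_pole {L Θ : ℂ → X →L[ℂ] X} {δ : ℂ → ℂ} (hL : AnalyticAt ℂ L 0)
    (hδ : AnalyticAt ℂ δ 0) (hΘ : AnalyticAt ℂ Θ 0)
    (h1 : ∀ᶠ z in 𝓝[≠] 0, L z * Θ z = δ z • 1 ∧ Θ z * L z = δ z • 1 ∧ δ z ≠ 0)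
    {x₀ : X} (hx₀ : x₀ ≠ 0) (hLx : L 0 x₀ = 0) :
    ∃ (n : ℕ) (M : ℂ → X →L[ℂ] X), AnalyticAt ℂ M 0 ∧ M 0 ≠ 0 ∧
      (∀ᶠ z in 𝓝 0, L z * M z = z ^ (n + 1) • 1 ∧ M z * L z = z ^ (n + 1) • 1) := by
  have hnt : (1 : X →L[ℂ] X) ≠ 0 := fun h => hx₀ (by
    simpa using congrArg (fun T : X →L[ℂ] X => T x₀) h)
  have hδ0 : ¬ ∀ᶠ z in 𝓝 0, δ z = 0 := fun h => by
    obtain ⟨z, hz, hz'⟩ := (h1.and (h.filter_mono nhdsWithin_le_nhds)).exists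
    exact hz.2.2 hz'
  have hΘ0 : ¬ ∀ᶠ z in 𝓝 0, Θ z = 0 := fun h => by
    obtain ⟨z, hz, hz'⟩ := (h1.and (h.filter_mono nhdsWithin_le_nhds)).exists
    have := hz.1
    rw [hz', mul_zero] at this
    exact hnt ((smul_eq_zero.1 this.symm).resolve_left hz.2.2)
  obtain ⟨p, u, hu, hu0, hδu⟩ := hδ.exists_eventuallyEq_pow_smul_nonzero_iff.2 hδ0
  obtain ⟨q, Θ', hΘ', hΘ'0, hΘΘ'⟩ := hΘ.exists_eventuallyEq_pow_smul_nonzero_iff.2 hΘ0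
  simp only [sub_zero, smul_eq_mul] at hδu hΘΘ'
  set M : ℂ → X →L[ℂ] X := fun z => (u z)⁻¹ • Θ' z with hM
  have hMa : AnalyticAt ℂ M 0 := (hu.inv hu0).smul hΘ'
  have hM0 : M 0 ≠ 0 := smul_ne_zero (inv_ne_zero hu0) hΘ'0
  have hune : ∀ᶠ z in 𝓝 0, u z ≠ 0 := hu.continuousAt.eventually_ne hu0
  have h2 : ∀ᶠ z in 𝓝[≠] 0, z ^ q • (L z * M z) = z ^ p • 1 ∧ z ^ q • (M z * L z) = z ^ p • 1 := by
    filter_upwards [h1, hδu.filter_mono nhdsWithin_le_nhds, hΘΘ'.filter_mono nhdsWithin_le_nhds,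
      hune.filter_mono nhdsWithin_le_nhds] with z ⟨ha, hb, _⟩ hd hT hun
    rw [hd, hT, mul_smul_comm] at ha
    rw [hd, hT, smul_mul_assoc] at hb
    constructor
    · simp only [hM, mul_smul_comm]
      rw [smul_comm, ha, smul_smul]
      congr 1
      field_simp
    · simp only [hM, smul_mul_assoc]
      rw [smul_comm, hb, smul_smul]
      congr 1
      field_simp
  -- If q ≥ p, the identity z^(q-p) M(z) L(z) x₀ = x₀ would tend to 0 = x₀. Hence the pole has
  -- positive order p - q.
  have hpq : q < p := by
    by_contra! hle
    have h3 : ∀ᶠ z in 𝓝[≠] 0, z ^ (q - p) • (M z (L z x₀)) = x₀ := by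
      filter_upwards [h2, self_mem_nhdsWithin] with z hz hne
      have h4 := congrArg (fun T : X →L[ℂ] X => T x₀) hz.2
      rw [← Nat.sub_add_cancel hle, pow_add, mul_comm, ← smul_smul] at h4
      exact smul_right_injective X (pow_ne_zero p hne) h4
    have hc : ContinuousAt (fun z => z ^ (q - p) • (M z (L z x₀))) 0 :=
      (continuousAt_id.pow _).smul
        (hMa.continuousAt.clm_apply (hL.continuousAt.clm_apply continuousAt_const))
    have h5 := tendsto_nhds_unique (hc.tendsto.mono_left nhdsWithin_le_nhds)
      (tendsto_const_nhds.congr' (h3.mono fun z hz => hz.symm))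
    simp [hLx] at h5
    exact hx₀ h5.symm
  obtain ⟨n, rfl⟩ : ∃ n, p = n + 1 + q := ⟨p - q - 1, by omega⟩
  refine ⟨n, M, hMa, hM0, ?_⟩
  have h6 : ∀ᶠ z in 𝓝[≠] 0, L z * M z = z ^ (n + 1) • 1 ∧ M z * L z = z ^ (n + 1) • 1 := by
    filter_upwards [h2, self_mem_nhdsWithin] with z hz hne
    have hinj := smul_right_injective (X →L[ℂ] X) (pow_ne_zero q hne)
    refine ⟨hinj ?_, hinj ?_⟩
    · simp only [hz.1, smul_smul]
      ring_nf
    · simp only [hz.2, smul_smul]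
      ring_nf
  -- Continuity extends both identities to the origin.
  have hca : ContinuousAt (fun z => L z * M z) 0 := hL.continuousAt.mul hMa.continuousAt
  have hcb : ContinuousAt (fun z => M z * L z) 0 := hMa.continuousAt.mul hL.continuousAt
  have hcc : ContinuousAt (fun z : ℂ => z ^ (n + 1) • (1 : X →L[ℂ] X)) 0 := by fun_prop
  have h7 : L 0 * M 0 = (0 : ℂ) ^ (n + 1) • 1 :=
    tendsto_nhds_unique (hca.tendsto.mono_left nhdsWithin_le_nhds)
      ((hcc.tendsto.mono_left nhdsWithin_le_nhds).congr' (h6.mono fun z hz => hz.1.symm))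
  have h8 : M 0 * L 0 = (0 : ℂ) ^ (n + 1) • 1 :=
    tendsto_nhds_unique (hcb.tendsto.mono_left nhdsWithin_le_nhds)
      ((hcc.tendsto.mono_left nhdsWithin_le_nhds).congr' (h6.mono fun z hz => hz.2.symm))
  filter_upwards [eventually_nhdsWithin_iff.1 h6] with z hz
  rcases eq_or_ne z 0 with rfl | hne
  · exact ⟨h7, h8⟩
  · exact hz hne

end FiniteRank

/-! ### Gaussian elimination over germs of analytic functions. -/

section Elimination

variable {X : Type*} [NormedAddCommGroup X] [InnerProductSpace ℂ X]

/-- Finitely many real-analytic vectors that are linearly dependent at all parameters near `r`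
satisfy an analytic linear relation that is nontrivial at `r`. -/
lemma exists_analytic_relation {r : ℝ} (n : ℕ) (m : Fin n → ℝ → X)
    (hm : ∀ i, AnalyticAt ℝ (m i) r)
    (hdep : ∀ᶠ s in 𝓝[≠] r, ∃ v : Fin n → ℂ, v ≠ 0 ∧ ∑ i, v i • m i s = 0) :
    ∃ v : Fin n → ℝ → ℂ, (∀ i, AnalyticAt ℝ (v i) r) ∧ (∃ i, v i r ≠ 0) ∧
      ∀ᶠ s in 𝓝 r, ∑ i, v i s • m i s = 0 := by
  induction n with
  | zero =>
    obtain ⟨s, v, hv, -⟩ := hdep.exists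
    exact absurd (Subsingleton.elim v 0) hv
  | succ n ih =>
    by_cases h0 : ∀ᶠ s in 𝓝 r, m (Fin.last n) s = 0
    · refine ⟨fun i _ => if i = Fin.last n then 1 else 0, fun i => analyticAt_const,
        ⟨Fin.last n, by simp⟩, ?_⟩
      filter_upwards [h0] with s hs
      simp [hs]
    · obtain ⟨p, g, hg, hg0, hmg⟩ := (hm (Fin.last n)).exists_eventuallyEq_pow_smul_nonzero_iff.2 h0
      -- The last vector, stripped of its power of s - r, is the pivot: pairing with g(r) gives a
      -- scalar that stays nonzero near r.
      let φ : X →L[ℝ] ℂ := (innerSL ℂ (g r)).restrictScalars ℝ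
      have hφ : ∀ (c : ℂ) (x : X), φ (c • x) = c * φ x := fun c x => by simp [φ]
      have hφa : ∀ {f : ℝ → X}, AnalyticAt ℝ f r → AnalyticAt ℝ (fun s => φ (f s)) r := fun hf =>
        (φ.analyticAt _).comp hf
      have hφg : ∀ᶠ s in 𝓝 r, φ (g s) ≠ 0 :=
        (hφa hg).continuousAt.eventually_ne (by simpa [φ] using hg0)
      let m' : Fin n → ℝ → X := fun i s => φ (g s) • m i.castSucc s - φ (m i.castSucc s) • g s
      have hm' : ∀ i, AnalyticAt ℝ (m' i) r := fun i =>
        ((hφa hg).smul (hm _)).sub ((hφa (hm _)).smul hg)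
      have hsum : ∀ (s : ℝ) (v : Fin n → ℂ), ∑ i, v i • m' i s =
          φ (g s) • ∑ i, v i • m i.castSucc s - φ (∑ i, v i • m i.castSucc s) • g s := by
        intro s v
        simp only [m', smul_sub, Finset.sum_sub_distrib, Finset.smul_sum, map_sum, hφ,
          Finset.sum_smul, smul_smul]
        simp only [mul_comm]
      have hdep' : ∀ᶠ s in 𝓝[≠] r, ∃ v : Fin n → ℂ, v ≠ 0 ∧ ∑ i, v i • m' i s = 0 := by
        filter_upwards [hdep, hmg.filter_mono nhdsWithin_le_nhds, hφg.filter_mono nhdsWithin_le_nhds,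
          self_mem_nhdsWithin] with s ⟨v, hv, hvs⟩ hms hgs hne
        rw [Fin.sum_univ_castSucc, hms] at hvs
        have hgs0 : g s ≠ 0 := fun h => hgs (by rw [h, map_zero])
        refine ⟨fun i => v i.castSucc, fun h => hv ?_, ?_⟩
        · have h' : ∀ i : Fin n, v i.castSucc = 0 := fun i => congrFun h i
          simp only [h', zero_smul, Finset.sum_const_zero, zero_add] at hvs
          have hl : v (Fin.last n) = 0 := (smul_eq_zero.1 hvs).resolve_right
            (smul_ne_zero (pow_ne_zero p (sub_ne_zero.2 hne)) hgs0)
          funext i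
          exact Fin.lastCases hl h' i
        · have h1 : ∑ i : Fin n, v i.castSucc • m i.castSucc s =
              (-(v (Fin.last n) * (((s - r) ^ p : ℝ) : ℂ))) • g s := by
            rw [neg_smul, ← smul_smul]
            exact eq_neg_of_add_eq_zero_left hvs
          rw [hsum, h1, hφ, smul_smul]
          rw [mul_comm, sub_self]
      obtain ⟨v, hva, ⟨i₀, hi₀⟩, hv⟩ := ih m' hm' hdep'
      -- The relation among the eliminated vectors, lifted back. The factor (s-r)^p compensates for
      -- using g in place of the last vector, and makes `w` possibly vanish at r.
      let w : ℝ → Fin (n + 1) → ℂ := fun s => Fin.snoc (α := fun _ => ℂ)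
        (fun i => (((s - r) ^ p : ℝ) : ℂ) * φ (g s) * v i s)
        (-φ (∑ i, v i s • m i.castSucc s))
      have hpa : AnalyticAt ℝ (fun s : ℝ => (((s - r) ^ p : ℝ) : ℂ)) r :=
        (Complex.ofRealCLM.analyticAt _).comp ((analyticAt_id.sub analyticAt_const).pow p)
      have hwa : AnalyticAt ℝ w r := by
        rw [analyticAt_pi_iff]
        intro i
        refine Fin.lastCases ?_ (fun i => ?_) i
        · simp only [Fin.snoc_last]
          exact (hφa (Finset.analyticAt_fun_sum _ fun i _ => (hva i).smul (hm _))).neg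
        · simp only [Fin.snoc_castSucc]
          exact (hpa.mul (hφa hg)).mul (hva i)
      have hw0 : ∀ᶠ s in 𝓝[≠] r, w s ≠ 0 := by
        filter_upwards [hφg.filter_mono nhdsWithin_le_nhds, self_mem_nhdsWithin,
          ((hva i₀).continuousAt.eventually_ne hi₀).filter_mono nhdsWithin_le_nhds] with s h1 h2 h3 h
        have := congrFun h i₀.castSucc
        simp only [w, Fin.snoc_castSucc, Pi.zero_apply] at this
        refine mul_ne_zero (mul_ne_zero ?_ h1) h3 this
        exact_mod_cast pow_ne_zero p (sub_ne_zero.2 h2)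
      have hws : ∀ᶠ s in 𝓝 r, ∑ i, w s i • m i s = 0 := by
        filter_upwards [hv, hmg] with s h1 h2
        rw [hsum, sub_eq_zero] at h1
        rw [Fin.sum_univ_castSucc, h2]
        simp only [w, Fin.snoc_castSucc, Fin.snoc_last]
        have h3 : ∑ i, ((((s - r) ^ p : ℝ) : ℂ) * φ (g s) * v i s) • m i.castSucc s =
            (((s - r) ^ p : ℝ) : ℂ) • φ (g s) • ∑ i, v i s • m i.castSucc s := by
          simp only [Finset.smul_sum, smul_smul, mul_assoc]
        rw [h3, h1, neg_smul, smul_comm (φ _) ((s - r) ^ p)]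
        exact add_neg_cancel _
      have hwne : ¬ ∀ᶠ s in 𝓝 r, w s = 0 := fun h => by
        obtain ⟨s, h1, h2⟩ := (hw0.and (h.filter_mono nhdsWithin_le_nhds)).exists
        exact h1 h2
      -- Dividing by the common order of vanishing restores nontriviality at r.
      obtain ⟨q, u, hu, hu0, hwu⟩ := hwa.exists_eventuallyEq_pow_smul_nonzero_iff.2 hwne
      have hua : ∀ i, AnalyticAt ℝ (fun s => u s i) r := analyticAt_pi_iff.1 hu
      refine ⟨fun i s => u s i, hua, ?_, ?_⟩
      · by_contra! h
        exact hu0 (funext h)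
      · have h1 : ∀ᶠ s in 𝓝[≠] r, ∑ i, u s i • m i s = 0 := by
          filter_upwards [hws.filter_mono nhdsWithin_le_nhds, hwu.filter_mono nhdsWithin_le_nhds,
            self_mem_nhdsWithin] with s h2 h3 h4
          rw [h3] at h2
          simp only [Pi.smul_apply, smul_assoc, ← Finset.smul_sum] at h2
          exact (smul_eq_zero.1 h2).resolve_left (pow_ne_zero q (sub_ne_zero.2 h4))
        have h2 : AnalyticAt ℝ (fun s => ∑ i, u s i • m i s) r :=
          Finset.analyticAt_fun_sum _ fun i _ => (hua i).smul (hm i)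
        exact h2.frequently_zero_iff_eventually_zero.1 h1.frequently

end Elimination

/-! ### Chains and Laurent coefficients of a linear pencil. -/

section Pencil

variable {X : Type*} [NormedAddCommGroup X] [NormedSpace ℂ X]

/-- The vectors `χ` that end a chain `χ₁, …, χₙ = χ` with `Q χ₁ = 0` and `Q χⱼ₊₁ ∈ ℂ C χⱼ`. -/
def chainSpace (Q C : X →L[ℂ] X) : ℕ → Submodule ℂ X
  | 0 => ⊥
  | n + 1 => ((chainSpace Q C n).map (C : X →ₗ[ℂ] X)).comap (Q : X →ₗ[ℂ] X)

lemma mem_chainSpace_succ {Q C : X →L[ℂ] X} {n : ℕ} {x : X} :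
    x ∈ chainSpace Q C (n + 1) ↔ ∃ g ∈ chainSpace Q C n, C g = Q x := Iff.rfl

lemma mem_chainSpace_one {Q C : X →L[ℂ] X} {x : X} : x ∈ chainSpace Q C 1 ↔ Q x = 0 := by
  rw [mem_chainSpace_succ]
  constructor
  · rintro ⟨g, hg, h⟩
    rw [(Submodule.mem_bot ℂ).1 hg, map_zero] at h
    exact h.symm
  · exact fun h => ⟨0, Submodule.zero_mem _, by rw [h, map_zero]⟩

/-- `m` is the sequence of coefficients of an expansion
`(Q + z C)⁻¹ = z ^ (-(n + 1)) ∑ z ^ j m j`. -/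
structure IsLaurentInverse (Q C : X →L[ℂ] X) (n : ℕ) (m : ℕ → X →L[ℂ] X) : Prop where
  left_zero : ∀ x, Q (m 0 x) = 0
  left_succ : ∀ j x, Q (m (j + 1) x) + C (m j x) = if j = n then x else 0
  right_zero : ∀ x, m 0 (Q x) = 0
  right_succ : ∀ j x, m (j + 1) (Q x) + m j (C x) = if j = n then x else 0

lemma isLaurentInverse_taylorAt [CompleteSpace X] {Q C : X →L[ℂ] X} {n : ℕ} {M : ℂ → X →L[ℂ] X}
    (hM : AnalyticAt ℂ M 0)
    (h : ∀ᶠ z in 𝓝 0, (Q + z • C) * M z = z ^ (n + 1) • 1 ∧ M z * (Q + z • C) = z ^ (n + 1) • 1) :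
    IsLaurentInverse Q C n (taylorAt ℂ M 0) := by
  have hpow : ∀ (x : X) (j : ℕ), taylorAt ℂ (fun z : ℂ => z ^ (n + 1) • x) 0 j =
      if j = n + 1 then x else 0 := fun x j => by
    simpa using taylorAt_pow_smul (𝕜 := ℂ) x 0 (n + 1) j
  have hMx : ∀ x, AnalyticAt ℂ (fun z => M z x) 0 := fun x =>
    ((ContinuousLinearMap.apply ℂ X x).analyticAt _).comp hM
  have htx : ∀ x j, taylorAt ℂ (fun z => M z x) 0 j = taylorAt ℂ M 0 j x := fun x j =>
    taylorAt_clm (ContinuousLinearMap.apply ℂ X x) hM j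
  have ha : ∀ (T : X →L[ℂ] X) {f : ℂ → X}, AnalyticAt ℂ f 0 → AnalyticAt ℂ (fun z => T (f z)) 0 :=
    fun T f hf => (T.analyticAt _).comp hf
  have hl : ∀ x j, taylorAt ℂ (fun z : ℂ => Q (M z x) + (z - 0) • C (M z x)) 0 j =
      if j = n + 1 then x else 0 := fun x j => by
    rw [← hpow]
    refine taylorAt_congr (h.mono fun z hz => ?_) j
    simpa using congrArg (fun T : X →L[ℂ] X => T x) hz.1
  have hr : ∀ x j, taylorAt ℂ (fun z : ℂ => M z (Q x) + (z - 0) • M z (C x)) 0 j =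
      if j = n + 1 then x else 0 := fun x j => by
    rw [← hpow]
    refine taylorAt_congr (h.mono fun z hz => ?_) j
    simpa using congrArg (fun T : X →L[ℂ] X => T x) hz.2
  have hid : AnalyticAt ℂ (fun z : ℂ => z - 0) 0 := by fun_prop
  refine ⟨fun x => ?_, fun j x => ?_, fun x => ?_, fun j x => ?_⟩
  · simpa using hl x 0
  · have := hl x (j + 1)
    have h1 : AnalyticAt ℂ (fun z : ℂ => (z - 0) • C (M z x)) 0 := hid.smul (ha C (hMx x))
    rw [taylorAt_add (ha Q (hMx x)) h1,
      taylorAt_sub_smul_succ (ha C (hMx x)), taylorAt_clm Q (hMx x), taylorAt_clm C (hMx x),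
      htx, htx] at this
    simpa using this
  · simpa using hr x 0
  · have := hr x (j + 1)
    have h1 : AnalyticAt ℂ (fun z : ℂ => (z - 0) • M z (C x)) 0 := hid.smul (hMx _)
    rw [taylorAt_add (hMx _) h1, taylorAt_sub_smul_succ (hMx _), htx, htx] at this
    simpa using this

namespace IsLaurentInverse

variable {Q C : X →L[ℂ] X} {n : ℕ} {m : ℕ → X →L[ℂ] X}

/-- The nilpotent operator of the pencil `Q + z C`. -/
def nil (Q : X →L[ℂ] X) (n : ℕ) (m : ℕ → X →L[ℂ] X) : X →L[ℂ] X := -(m n * Q)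

/-- Induction along the chain: with Qg = Cg', the coefficient identity m_{j+1}Qg + m_jCg = δ_{jn}g
loses its first term when j ≥ n. Thus m_nC is the identity on chain vectors; it is the Riesz
projection onto the resonance vectors. -/
lemma coeff_chain (h : IsLaurentInverse Q C n m) {N : ℕ} {g : X} (hg : g ∈ chainSpace Q C N) :
    (∀ j, n < j → m j (C g) = 0) ∧ m n (C g) = g := by
  induction N generalizing g with
  | zero =>
    rw [(Submodule.mem_bot ℂ).1 hg]
    simp
  | succ N ih =>
    obtain ⟨g', hg', hQ⟩ := hg
    change C g' = Q g at hQ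
    have h1 : ∀ j, n < j → m j (Q g) = 0 := fun j hj => by rw [← hQ, (ih hg').1 j hj]
    constructor
    · intro j hj
      have := h.right_succ j g
      rwa [h1 (j + 1) (by omega), zero_add, if_neg (by omega)] at this
    · have := h.right_succ n g
      rwa [h1 (n + 1) (by omega), zero_add, if_pos rfl] at this

/-- Turns any solution of Qx = -Cg with g a chain vector into the value of the nilpotent operator;
every later computation of this operator on a chain goes through it. -/
lemma nil_apply_of (h : IsLaurentInverse Q C n m) {N : ℕ} {g x : X} (hg : g ∈ chainSpace Q C N)
    (hx : Q x = -C g) : nil Q n m x = g := by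
  change -(m n (Q x)) = g
  rw [hx, map_neg, neg_neg, (h.coeff_chain hg).2]

lemma coeff_mem (h : IsLaurentInverse Q C n m) {j : ℕ} (hj : j ≤ n) (x : X) :
    m j x ∈ chainSpace Q C (j + 1) := by
  induction j with
  | zero => exact mem_chainSpace_one.2 (h.left_zero x)
  | succ j ih =>
    refine mem_chainSpace_succ.2 ⟨-m j x, neg_mem (ih (by omega)), ?_⟩
    have := h.left_succ j x
    rw [if_neg (by omega)] at this
    rw [map_neg, eq_neg_of_add_eq_zero_left this]

lemma nil_coeff (h : IsLaurentInverse Q C n m) {j : ℕ} (hj : j + 1 ≤ n) (x : X) :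
    nil Q n m (m (j + 1) x) = m j x := by
  refine h.nil_apply_of (h.coeff_mem (by omega) x) ?_
  have := h.left_succ j x
  rw [if_neg (by omega)] at this
  exact eq_neg_of_add_eq_zero_left this

/-- With i = 0 this shows that the range of the leading coefficient has depth at least j for every j
≤ n. -/
lemma nil_pow_coeff (h : IsLaurentInverse Q C n m) {j i : ℕ} (hj : i + j ≤ n) (x : X) :
    (nil Q n m ^ j) (m (i + j) x) = m i x := by
  induction j with
  | zero => rfl
  | succ j ih =>
    rw [pow_succ]
    change (nil Q n m ^ j) (nil Q n m (m (i + j + 1) x)) = _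
    rw [h.nil_coeff (by omega), ih (by omega)]

/-- Chain vectors are fixed by m_nC, and values of m_n are chain vectors of length n + 1; so chains
never need to be longer than the order of the pole. -/
lemma chainSpace_le (h : IsLaurentInverse Q C n m) {N : ℕ} {x : X} (hx : x ∈ chainSpace Q C N) :
    x ∈ chainSpace Q C (n + 1) := by
  rw [← (h.coeff_chain hx).2]
  exact h.coeff_mem le_rfl _

lemma nil_mem_pred (h : IsLaurentInverse Q C n m) {N : ℕ} {x : X}
    (hx : x ∈ chainSpace Q C (N + 1)) :
    nil Q n m x ∈ chainSpace Q C N ∧ Q x = -C (nil Q n m x) := by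
  obtain ⟨g, hg, hQ⟩ := mem_chainSpace_succ.1 hx
  have h1 : Q x = -C (-g) := by rw [map_neg, neg_neg, hQ]
  have h2 := h.nil_apply_of (neg_mem hg) h1
  rw [h2]
  exact ⟨neg_mem hg, h1⟩

lemma nil_mem (h : IsLaurentInverse Q C n m) (x : X) :
    nil Q n m x ∈ chainSpace Q C (n + 1) := neg_mem (h.coeff_mem le_rfl _)

/-- On resonance vectors the nilpotent operator goes one step down the chain, and a step down can be
reversed through Qx = -C(nil x). Orders thereby become kernels of powers. -/
lemma mem_chainSpace_iff (h : IsLaurentInverse Q C n m) {N : ℕ} {x : X}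
    (hx : x ∈ chainSpace Q C N) (k : ℕ) :
    x ∈ chainSpace Q C k ↔ (nil Q n m ^ k) x = 0 := by
  have hx' := h.chainSpace_le hx
  clear hx
  induction k generalizing x with
  | zero => simp [chainSpace]
  | succ k ih =>
    rw [pow_succ]
    change _ ↔ (nil Q n m ^ k) (nil Q n m x) = 0
    refine Iff.trans ?_ (ih (h.nil_mem x))
    constructor
    · exact fun hx => (h.nil_mem_pred hx).1
    · exact fun hx => mem_chainSpace_succ.2
        ⟨-nil Q n m x, neg_mem hx, by rw [map_neg, (h.nil_mem_pred hx').2]⟩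

/-- Every value of a power of `nil` is attained at a resonance vector. -/
lemma exists_mem_nil_eq (h : IsLaurentInverse Q C n m) (f : X) :
    ∃ f' ∈ chainSpace Q C (n + 1), nil Q n m f' = nil Q n m f := by
  -- The Riesz projection of f: for n ≥ 1, nil(m_nCf) = m_{n-1}Cf = -m_nQf. For n = 0 the nilpotent
  -- operator is zero.
  refine ⟨m n (C f), h.coeff_mem le_rfl _, ?_⟩
  rcases Nat.eq_zero_or_pos n with rfl | hn
  · change -(m 0 (Q _)) = -(m 0 (Q _))
    rw [h.right_zero, h.right_zero]
  · obtain ⟨j, rfl⟩ : ∃ j, n = j + 1 := ⟨n - 1, by omega⟩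
    rw [h.nil_coeff le_rfl]
    have := h.right_succ j f
    rw [if_neg (by omega)] at this
    exact eq_neg_of_add_eq_zero_right this

/-- Depth allows an arbitrary preimage; this replaces it by a resonance vector, on which the chain
relations are available. -/
lemma exists_mem_nil_pow_eq (h : IsLaurentInverse Q C n m) {k : ℕ} {f x : X}
    (hx : x ∈ chainSpace Q C (n + 1)) (hf : (nil Q n m ^ k) f = x) :
    ∃ f' ∈ chainSpace Q C (n + 1), (nil Q n m ^ k) f' = x := by
  cases k with
  | zero => exact ⟨x, hx, rfl⟩
  | succ k =>
    obtain ⟨f', hf', h1⟩ := h.exists_mem_nil_eq f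
    refine ⟨f', hf', ?_⟩
    rw [← hf, pow_succ]
    change (nil Q n m ^ k) (nil Q n m f') = (nil Q n m ^ k) (nil Q n m f)
    rw [h1]

lemma nil_pow_eq_zero (h : IsLaurentInverse Q C n m) {x : X} (hx : x ∈ chainSpace Q C (n + 1))
    {k : ℕ} (hk : n + 1 ≤ k) : (nil Q n m ^ k) x = 0 := by
  obtain ⟨i, rfl⟩ := Nat.exists_eq_add_of_le' hk
  rw [pow_add]
  change (nil Q n m ^ i) ((nil Q n m ^ (n + 1)) x) = 0
  rw [(h.mem_chainSpace_iff hx (n + 1)).1 hx, map_zero]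

lemma nil_pow_mem (h : IsLaurentInverse Q C n m) {x : X} (hx : x ∈ chainSpace Q C (n + 1))
    (k : ℕ) : (nil Q n m ^ k) x ∈ chainSpace Q C (n + 1) := by
  cases k with
  | zero => exact hx
  | succ k => rw [pow_succ']; exact h.nil_mem _

/-- Taylor coefficients of a solution of `(Q + (c₁ z + c₂ z² + ⋯) C) χ(z) = O(z ^ k)`. -/
lemma of_triangular (h : IsLaurentInverse Q C n m) {k : ℕ} {c : ℕ → ℝ} {x : ℕ → X}
    (hx : ∀ i < k, Q (x i) + ∑ j ∈ Finset.range i, c (j + 1) • C (x (i - (j + 1))) = 0) :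
    ∀ i < k, x i ∈ chainSpace Q C (i + 1) ∧
      nil Q n m (x i) = ∑ j ∈ Finset.range i, c (j + 1) • x (i - (j + 1)) := by
  intro i
  induction i using Nat.strong_induction_on with
  | _ i ih =>
    intro hi
    set g := ∑ j ∈ Finset.range i, c (j + 1) • x (i - (j + 1)) with hg
    have hmono : ∀ a b, a ≤ b → chainSpace Q C a ≤ chainSpace Q C b := by
      refine fun a b hab => monotone_nat_of_le_succ (f := chainSpace Q C) (fun j => ?_) hab
      induction j with
      | zero => exact bot_le
      | succ j ihj => exact Submodule.comap_mono (Submodule.map_mono ihj)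
    have hgm : g ∈ chainSpace Q C i := by
      refine Submodule.sum_mem _ fun j hj => ?_
      have hj' := Finset.mem_range.1 hj
      have h1 := hmono _ i (by omega) (ih (i - (j + 1)) (by omega) (by omega)).1
      rw [← Complex.coe_smul]
      exact Submodule.smul_mem _ _ h1
    have hQ : Q (x i) = -C g := by
      have h2 : C g = ∑ j ∈ Finset.range i, c (j + 1) • C (x (i - (j + 1))) := by
        rw [hg, map_sum]
        simp only [← Complex.coe_smul, map_smul]
      rw [h2]
      exact eq_neg_of_add_eq_zero_left (hx i hi)
    refine ⟨mem_chainSpace_succ.2 ⟨-g, neg_mem hgm, by rw [map_neg, hQ]⟩, h.nil_apply_of hgm hQ⟩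

/-- Only the term with coefficient c₁ survives i applications of a strictly triangular operator. For
c₁ ≠ 0 this gives both exact orders and the depth of x₀. -/
lemma nil_pow_triangular {k : ℕ} {c : ℕ → ℝ} {x : ℕ → X} {A : X →L[ℂ] X}
    (hx : ∀ i < k, A (x i) = ∑ j ∈ Finset.range i, c (j + 1) • x (i - (j + 1))) :
    ∀ i < k, (A ^ i) (x i) = c 1 ^ i • x 0 ∧ ∀ j, i < j → (A ^ j) (x i) = 0 := by
  intro i
  induction i using Nat.strong_induction_on with
  | _ i ih =>
    intro hi
    have hpow : ∀ p, (A ^ (p + 1)) (x i) =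
        ∑ j ∈ Finset.range i, c (j + 1) • (A ^ p) (x (i - (j + 1))) := fun p => by
      rw [pow_succ]
      change (A ^ p) (A (x i)) = _
      rw [hx i hi, map_sum]
      simp only [← Complex.coe_smul, map_smul]
    constructor
    · cases i with
      | zero => simp
      | succ i =>
        rw [hpow, Finset.sum_range_succ', Finset.sum_eq_zero]
        · rw [zero_add, Nat.add_sub_cancel, (ih i (by omega) (by omega)).1, smul_smul, pow_succ']
        · intro j hj
          have hj' := Finset.mem_range.1 hj
          rw [(ih _ (by omega) (by omega)).2 i (by omega), smul_zero]
    · intro p hp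
      obtain ⟨p, rfl⟩ : ∃ q, p = q + 1 := ⟨p - 1, by omega⟩
      rw [hpow]
      refine Finset.sum_eq_zero fun j hj => ?_
      have hj' := Finset.mem_range.1 hj
      rw [(ih _ (by omega) (by omega)).2 p (by omega), smul_zero]

end IsLaurentInverse

/-- The generalised eigenvectors of `A = (Q + z C)⁻¹ C` for `z⁻¹` are the chain vectors. -/
lemma pow_apply_eq_zero_iff {Q C A : X →L[ℂ] X} {z : ℂ}
    (hinj : Function.Injective (Q + z • C)) (hA : ∀ x, Q (A x) + z • C (A x) = C x) (k : ℕ) (x : X) :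
    ((1 - z • A) ^ k) x = 0 ↔ x ∈ chainSpace Q C k := by
  set R := 1 - z • A with hR
  have hLR : ∀ x, (Q + z • C) (R x) = Q x := fun x => by
    have := hA x
    have h1 : (Q + z • C) (R x) = Q x + z • C x - z • (Q (A x) + z • C (A x)) := by
      simp only [hR, add_apply, smul_apply, sub_apply, one_apply_eq_self, map_sub, map_smul,
        smul_add]
    rw [h1, this, add_sub_cancel_right]
  have hLA : ∀ x, (Q + z • C) (A x) = C x := hA
  have hcomm : ∀ (k : ℕ) x, (R ^ k) (A x) = A ((R ^ k) x) := fun k x => by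
    have h1 : Commute R A := (Commute.one_left A).sub_left ((Commute.refl A).smul_left z)
    exact congrArg (fun T : X →L[ℂ] X => T x) (h1.pow_left k).eq
  have hzA : ∀ x, z • A x = x - R x := fun x => by simp [hR]
  induction k generalizing x with
  | zero => simp [chainSpace]
  | succ k ih =>
    rw [mem_chainSpace_succ, pow_succ]
    change (R ^ k) (R x) = 0 ↔ _
    constructor
    · intro h
      -- On ker R^k the operator 1 - R = zA is inverted by the geometric sum; the preceding chain
      -- element is zW(Rx), since L(zAWRx) = LRx = Qx.
      obtain ⟨W, hW⟩ : ∃ W : X →L[ℂ] X, (1 - R) * W = 1 - R ^ k ∧ Commute W R := by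
        refine ⟨∑ i ∈ Finset.range k, R ^ i, ?_, ?_⟩
        · exact mul_neg_geom_sum R k
        · exact Commute.sum_left _ _ _ fun i _ => (Commute.refl R).pow_left i
      refine ⟨z • W (R x), ?_, ?_⟩
      · refine (ih _).1 ?_
        rw [map_smul]
        have : (R ^ k) (W (R x)) = W ((R ^ k) (R x)) :=
          congrArg (fun T : X →L[ℂ] X => T (R x)) (hW.2.pow_right k).eq.symm
        rw [this, h, map_zero, smul_zero]
      · have h1 : z • A (W (R x)) = R x := by
          rw [hzA]
          have := congrArg (fun T : X →L[ℂ] X => T (R x)) hW.1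
          have h2 : W (R x) - R (W (R x)) = R x - (R ^ k) (R x) := this
          rw [h2, h, sub_zero]
        rw [← hLA, ← hLR, map_smul, h1]
    · rintro ⟨g, hg, hgx⟩
      have h1 : R x = A g := hinj (by rw [hLR, hLA, hgx])
      rw [h1, hcomm, (ih g).2 hg, map_zero]

end Pencil

/-! ### Self-adjointness, relative compactness and reduced inverses. -/

section Operators

variable {E : Type*} [NormedAddCommGroup E] [InnerProductSpace ℂ E] [CompleteSpace E]
variable {D : Submodule ℂ E}

/-- `W` is symmetric on `D`. -/
def SymmOn (W : D →ₗ[ℂ] E) : Prop :=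
  ∀ x y : D, inner ℂ (W x) (y : E) = inner ℂ (x : E) (W y)

lemma SymmOn.add {V W : D →ₗ[ℂ] E} (hV : SymmOn V) (hW : SymmOn W) : SymmOn (V + W) := fun x y => by
  rw [LinearMap.add_apply, LinearMap.add_apply, inner_add_left, inner_add_right, hV, hW]

lemma SymmOn.sub {V W : D →ₗ[ℂ] E} (hV : SymmOn V) (hW : SymmOn W) : SymmOn (V - W) := fun x y => by
  rw [LinearMap.sub_apply, LinearMap.sub_apply, inner_sub_left, inner_sub_right, hV, hW]

lemma SymmOn.smul {V : D →ₗ[ℂ] E} (hV : SymmOn V) (a : ℝ) : SymmOn (a • V) := fun x y => by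
  simp only [LinearMap.smul_apply, ← Complex.coe_smul, inner_smul_left, inner_smul_right, hV x y,
    Complex.conj_ofReal]

lemma symmOn_rankOne (χ : E) : SymmOn (rankOne D χ) := fun x y => by
  change inner ℂ (inner ℂ χ (x : E) • χ) (y : E) = inner ℂ (x : E) (inner ℂ χ (y : E) • χ)
  rw [inner_smul_left, inner_smul_right, inner_conj_symm, mul_comm]

lemma ext_inner_dense (hD : Dense (D : Set E)) {x y : E}
    (h : ∀ u : D, inner ℂ x (u : E) = inner ℂ y (u : E)) : x = y := by
  exact hD.eq_of_inner_left (𝕜 := ℂ) fun v hv => h ⟨v, hv⟩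

lemma ext_clm_dense (hD : Dense (D : Set E)) {A B : E →L[ℂ] E} (h : ∀ u : D, A u = B u) : A = B :=
  ContinuousLinearMap.coeFn_injective
    (Continuous.ext_on hD A.continuous B.continuous fun x hx => h ⟨x, hx⟩)

/-- Symmetric operators on `D` become bounded when composed with a bounded map into `D`. -/
lemma exists_clm_comp (hD : Dense (D : Set E)) {W : D →ₗ[ℂ] E} (hW : SymmOn W) (J : E →L[ℂ] E)
    (hJ : ∀ x, J x ∈ D) : ∃ B : E →L[ℂ] E, ∀ x, B x = W ⟨J x, hJ x⟩ := by
  let L : E →ₗ[ℂ] E := W ∘ₗ ((J : E →ₗ[ℂ] E).codRestrict D hJ)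
  have hL : ∀ x, L x = W ⟨J x, hJ x⟩ := fun x => rfl
  have hc : Continuous L := by
    refine L.continuous_of_seq_closed_graph fun u x y hu hLu => ext_inner_dense hD fun w => ?_
    have h1 : Tendsto (fun n => inner ℂ (L (u n)) (w : E)) atTop (𝓝 (inner ℂ y (w : E))) :=
      hLu.inner tendsto_const_nhds
    have h2 : Tendsto (fun n => inner ℂ (J (u n)) (W w)) atTop (𝓝 (inner ℂ (J x) (W w))) :=
      ((J.continuous.tendsto x).comp hu).inner tendsto_const_nhds
    have h3 : ∀ v, inner ℂ (L v) (w : E) = inner ℂ (J v) (W w) := fun v => hW ⟨J v, hJ v⟩ w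
    simp only [h3] at h1
    rw [tendsto_nhds_unique h1 h2, h3]
  exact ⟨⟨L, hc⟩, fun x => rfl⟩

/-- The adjoint of a compact operator on a Hilbert space is compact. -/
lemma isCompactOperator_adjoint {K : E →L[ℂ] E} (hK : IsCompactOperator K) :
    IsCompactOperator (ContinuousLinearMap.adjoint K) := by
  set K' := ContinuousLinearMap.adjoint K with hK'
  have h1 : IsCompactOperator (K ∘L K') := hK.comp_clm K'
  have h2 : IsCompact (closure ((K ∘L K') '' Metric.closedBall 0 1)) :=
    h1.isCompact_closure_image_closedBall 1
  have h3 : TotallyBounded ((K ∘L K') '' Metric.closedBall 0 1) :=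
    h2.totallyBounded.subset subset_closure
  suffices h : TotallyBounded (K' '' Metric.closedBall 0 1) from
    (isCompactOperator_iff_isCompact_closure_image_closedBall (K' : E →ₗ[ℂ] E) one_pos).2
      (h.closure.isCompact_of_isClosed isClosed_closure)
  -- ‖K*u‖² = ⟨u, KK*u⟩ with ‖u‖ ≤ 2, so a finite net for the image of the ball under the compact
  -- KK* pulls back to one for K*.
  have hest : ∀ x y : E, ‖x‖ ≤ 1 → ‖y‖ ≤ 1 → ‖K' x - K' y‖ ^ 2 ≤ 2 * ‖K (K' x) - K (K' y)‖ := by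
    intro x y hx hy
    have h4 : inner ℂ (K' (x - y)) (K' (x - y)) = inner ℂ (x - y) (K (K' (x - y))) := by
      rw [hK', ContinuousLinearMap.adjoint_inner_left]
    rw [← map_sub, ← map_sub K, ← map_sub, ← inner_self_eq_norm_sq (𝕜 := ℂ), h4]
    calc _ ≤ ‖inner ℂ (x - y) (K (K' (x - y)))‖ := RCLike.re_le_norm _
      _ ≤ ‖x - y‖ * ‖K (K' (x - y))‖ := norm_inner_le_norm _ _
      _ ≤ _ := by
        gcongr
        linarith [norm_sub_le x y]
  rw [Metric.totallyBounded_iff]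
  intro ε hε
  obtain ⟨t, hts, htf, htc⟩ := Metric.finite_approx_of_totallyBounded h3 (ε ^ 2 / 2) (by positivity)
  have hts' : ∀ y ∈ t, ∃ x ∈ Metric.closedBall (0 : E) 1, (K ∘L K') x = y := fun y hy => hts hy
  choose! g hg1 hg2 using hts'
  refine ⟨(fun y => K' (g y)) '' t, htf.image _, ?_⟩
  rintro _ ⟨x, hx, rfl⟩
  obtain ⟨y, hy, hxy⟩ := Set.mem_iUnion₂.1 (htc ⟨x, hx, rfl⟩)
  refine Set.mem_iUnion₂.2 ⟨K' (g y), ⟨y, hy, rfl⟩, ?_⟩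
  rw [Metric.mem_ball, dist_eq_norm] at hxy ⊢
  have h5 := hest x (g y) (by simpa using hx) (by simpa using hg1 y hy)
  have h6 : K (K' (g y)) = y := hg2 y hy
  rw [h6] at h5
  have h7 : ‖K (K' x) - y‖ < ε ^ 2 / 2 := hxy
  exact lt_of_pow_lt_pow_left₀ 2 hε.le (by linarith)

/-- The field `maximal` says that the adjoint does not extend T; it puts vectors orthogonal to a
range into the domain. -/
structure IsSelfAdjointOn (T : D →ₗ[ℂ] E) : Prop where
  dense : Dense (D : Set E)
  symm : SymmOn T
  maximal : ∀ y w : E, (∀ x : D, inner ℂ w (x : E) = inner ℂ y (T x)) → ∃ h : y ∈ D, T ⟨y, h⟩ = w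

lemma isSelfAdjointOn_of_isSelfAdjoint {H₀ : E →ₗ.[ℂ] E} (hd : Dense (H₀.domain : Set E))
    (h : IsSelfAdjoint H₀) : IsSelfAdjointOn H₀.toFun := by
  have hadj : H₀.adjoint = H₀ := h
  have hform := LinearPMap.adjoint_isFormalAdjoint hd
  have hmax : ∀ y w : E, (∀ x : H₀.domain, inner ℂ w (x : E) = inner ℂ y (H₀.toFun x)) →
      ∃ h : y ∈ H₀.adjoint.domain, H₀.adjoint ⟨y, h⟩ = w := fun y w hyw => by
    have hy := LinearPMap.mem_adjoint_domain_of_exists (T := H₀) y ⟨w, hyw⟩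
    exact ⟨hy, LinearPMap.adjoint_apply_eq hd ⟨y, hy⟩ hyw⟩
  rw [hadj] at hform hmax
  exact ⟨hd, hform, hmax⟩

/-- The eigenspace of `H` at `lam`, as a subspace of the ambient space. -/
def eigenSub (H : D →ₗ[ℂ] E) (lam : ℝ) : Submodule ℂ E :=
  (LinearMap.ker (shift H lam)).map D.subtype

lemma mem_eigenSub {H : D →ₗ[ℂ] E} {lam : ℝ} {x : E} :
    x ∈ eigenSub H lam ↔ InEigenspace H lam x := by
  constructor
  · rintro ⟨y, hy, rfl⟩
    refine ⟨y.2, ?_⟩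
    have : H y - (lam : ℂ) • (y : E) = 0 := hy
    exact sub_eq_zero.1 this
  · rintro ⟨h, hx⟩
    refine ⟨⟨x, h⟩, ?_, rfl⟩
    change H ⟨x, h⟩ - (lam : ℂ) • x = 0
    rw [hx, sub_self]

/-- `S` is the inverse of `H - lam + P`, where `P` is the orthogonal projection onto the
finite-dimensional eigenspace of `H` at `lam`. -/
structure IsReducedInverse (H : D →ₗ[ℂ] E) (lam : ℝ) (P S : E →L[ℂ] E) : Prop where
  finite : FiniteDimensional ℂ (eigenSub H lam)
  proj_mem : ∀ x, P x ∈ eigenSub H lam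
  proj_eq : ∀ x ∈ eigenSub H lam, P x = x
  proj_symm : ∀ x y, inner ℂ (P x) y = inner ℂ x (P y)
  mem : ∀ x, S x ∈ D
  right : ∀ x, H ⟨S x, mem x⟩ - (lam : ℂ) • S x + P (S x) = x
  left : ∀ x : D, S (H x - (lam : ℂ) • (x : E) + P x) = x
  symm : ∀ x y, inner ℂ (S x) y = inner ℂ x (S y)

lemma inner_shift_eq_zero {H : D →ₗ[ℂ] E} {lam : ℝ} (hH : SymmOn H) {v : E}
    (hv : InEigenspace H lam v) (x : D) : inner ℂ v (H x - (lam : ℂ) • (x : E)) = 0 := by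
  obtain ⟨h, hv⟩ := hv
  rw [inner_sub_right, ← hH ⟨v, h⟩ x, hv, inner_smul_left, inner_smul_right, Complex.conj_ofReal,
    sub_self]

lemma inner_shift_symm {H : D →ₗ[ℂ] E} {lam : ℝ} (hH : SymmOn H) (x y : D) :
    inner ℂ (H x - (lam : ℂ) • (x : E)) (y : E) = inner ℂ (x : E) (H y - (lam : ℂ) • (y : E)) := by
  rw [inner_sub_right, inner_sub_left, hH x y, inner_smul_left, inner_smul_right,
    Complex.conj_ofReal]

/-- By symmetry the range of H - λ is orthogonal to the eigenspace, so both summands vanish; then x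
is an eigenvector with zero projection. -/
lemma eq_zero_of_shift_add_proj {H : D →ₗ[ℂ] E} {lam : ℝ} (hH : SymmOn H)
    [(eigenSub H lam).HasOrthogonalProjection] {x : D}
    (hx : H x - (lam : ℂ) • (x : E) + (eigenSub H lam).starProjection x = 0) : x = 0 := by
  set p := (eigenSub H lam).starProjection (x : E) with hp
  have hpm : p ∈ eigenSub H lam := Submodule.starProjection_apply_mem _ _
  have h1 : inner ℂ p p = 0 := by
    have h2 := inner_shift_eq_zero hH (mem_eigenSub.1 hpm) x
    rw [eq_neg_of_add_eq_zero_left hx, inner_neg_right, neg_eq_zero] at h2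
    exact h2
  have hp0 : p = 0 := inner_self_eq_zero.1 h1
  rw [hp0, add_zero, sub_eq_zero] at hx
  have h3 : (x : E) ∈ eigenSub H lam := mem_eigenSub.2 ⟨x.2, hx⟩
  have h4 : (eigenSub H lam).starProjection (x : E) = x := Submodule.starProjection_eq_self_iff.2 h3
  exact Subtype.ext (h4.symm.trans hp0)

/-- The inverse is everywhere defined and symmetric, hence bounded by Hellinger–Toeplitz. -/
lemma exists_reducedInverse_of_surjective {H : D →ₗ[ℂ] E} {lam : ℝ} (hH : SymmOn H)
    [hfin : FiniteDimensional ℂ (eigenSub H lam)]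
    (hsurj : ∀ y : E, ∃ x : D, H x - (lam : ℂ) • (x : E) + (eigenSub H lam).starProjection x = y) :
    ∃ S, IsReducedInverse H lam (eigenSub H lam).starProjection S := by
  set P := (eigenSub H lam).starProjection with hP
  let F : D →ₗ[ℂ] E := shift H lam + (P : E →ₗ[ℂ] E) ∘ₗ D.subtype
  have hF : ∀ x : D, F x = H x - (lam : ℂ) • (x : E) + P x := fun x => rfl
  have hinj : Function.Injective F := by
    rw [← LinearMap.ker_eq_bot, LinearMap.ker_eq_bot']
    exact fun x hx => eq_zero_of_shift_add_proj hH hx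
  let e : D ≃ₗ[ℂ] E := LinearEquiv.ofBijective F ⟨hinj, hsurj⟩
  have he : ∀ x, F (e.symm x) = x := fun x => e.apply_symm_apply x
  have hPs : ∀ x y, inner ℂ (P x) y = inner ℂ x (P y) :=
    Submodule.inner_starProjection_left_eq_right _
  have hFs : ∀ x y : D, inner ℂ (F x) (y : E) = inner ℂ (x : E) (F y) := fun x y => by
    rw [hF, hF, inner_add_left, inner_add_right, inner_shift_symm hH, hPs]
  let S₀ : E →ₗ[ℂ] E := D.subtype ∘ₗ e.symm.toLinearMap
  have hS₀ : S₀.IsSymmetric := fun x y => by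
    change inner ℂ ((e.symm x : D) : E) y = inner ℂ x ((e.symm y : D) : E)
    conv_lhs => rw [← he y]
    conv_rhs => rw [← he x]
    rw [hFs]
  refine ⟨⟨S₀, hS₀.continuous⟩, ⟨hfin, Submodule.starProjection_apply_mem _,
    fun x hx => Submodule.starProjection_eq_self_iff.2 hx, hPs, fun x => (e.symm x).2,
    fun x => (hF (e.symm x)).symm.trans (he x), fun x => ?_, hS₀⟩⟩
  change ((e.symm (e x) : D) : E) = x
  rw [e.symm_apply_apply]

/-- The range of T - λ is closed and, by maximality, its orthogonal complement consists of
eigenvectors. So y - Py is in the range, and correcting the preimage by eigenvectors solves the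
equation for y. -/
lemma exists_reducedInverse_of_notMem_essentialSpectrum {T : D →ₗ[ℂ] E} (hT : IsSelfAdjointOn T)
    {lam : ℝ} (hlam : (lam : ℂ) ∉ essentialSpectrum T) :
    ∃ P S, IsReducedInverse T lam P S := by
  simp only [essentialSpectrum, Set.mem_ofPred_eq, not_not] at hlam
  obtain ⟨hfin, hcl, -⟩ := hlam
  have hfin' : FiniteDimensional ℂ (eigenSub T lam) := by unfold eigenSub; infer_instance
  refine ⟨_, exists_reducedInverse_of_surjective hT.symm fun y => ?_⟩
  set P := (eigenSub T lam).starProjection with hP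
  set Rg := LinearMap.range (shift T lam) with hRg
  have : CompleteSpace Rg := hcl.completeSpace_coe
  have horth : Rgᗮ ≤ eigenSub T lam := fun v hv => by
    rw [mem_eigenSub]
    refine hT.maximal v _ fun x => ?_
    have h1 : inner ℂ v (shift T lam x) = 0 := by
      rw [← inner_conj_symm, (Submodule.mem_orthogonal _ _).1 hv _ ⟨x, rfl⟩, map_zero]
    have h2 : shift T lam x = T x - (lam : ℂ) • (x : E) := rfl
    rw [h2, inner_sub_right, inner_smul_right, sub_eq_zero] at h1
    rw [inner_smul_left, Complex.conj_ofReal, h1]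
  have hy : y - P y ∈ Rg := by
    rw [← Submodule.orthogonal_orthogonal Rg]
    exact Submodule.orthogonal_le horth (Submodule.sub_starProjection_mem_orthogonal y)
  obtain ⟨x, hx⟩ := hy
  have hPm : ∀ z, InEigenspace T lam (P z) := fun z =>
    mem_eigenSub.1 (Submodule.starProjection_apply_mem _ _)
  have hPP : ∀ z, P (P z) = P z := fun z =>
    Submodule.starProjection_eq_self_iff.2 (Submodule.starProjection_apply_mem _ _)
  obtain ⟨h1, h1'⟩ := hPm x
  obtain ⟨h2, h2'⟩ := hPm y
  refine ⟨x - ⟨P x, h1⟩ + ⟨P y, h2⟩, ?_⟩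
  have hx' : T x - (lam : ℂ) • (x : E) = y - P y := hx
  have h3 : P ((x - ⟨P x, h1⟩ + ⟨P y, h2⟩ : D) : E) = P y := by
    simp [hPP]
  rw [h3, map_add, map_sub, h1', h2', Submodule.coe_add, Submodule.coe_sub, smul_add, smul_sub]
  calc _ = T x - (lam : ℂ) • (x : E) + P y := by abel
    _ = y := by rw [hx', sub_add_cancel]

lemma finiteDimensional_of_compact {K : E →L[ℂ] E} (hK : IsCompactOperator K) (V : Submodule ℂ E)
    (hV : ∀ x ∈ V, K x = x) : FiniteDimensional ℂ V := by
  set N := LinearMap.ker ((1 - K : E →L[ℂ] E) : E →ₗ[ℂ] E) with hN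
  have hmem : ∀ x, x ∈ N ↔ K x = x := fun x => by
    rw [hN, LinearMap.mem_ker]
    change x - K x = 0 ↔ _
    rw [sub_eq_zero, eq_comm]
  have hcl : IsClosed (N : Set E) := (1 - K : E →L[ℂ] E).isClosed_ker
  have hNc : CompleteSpace N := hcl.completeSpace_coe
  have hfin : FiniteDimensional ℂ N := by
    refine FiniteDimensional.of_isCompactOperator_id (𝕜 := ℂ) ?_
    have h1 : ∀ v ∈ N, (K : E →ₗ[ℂ] E) v ∈ N := fun v hv => by
      change K v ∈ N
      rwa [(hmem v).1 hv]
    have h2 := IsCompactOperator.restrict' (f := (K : E →ₗ[ℂ] E)) hK h1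
    have h3 : (id : N → N) = (K : E →ₗ[ℂ] E).restrict h1 :=
      funext fun v => Subtype.ext ((hmem v).1 v.2).symm
    rw [h3]
    exact h2
  exact Submodule.finiteDimensional_of_le (S₂ := N) fun x hx => (hmem x).2 (hV x hx)

/-- Relative compactness places the resolvent to the left of W; taking adjoints moves it to the
right, as WJ = K*(T - z̄)J. -/
lemma isCompactOperator_comp_of_isDirection {T W : D →ₗ[ℂ] E} (hD : Dense (D : Set E))
    (hTs : SymmOn T) (hW : IsDirection T W)
    {J : E →L[ℂ] E} (hJ : ∀ x, J x ∈ D) {B : E →L[ℂ] E} (hB : ∀ x, B x = W ⟨J x, hJ x⟩) :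
    IsCompactOperator B := by
  obtain ⟨hWs, z, K, ⟨R, hR, hK⟩, hKc⟩ := hW
  obtain ⟨TJ, hTJ⟩ := exists_clm_comp hD hTs J hJ
  have : B = ContinuousLinearMap.adjoint K ∘L (TJ - (starRingEnd ℂ z) • J) := by
    ext x
    refine ext_inner_dense hD fun y => ?_
    change _ = inner ℂ (ContinuousLinearMap.adjoint K (TJ x - (starRingEnd ℂ z) • J x)) (y : E)
    obtain ⟨hm, hm'⟩ := hR.1 (W y)
    rw [ContinuousLinearMap.adjoint_inner_left, hK, hB, hWs, hTJ, inner_sub_left, inner_smul_left,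
      Complex.conj_conj]
    have := hTs ⟨J x, hJ x⟩ ⟨R (W y), hm⟩
    simp only at this
    rw [this]
    conv_lhs => rw [← hm']
    rw [inner_sub_right, inner_smul_right]
  rw [this]
  exact (isCompactOperator_adjoint hKc).comp_clm _

/-- With `G` the reduced inverse of T, (H - λ)G differs from the identity by a compact operator.
This makes the eigenspace of H finite-dimensional, and the Fredholm alternative then makes H - λ + P
onto. -/
lemma exists_reducedInverse {T H : D →ₗ[ℂ] E} (hD : Dense (D : Set E)) (hTs : SymmOn T) {lam : ℝ}
    {P₀ G : E →L[ℂ] E} (hG : IsReducedInverse T lam P₀ G) (hW : IsDirection T (H - T)) :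
    ∃ P S, IsReducedInverse H lam P S := by
  have hWs : SymmOn (H - T) := hW.1
  have hHs : SymmOn H := by
    have := hTs.add hWs
    rwa [add_sub_cancel] at this
  obtain ⟨B, hB⟩ := exists_clm_comp hD hWs G hG.mem
  have hBc := isCompactOperator_comp_of_isDirection hD hTs hW hG.mem hB
  have hP₀c : IsCompactOperator P₀ := by
    have := hG.finite
    let P' : E →L[ℂ] eigenSub T lam := P₀.codRestrict _ hG.proj_mem
    have hpr : ProperSpace (eigenSub T lam) := FiniteDimensional.proper ℂ _
    have h1 : IsCompactOperator P' := isCompactOperator_of_locallyCompactSpace_dom P'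
    exact h1.clm_comp (eigenSub T lam).subtypeL
  have hHG : ∀ x, H ⟨G x, hG.mem x⟩ - (lam : ℂ) • G x = x + (B x - P₀ (G x)) := fun x => by
    rw [hB, LinearMap.sub_apply]
    conv_rhs => enter [1]; rw [← hG.right x]
    abel
  have hfin : FiniteDimensional ℂ (eigenSub H lam) := by
    let K := P₀ ∘L G - B
    have hK : IsCompactOperator K := (hP₀c.comp_clm G).sub hBc
    set N := LinearMap.ker ((1 - K : E →L[ℂ] E) : E →ₗ[ℂ] E) with hN
    have hNf : FiniteDimensional ℂ N := finiteDimensional_of_compact hK N fun x hx => by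
      rw [hN, LinearMap.mem_ker] at hx
      exact (sub_eq_zero.1 (show x - K x = 0 from hx)).symm
    refine Submodule.finiteDimensional_of_le (S₂ := N.map (G : E →ₗ[ℂ] E)) fun v hv => ?_
    obtain ⟨hv1, hv2⟩ := mem_eigenSub.1 hv
    obtain ⟨u, rfl⟩ : ∃ u, G u = v := ⟨_, hG.left ⟨v, hv1⟩⟩
    refine ⟨u, ?_, rfl⟩
    have h1 := hHG u
    rw [hv2, sub_self] at h1
    change u - (P₀ (G u) - B u) = 0
    rw [h1]
    abel
  refine ⟨_, exists_reducedInverse_of_surjective hHs fun y => ?_⟩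
  set P := (eigenSub H lam).starProjection with hP
  have hPc : IsCompactOperator P := by
    have hpr : ProperSpace (eigenSub H lam) := FiniteDimensional.proper ℂ _
    have h1 : IsCompactOperator (eigenSub H lam).orthogonalProjectionOnto :=
      isCompactOperator_of_locallyCompactSpace_dom _
    exact h1.clm_comp (eigenSub H lam).subtypeL
  let K : E →L[ℂ] E := B - P₀ ∘L G + P ∘L G
  have hK : IsCompactOperator K := (hBc.sub (hP₀c.comp_clm G)).add (hPc.comp_clm G)
  have hKG : ∀ x, H ⟨G x, hG.mem x⟩ - (lam : ℂ) • G x + P (G x) = x + K x := fun x => by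
    rw [hHG]
    change _ = x + (B x - P₀ (G x) + P (G x))
    abel
  -- Here (H - λ + P)G = 1 + K. An eigenvalue -1 of K would contradict injectivity.
  rcases hK.hasEigenvalue_or_mem_resolventSet (μ := (-1 : ℂ)) (by norm_num) with h | h
  · obtain ⟨x, hx⟩ := h.exists_hasEigenvector
    have h1 : K x = (-1 : ℂ) • x := hx.apply_eq_smul
    have h2 := hKG x
    rw [h1, neg_one_smul, add_neg_cancel] at h2
    have h3 : G x = 0 := congrArg Subtype.val (eq_zero_of_shift_add_proj hHs h2)
    have h4 := hG.right x
    have h5 : (⟨G x, hG.mem x⟩ : D) = 0 := Subtype.ext h3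
    rw [h5, h3] at h4
    simp at h4
    exact absurd h4.symm hx.2
  · obtain ⟨u, hu⟩ := (spectrum.mem_resolventSet_iff.1 h : IsUnit _)
    set x := (↑u⁻¹ : E →L[ℂ] E) (-y) with hx
    have h1 : (u : E →L[ℂ] E) x = -y := congrArg (fun T : E →L[ℂ] E => T (-y)) u.mul_inv
    refine ⟨⟨G x, hG.mem x⟩, ?_⟩
    rw [hKG]
    rw [hu] at h1
    have h2 : (-1 : ℂ) • x - K x = -y := by
      rw [← h1]
      simp [Algebra.algebraMap_eq_smul_one]
    rw [← neg_eq_iff_eq_neg.2 h2]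
    simp [add_comm]

namespace IsReducedInverse

variable {H : D →ₗ[ℂ] E} {lam : ℝ} {P S : E →L[ℂ] E}

lemma proj_inv (h : IsReducedInverse H lam P S) (hH : SymmOn H) (x : E) : P (S x) = P x := by
  refine ext_inner_left ℂ fun w => ?_
  rw [← h.proj_symm, ← h.proj_symm]
  have hw := mem_eigenSub.1 (h.proj_mem w)
  have h1 := inner_shift_eq_zero hH hw ⟨S x, h.mem x⟩
  conv_rhs => rw [← h.right x]
  rw [inner_add_right]
  simp only at h1
  rw [h1, zero_add, ← h.proj_symm, h.proj_eq _ (h.proj_mem w)]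

lemma inv_proj (h : IsReducedInverse H lam P S) (x : E) : S (P x) = P x := by
  obtain ⟨h1, h2⟩ := mem_eigenSub.1 (h.proj_mem x)
  have := h.left ⟨P x, h1⟩
  rwa [h2, sub_self, zero_add, h.proj_eq _ (h.proj_mem x)] at this

lemma shift_inv (h : IsReducedInverse H lam P S) (hH : SymmOn H) (x : E) :
    H ⟨S x, h.mem x⟩ - (lam : ℂ) • S x = x - P x := by
  rw [← h.proj_inv hH x]
  exact eq_sub_of_add_eq (h.right x)

lemma inv_shift (h : IsReducedInverse H lam P S) (x : D) :
    S (H x - (lam : ℂ) • (x : E)) = x - P x := by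
  have := h.left x
  rw [map_add, h.inv_proj] at this
  exact eq_sub_of_add_eq this

lemma ker_iff (h : IsReducedInverse H lam P S) (x : E) :
    (1 - P) x = 0 ↔ InEigenspace H lam x := by
  rw [← mem_eigenSub]
  change x - P x = 0 ↔ _
  rw [sub_eq_zero]
  exact ⟨fun hx => hx ▸ h.proj_mem x, fun hx => (h.proj_eq x hx).symm⟩

lemma proj_proj (h : IsReducedInverse H lam P S) (x : E) : P (P x) = P x :=
  h.proj_eq _ (h.proj_mem x)

/-- The projection in coordinates. -/
lemma exists_coordinates (h : IsReducedInverse H lam P S) :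
    ∃ (n : ℕ) (e : Fin n → E) (φ : Fin n → E →L[ℂ] ℂ),
      (∀ v : Fin n → ℂ, ∑ i, v i • e i = 0 → v = 0) ∧ ∀ x, P x = ∑ i, φ i x • e i := by
  have := h.finite
  let b := stdOrthonormalBasis ℂ (eigenSub H lam)
  refine ⟨_, fun i => (b i : E), fun i => innerSL ℂ (b i : E), fun v hv => ?_, fun x => ?_⟩
  · have h1 : ∑ i, v i • b i = 0 := Subtype.ext (by simpa using hv)
    exact funext (Fintype.linearIndependent_iff.1 b.toBasis.linearIndependent v (by simpa using h1))
  · have h1 := congrArg Subtype.val (b.sum_repr' ⟨P x, h.proj_mem x⟩)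
    simp only [Submodule.coe_sum, Submodule.coe_smul, Submodule.coe_inner] at h1
    rw [← h1]
    refine Finset.sum_congr rfl fun i _ => ?_
    rw [← h.proj_symm, h.proj_eq _ (b i).2]
    rfl

end IsReducedInverse

/-- The resolvent `(T - i)⁻¹` of a self-adjoint operator. -/
lemma exists_resolvent_I {T : D →ₗ[ℂ] E} (hT : IsSelfAdjointOn T) {lam : ℝ} {P G : E →L[ℂ] E}
    (hG : IsReducedInverse T lam P G) :
    ∃ R : E →L[ℂ] E, IsResolvent T Complex.I R := by
  have hbound : ∀ u : D, ‖(u : E)‖ ≤ ‖T u - Complex.I • (u : E)‖ := fun u => by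
    have h1 : (inner ℂ (u : E) (T u - Complex.I • (u : E))).im = -‖(u : E)‖ ^ 2 := by
      have h2 : (inner ℂ (u : E) (T u)).im = 0 := by
        have h3 := inner_conj_symm (𝕜 := ℂ) (u : E) (T u)
        rw [hT.symm] at h3
        exact Complex.conj_eq_iff_im.1 h3
      rw [inner_sub_right, inner_smul_right, Complex.sub_im, h2, inner_self_eq_norm_sq_to_K]
      simp [← Complex.ofReal_pow]
    have h4 : ‖(u : E)‖ ^ 2 ≤ ‖(u : E)‖ * ‖T u - Complex.I • (u : E)‖ := by
      calc _ = |(inner ℂ (u : E) (T u - Complex.I • (u : E))).im| := by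
            rw [h1, abs_neg, abs_of_nonneg (by positivity)]
        _ ≤ ‖inner ℂ (u : E) (T u - Complex.I • (u : E))‖ := Complex.abs_im_le_norm _
        _ ≤ _ := norm_inner_le_norm _ _
    rcases (norm_nonneg (u : E)).eq_or_lt with h5 | h5
    · rw [← h5]
      exact norm_nonneg _
    · rw [pow_two] at h4
      exact le_of_mul_le_mul_left h4 h5
  -- This is (T - i)G, so its invertibility is that of T - i.
  let F : E →L[ℂ] E := 1 - P + ((lam : ℂ) - Complex.I) • G
  have hF : ∀ x, F x = T ⟨G x, hG.mem x⟩ - Complex.I • G x := fun x => by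
    have := hG.shift_inv hT.symm x
    change x - P x + ((lam : ℂ) - Complex.I) • G x = _
    rw [← this, sub_smul]
    abel
  have hGF : ∀ x, ‖G x‖ ≤ ‖F x‖ := fun x => by
    rw [hF]
    exact hbound ⟨G x, hG.mem x⟩
  have hanti : AntilipschitzWith (1 + ‖P‖₊ + ‖(lam : ℂ) - Complex.I‖₊) F := by
    refine AddMonoidHomClass.antilipschitz_of_bound F fun x => ?_
    have h1 : x = F x + P (G x) - ((lam : ℂ) - Complex.I) • G x := by
      rw [hG.proj_inv hT.symm]
      change x = x - P x + ((lam : ℂ) - Complex.I) • G x + P x - _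
      abel
    calc ‖x‖ = ‖F x + P (G x) - ((lam : ℂ) - Complex.I) • G x‖ := by rw [← h1]
      _ ≤ ‖F x‖ + ‖P (G x)‖ + ‖((lam : ℂ) - Complex.I) • G x‖ :=
        (norm_sub_le _ _).trans (by gcongr; exact norm_add_le _ _)
      _ ≤ ‖F x‖ + ‖P‖ * ‖F x‖ + ‖(lam : ℂ) - Complex.I‖ * ‖F x‖ := by
        rw [norm_smul]
        gcongr
        · exact (P.le_opNorm _).trans (by gcongr; exact hGF x)
        · exact hGF x
      _ = _ := by
        push_cast
        ring
  have hsurj : Function.Surjective F := by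
    have hcl : IsClosed (LinearMap.range (F : E →ₗ[ℂ] E) : Set E) :=
      hanti.isClosed_range F.uniformContinuous
    have hcs : CompleteSpace (LinearMap.range (F : E →ₗ[ℂ] E)) := hcl.completeSpace_coe
    suffices h : (LinearMap.range (F : E →ₗ[ℂ] E))ᗮ = ⊥ from
      LinearMap.range_eq_top.1 (Submodule.orthogonal_eq_bot_iff.1 h)
    rw [Submodule.eq_bot_iff]
    intro y hy
    -- A vector orthogonal to the range would satisfy Ty = -iy, impossible for symmetric T unless y
    -- = 0.
    have h1 : ∀ x : D, inner ℂ ((starRingEnd ℂ Complex.I) • y) (x : E) = inner ℂ y (T x) := by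
      intro x
      have h2 : F (T x - (lam : ℂ) • (x : E) + P x) = T x - Complex.I • (x : E) := by
        have h5 : (⟨_, hG.mem (T x - (lam : ℂ) • (x : E) + P x)⟩ : D) = x := Subtype.ext (hG.left x)
        rw [hF, h5, hG.left x]
      have h3 : inner ℂ y (T x - Complex.I • (x : E)) = 0 := by
        have h4 : inner ℂ (F (T x - (lam : ℂ) • (x : E) + P x)) y = 0 :=
          (Submodule.mem_orthogonal _ _).1 hy _ ⟨_, rfl⟩
        rw [← h2, ← inner_conj_symm, h4, map_zero]
      rw [inner_sub_right, sub_eq_zero, inner_smul_right] at h3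
      rw [inner_smul_left, Complex.conj_conj, h3]
    obtain ⟨h2, h3⟩ := hT.maximal y _ h1
    have h4 := hT.symm ⟨y, h2⟩ ⟨y, h2⟩
    rw [h3, inner_smul_left, inner_smul_right, Complex.conj_conj, Complex.conj_I] at h4
    have h5 : 2 * Complex.I * inner ℂ y y = 0 := by
      have : Complex.I * inner ℂ y y = -Complex.I * inner ℂ y y := h4
      linear_combination this
    simpa using h5
  let e := ContinuousLinearEquiv.ofBijective F (LinearMap.ker_eq_bot.2 hanti.injective)
    (LinearMap.range_eq_top.2 hsurj)
  have he : ∀ y, F (e.symm y) = y := fun y => e.apply_symm_apply y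
  refine ⟨G ∘L (e.symm : E →L[ℂ] E), fun y => ⟨hG.mem _, ?_⟩, fun x => ?_⟩
  · exact (hF (e.symm y)).symm.trans (he y)
  · change G (e.symm _) = x
    have h5 : (⟨_, hG.mem (T x - (lam : ℂ) • (x : E) + P x)⟩ : D) = x := Subtype.ext (hG.left x)
    have h6 : e (T x - (lam : ℂ) • (x : E) + P x) = T x - Complex.I • (x : E) := by
      change F _ = _
      rw [hF, h5, hG.left x]
    rw [← h6, e.symm_apply_apply, hG.left x]

end Operators

/-! ### The bounded pencil, isolation of the resonance, and the residue. -/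

section Core

variable {E : Type*} [NormedAddCommGroup E] [InnerProductSpace ℂ E] [CompleteSpace E]
variable {D : Submodule ℂ E}

/-- The bounded operators `B = V S` and `C = S V` attached to a reduced inverse `S` of `H - lam`. -/
structure IsPencil (H V : D →ₗ[ℂ] E) (lam : ℝ) (P S B C : E →L[ℂ] E) : Prop where
  dense : Dense (D : Set E)
  symmH : SymmOn H
  symmV : SymmOn V
  inv : IsReducedInverse H lam P S
  right : ∀ x, B x = V ⟨S x, inv.mem x⟩
  left : ∀ x : D, C x = S (V x)
  adj : ∀ x y, inner ℂ (C x) y = inner ℂ x (B y)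

/-- VS is everywhere defined and bounded by closed graph, whereas SV is only densely defined; its
extension is therefore obtained as the adjoint of VS. -/
lemma exists_isPencil {T H V : D →ₗ[ℂ] E} (hD : Dense (D : Set E)) (hTs : SymmOn T) {lam : ℝ}
    {P₀ G : E →L[ℂ] E} (hG : IsReducedInverse T lam P₀ G) (hW : IsDirection T (H - T))
    (hV : SymmOn V) : ∃ P S B C, IsPencil H V lam P S B C := by
  obtain ⟨P, S, hS⟩ := exists_reducedInverse hD hTs hG hW
  obtain ⟨B, hB⟩ := exists_clm_comp hD hV S hS.mem
  have hH : SymmOn H := by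
    have := hTs.add hW.1
    rwa [add_sub_cancel] at this
  refine ⟨P, S, B, ContinuousLinearMap.adjoint B, ⟨hD, hH, hV, hS, hB, fun x => ?_, fun x y =>
    ContinuousLinearMap.adjoint_inner_left B y x⟩⟩
  refine ext_inner_right ℂ fun y => ?_
  rw [ContinuousLinearMap.adjoint_inner_left, hB, hS.symm]
  exact (hV x ⟨S y, hS.mem y⟩).symm

namespace IsPencil

variable {H V : D →ₗ[ℂ] E} {lam : ℝ} {P S B C : E →L[ℂ] E}

lemma right_apply (h : IsPencil H V lam P S B C) (z : ℂ) (x : E) :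
    (H + z • V) ⟨S x, h.inv.mem x⟩ - (lam : ℂ) • S x = (1 - P + z • B) x := by
  change H _ + z • V _ - _ = x - P x + z • B x
  rw [h.right, ← h.inv.shift_inv h.symmH]
  abel

lemma left_apply (h : IsPencil H V lam P S B C) (z : ℂ) (x : D) :
    S ((H + z • V) x - (lam : ℂ) • (x : E)) = (1 - P + z • C) x := by
  change S (H x + z • V x - _) = (x : E) - P x + z • C x
  rw [h.left, ← h.inv.inv_shift, map_sub, map_sub, map_add, map_smul]
  abel

lemma intertwine (h : IsPencil H V lam P S B C) (z : ℂ) (x : E) :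
    (1 - P + z • C) (S x) = S ((1 - P + z • B) x) := by
  rw [← h.right_apply, ← h.left_apply z ⟨S x, h.inv.mem x⟩]

lemma adj_apply (h : IsPencil H V lam P S B C) (z : ℂ) (x y : E) :
    inner ℂ ((1 - P + z • C) x) y = inner ℂ x ((1 - P + (starRingEnd ℂ z) • B) y) := by
  change inner ℂ (x - P x + z • C x) y = inner ℂ x (y - P y + (starRingEnd ℂ z) • B y)
  rw [inner_add_left, inner_sub_left, inner_add_right, inner_sub_right, h.inv.proj_symm,
    inner_smul_left, inner_smul_right, h.adj]

lemma inv_injective (h : IsPencil H V lam P S B C) {x : E} (hx : S x = 0) : x = 0 := by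
  have h1 := h.inv.right x
  have h2 : (⟨S x, h.inv.mem x⟩ : D) = 0 := Subtype.ext hx
  rw [h2, hx] at h1
  simpa using h1.symm

lemma isResonant_iff (h : IsPencil H V lam P S B C) (a : ℝ) :
    IsResonant (H + a • V) lam ↔ ∃ x, x ≠ 0 ∧ (1 - P + (a : ℂ) • B) x = 0 := by
  have hsm : H + a • V = H + (a : ℂ) • V := by
    ext x
    simp
  rw [hsm]
  constructor
  · rintro ⟨χ, hχ, hm, he⟩
    obtain ⟨x, rfl⟩ : ∃ x, S x = χ := ⟨_, h.inv.left ⟨χ, hm⟩⟩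
    refine ⟨x, fun h0 => hχ (by rw [h0, map_zero]), ?_⟩
    rw [← h.right_apply, he, sub_self]
  · rintro ⟨x, hx, h0⟩
    refine ⟨S x, fun h1 => hx (h.inv_injective h1), h.inv.mem x, ?_⟩
    rw [← h.right_apply] at h0
    exact sub_eq_zero.1 h0

/-- The perturbation determinant is analytic, so near 0 it vanishes identically or only possibly at
0. -/
lemma dichotomy (h : IsPencil H V lam P S B C) :
    (∀ᶠ z in 𝓝 (0 : ℂ), ∃ x, x ≠ 0 ∧ (1 - P + z • B) x = 0) ∨
      ∀ᶠ z in 𝓝[≠] (0 : ℂ), IsUnit (1 - P + z • B) := by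
  obtain ⟨n, e, φ, he, hP⟩ := h.inv.exists_coordinates
  have hU : AnalyticAt ℂ (fun z : ℂ => (1 : E →L[ℂ] E) + z • B) 0 :=
    analyticAt_const.add (analyticAt_id.smul analyticAt_const)
  obtain ⟨δ, Θ, hδ, -, hev⟩ := exists_analytic_adjugate he hP hU (by simp)
  have hrw : ∀ z : ℂ, (1 : E →L[ℂ] E) + z • B - P = 1 - P + z • B := fun z => by abel
  simp only [hrw] at hev
  rcases hδ.eventually_eq_zero_or_eventually_ne_zero with h0 | h0
  · left
    filter_upwards [hev, h0] with z h1 h2 using h1.2.2 h2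
  · right
    filter_upwards [hev.filter_mono nhdsWithin_le_nhds, h0] with z h1 h2
    refine ⟨⟨1 - P + z • B, (δ z)⁻¹ • Θ z, ?_, ?_⟩, rfl⟩
    · rw [mul_smul_comm, h1.1, smul_smul, inv_mul_cancel₀ h2, one_smul]
    · rw [smul_mul_assoc, h1.2.1, smul_smul, inv_mul_cancel₀ h2, one_smul]

/-- Regularity of the direction makes the resonance at `H` isolated on the complex line. -/
lemma eventually_isUnit (h : IsPencil H V lam P S B C) (hreg : IsRegular H V lam)
    (hall : ∀ a : ℝ, ∃ P S B C, IsPencil (H + a • V) V lam P S B C) :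
    ∀ᶠ z in 𝓝[≠] (0 : ℂ), IsUnit (1 - P + z • B) := by
  refine h.dichotomy.resolve_left fun h0 => ?_
  have hof : Tendsto (fun a : ℝ => (a : ℂ)) (𝓝 0) (𝓝 0) := by
    have := Complex.continuous_ofReal.tendsto 0
    rwa [Complex.ofReal_zero] at this
  -- The parameters around which the whole line is resonant. This set is open, closed by the
  -- dichotomy applied at its limit points, and contains 0; connectedness of ℝ then contradicts
  -- regularity.
  let Ω : Set ℝ := {a | ∀ᶠ b in 𝓝 a, IsResonant (H + b • V) lam}
  have hshift : ∀ a b : ℝ, H + b • V = H + a • V + (b - a) • V := fun a b => by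
    rw [sub_smul]
    abel
  have hΩo : IsOpen Ω := isOpen_iff_mem_nhds.2 fun a ha => eventually_eventually_nhds.2 ha
  have hΩc : IsClosed Ω := by
    refine isClosed_of_closure_subset fun a ha => ?_
    obtain ⟨P', S', B', C', h'⟩ := hall a
    have hsub : Tendsto (fun b : ℝ => b - a) (𝓝 a) (𝓝 0) := by
      have := (continuous_sub_right a).tendsto a
      rwa [sub_self] at this
    rcases h'.dichotomy with h1 | h1
    · refine ((hof.comp hsub).eventually h1).mono fun b hb => ?_
      rw [hshift a b, h'.isResonant_iff]
      exact hb
    · have h2 : ∀ᶠ b in 𝓝 a, b ≠ a → ¬ IsResonant (H + b • V) lam := by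
        refine ((hof.comp hsub).eventually (eventually_nhdsWithin_iff.1 h1)).mono
          fun b hb hne hres => ?_
        rw [hshift a b, h'.isResonant_iff] at hres
        obtain ⟨x, hx, hx0⟩ := hres
        have hu : IsUnit (1 - P' + ((b - a : ℝ) : ℂ) • B') :=
          hb (by simpa [sub_eq_zero] using hne)
        obtain ⟨u, hu⟩ := hu
        have h3 : (↑u⁻¹ : E →L[ℂ] E) ((u : E →L[ℂ] E) x) = x :=
          congrArg (fun T : E →L[ℂ] E => T x) u.inv_mul
        rw [hu, hx0, map_zero] at h3
        exact hx h3.symm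
      obtain ⟨b, hb1, hb2⟩ :=
        (mem_closure_iff_frequently.1 ha).and_eventually h2.eventually_nhds |>.exists
      rcases eq_or_ne b a with rfl | hne
      · exact hb1
      · exact absurd hb1.self_of_nhds (hb2.self_of_nhds hne)
  have hΩ0 : (0 : ℝ) ∈ Ω := (hof.eventually h0).mono fun b hb => (h.isResonant_iff b).2 hb
  have huniv : Ω = Set.univ := IsClopen.eq_univ ⟨hΩc, hΩo⟩ ⟨0, hΩ0⟩
  obtain ⟨s, hs⟩ := hreg
  have : s ∈ Ω := huniv ▸ Set.mem_univ s
  exact hs this.self_of_nhds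

end IsPencil

/-- The pencil of an isolated resonance together with the expansion
`(1 - P + z C)⁻¹ = z ^ (-(n + 1)) M z` at `z = 0`. -/
structure IsCore (H V : D →ₗ[ℂ] E) (lam : ℝ) (P S B C : E →L[ℂ] E) (n : ℕ)
    (M : ℂ → E →L[ℂ] E) : Prop extends IsPencil H V lam P S B C where
  analytic : AnalyticAt ℂ M 0
  ne_zero : M 0 ≠ 0
  isUnit : ∀ᶠ z in 𝓝[≠] (0 : ℂ), IsUnit (1 - P + z • B)
  inverse : ∀ᶠ z in 𝓝 (0 : ℂ), (1 - P + z • C) * M z = z ^ (n + 1) • 1 ∧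
    M z * (1 - P + z • C) = z ^ (n + 1) • 1

/-- Isolation is known for the pencil in `B`. A kernel vector of the pencil in `C` at z is
orthogonal to the range of the pencil in `B` at the conjugate point, hence zero, so the determinant
does not vanish off the origin. -/
lemma exists_isCore {H V : D →ₗ[ℂ] E} {lam : ℝ} {P S B C : E →L[ℂ] E}
    (h : IsPencil H V lam P S B C) (hu : ∀ᶠ z in 𝓝[≠] (0 : ℂ), IsUnit (1 - P + z • B))
    (hres : IsResonant H lam) : ∃ n M, IsCore H V lam P S B C n M := by
  obtain ⟨x₀, hx₀, hx₀'⟩ := hres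
  obtain ⟨N, e, φ, he, hP⟩ := h.inv.exists_coordinates
  have hU : AnalyticAt ℂ (fun z : ℂ => (1 : E →L[ℂ] E) + z • C) 0 :=
    analyticAt_const.add (analyticAt_id.smul analyticAt_const)
  obtain ⟨δ, Θ, hδ, hΘ, hev⟩ := exists_analytic_adjugate he hP hU (by simp)
  have hrw : ∀ z : ℂ, (1 : E →L[ℂ] E) + z • C - P = 1 - P + z • C := fun z => by abel
  simp only [hrw] at hev
  have hconj : Tendsto (starRingEnd ℂ) (𝓝[≠] (0 : ℂ)) (𝓝[≠] (0 : ℂ)) := by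
    refine tendsto_nhdsWithin_iff.2 ⟨?_, ?_⟩
    · have := (Complex.continuous_conj.tendsto 0).mono_left (nhdsWithin_le_nhds (s := {0}ᶜ))
      rwa [map_zero] at this
    · filter_upwards [self_mem_nhdsWithin] with z hz
      simpa using hz
  have hL : AnalyticAt ℂ (fun z : ℂ => (1 : E →L[ℂ] E) - P + z • C) 0 :=
    analyticAt_const.add (analyticAt_id.smul analyticAt_const)
  obtain ⟨n, M, hM, hM0, hMi⟩ := exists_pole hL hδ hΘ (x₀ := x₀) (by
    filter_upwards [hev.filter_mono nhdsWithin_le_nhds, hconj.eventually hu] with z h1 h2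
    refine ⟨h1.1, h1.2.1, fun h0 => ?_⟩
    obtain ⟨x, hx, hx0⟩ := h1.2.2 h0
    refine hx (ext_inner_right ℂ fun y => ?_)
    obtain ⟨u, hu⟩ := h2
    have h3 : (u : E →L[ℂ] E) ((↑u⁻¹ : E →L[ℂ] E) y) = y :=
      congrArg (fun T : E →L[ℂ] E => T y) u.mul_inv
    rw [← h3, hu, ← h.adj_apply, hx0, inner_zero_left, inner_zero_left]) hx₀
    (by simpa using (h.inv.ker_iff x₀).2 hx₀')
  exact ⟨n, M, { h with analytic := hM, ne_zero := hM0, isUnit := hu, inverse := hMi }⟩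

lemma IsResolvent.unique {T : D →ₗ[ℂ] E} {z : ℂ} {R R' : E →L[ℂ] E} (h : IsResolvent T z R)
    (h' : IsResolvent T z R') : R = R' := by
  ext y
  obtain ⟨h1, h2⟩ := h.1 y
  have := h'.2 ⟨R y, h1⟩
  rw [h2] at this
  exact this.symm

lemma IsResolventMul.unique (hD : Dense (D : Set E)) {T V : D →ₗ[ℂ] E} {z : ℂ} {A A' : E →L[ℂ] E}
    (h : IsResolventMul T V z A) (h' : IsResolventMul T V z A') : A = A' := by
  obtain ⟨R, hR, hA⟩ := h
  obtain ⟨R', hR', hA'⟩ := h'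
  refine ext_clm_dense hD fun u => ?_
  rw [hA, hA', hR.unique hR']

lemma resolventMul_spec {T V : D →ₗ[ℂ] E} {z : ℂ} (h : ∃ A, IsResolventMul T V z A) :
    IsResolventMul T V z (resolventMul T V z) := by
  unfold resolventMul
  rw [dif_pos h]
  exact h.choose_spec

namespace IsPencil

variable {H V : D →ₗ[ℂ] E} {lam r : ℝ} {P S B C : E →L[ℂ] E}

/-- Wherever `A = (H_s - lam)⁻¹ V` exists, the pencil is injective and `A` solves `L A = C`. -/
lemma of_isResolventMul (h : IsPencil H V lam P S B C) {s : ℂ} {A : E →L[ℂ] E}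
    (hA : IsResolventMul (line H V r s) V lam A) :
    Function.Injective (1 - P + (s - r) • C : E →L[ℂ] E) ∧
      ∀ x, (1 - P : E →L[ℂ] E) (A x) + (s - r) • C (A x) = C x := by
  obtain ⟨R, hR, hA⟩ := hA
  constructor
  · let Ψ : E →L[ℂ] E := 1 - (s - r) • A + R ∘L P
    have hΨ : Ψ ∘L (1 - P + (s - r) • C) = 1 := by
      refine ext_clm_dense h.dense fun x => ?_
      change Ψ ((1 - P + (s - r) • C : E →L[ℂ] E) x) = x
      rw [← h.left_apply]
      set u := (H + (s - (r : ℂ)) • V) x - (lam : ℂ) • (x : E) with hu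
      change S u - (s - r) • A (S u) + R (P (S u)) = x
      have h1 := hA ⟨S u, h.inv.mem u⟩
      have h2 := hR.2 ⟨S u, h.inv.mem u⟩
      have h3 : line H V r s ⟨S u, h.inv.mem u⟩ - (lam : ℂ) • S u
          = u - P (S u) + (s - r) • V ⟨S u, h.inv.mem u⟩ := by
        change H _ + (s - (r : ℂ)) • V _ - _ = _
        have h4 := h.inv.right u
        rw [← eq_sub_of_add_eq h4]
        abel
      have h5 : R u = x := hR.2 x
      simp only at h1 h2
      rw [h3, map_add, map_sub, map_smul] at h2
      rw [h1]
      calc _ = R u + (S u - (R u - R (P (S u)) + (s - r) • R (V ⟨S u, h.inv.mem u⟩))) := by abel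
        _ = x := by rw [h2, sub_self, add_zero, h5]
    intro x y hxy
    have h1 : ∀ x, Ψ ((1 - P + (s - r) • C : E →L[ℂ] E) x) = x := fun x =>
      congrArg (fun T : E →L[ℂ] E => T x) hΨ
    rw [← h1 x, hxy, h1]
  · have h1 : (1 - P + (s - r) • C : E →L[ℂ] E) ∘L A = C := by
      refine ext_clm_dense h.dense fun x => ?_
      obtain ⟨hm, h2⟩ := hR.1 (V x)
      change (1 - P + (s - r) • C : E →L[ℂ] E) (A x) = C x
      rw [hA, h.left, ← h.left_apply _ ⟨R (V x), hm⟩]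
      exact congrArg S h2
    exact fun x => congrArg (fun T : E →L[ℂ] E => T x) h1

end IsPencil

namespace IsCore

variable {H V : D →ₗ[ℂ] E} {lam : ℝ} {P S B C : E →L[ℂ] E} {n : ℕ} {M : ℂ → E →L[ℂ] E}

/-- The coefficients of the expansion of the inverse of the pencil. -/
abbrev coeff (M : ℂ → E →L[ℂ] E) : ℕ → E →L[ℂ] E := taylorAt ℂ M 0

lemma laurent (h : IsCore H V lam P S B C n M) : IsLaurentInverse (1 - P) C n (coeff M) :=
  isLaurentInverse_taylorAt h.analytic h.inverse

/-- Off the origin, the resolvent is given by the expansion. -/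
lemma eventually_resolvent (h : IsCore H V lam P S B C n M) :
    ∀ᶠ z in 𝓝[≠] (0 : ℂ),
      IsResolvent (H + z • V) lam (((z ^ (n + 1))⁻¹ • M z) ∘L S) ∧
      IsResolventMul (H + z • V) V lam (((z ^ (n + 1))⁻¹ • M z) ∘L C) := by
  filter_upwards [h.isUnit, h.inverse.filter_mono nhdsWithin_le_nhds, self_mem_nhdsWithin]
    with z ⟨u, hu⟩ ⟨h1, h2⟩ hz
  have hz' : z ^ (n + 1) ≠ 0 := pow_ne_zero _ hz
  have hML : ∀ x, ((z ^ (n + 1))⁻¹ • M z) ((1 - P + z • C) x) = x := fun x => by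
    have := congrArg (fun T : E →L[ℂ] E => T x) h2
    change (z ^ (n + 1))⁻¹ • (M z ((1 - P + z • C) x)) = x
    rw [show M z ((1 - P + z • C) x) = z ^ (n + 1) • x from this, smul_smul, inv_mul_cancel₀ hz',
      one_smul]
  have hR : IsResolvent (H + z • V) lam (((z ^ (n + 1))⁻¹ • M z) ∘L S) := by
    constructor
    · intro y
      have h3 : (1 - P + z • B) ((↑u⁻¹ : E →L[ℂ] E) y) = y := by
        rw [← hu]
        exact congrArg (fun T : E →L[ℂ] E => T y) u.mul_inv
      set w := (↑u⁻¹ : E →L[ℂ] E) y with hw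
      have h4 : (((z ^ (n + 1))⁻¹ • M z) ∘L S) y = S w := by
        change ((z ^ (n + 1))⁻¹ • M z) (S y) = S w
        rw [← h3, ← h.intertwine, hML]
      rw [h4]
      exact ⟨h.inv.mem w, by rw [h.right_apply, h3]⟩
    · intro x
      change ((z ^ (n + 1))⁻¹ • M z) (S _) = x
      rw [h.left_apply, hML]
  refine ⟨hR, _, hR, fun x => ?_⟩
  change ((z ^ (n + 1))⁻¹ • M z) (C x) = ((z ^ (n + 1))⁻¹ • M z) (S (V x))
  rw [h.left]

lemma tendsto_sub_nhdsNE (r : ℂ) : Tendsto (fun s : ℂ => s - r) (𝓝[≠] r) (𝓝[≠] 0) := by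
  refine tendsto_nhdsWithin_iff.2 ⟨?_, ?_⟩
  · have := ((continuous_sub_right r).tendsto r).mono_left (nhdsWithin_le_nhds (s := {r}ᶜ))
    rwa [sub_self] at this
  · filter_upwards [self_mem_nhdsWithin] with z hz
    simpa [sub_eq_zero] using hz

/-- The chain description does not mention s, which is why the resonance equation holds for one
admissible s exactly when it holds for all. -/
lemma resonanceEq_iff (h : IsCore H V lam P S B C n M) (r : ℝ) (k : ℕ) (χ : E) :
    ResonanceEq H V lam r k χ ↔ χ ∈ chainSpace (1 - P) C k := by
  have key : ∀ s : ℂ, (∃ A, IsResolventMul (line H V r s) V (lam : ℂ) A) →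
      (((1 + ((r : ℂ) - s) • opA H V lam r s) ^ k) χ = 0 ↔ χ ∈ chainSpace (1 - P) C k) := by
    intro s hs
    obtain ⟨h1, h2⟩ := h.toIsPencil.of_isResolventMul (resolventMul_spec hs)
    rw [← pow_apply_eq_zero_iff h1 h2]
    have : (1 : E →L[ℂ] E) + ((r : ℂ) - s) • opA H V lam r s =
        1 - (s - r) • resolventMul (line H V r s) V lam := by
      rw [← neg_sub s, neg_smul, ← sub_eq_add_neg]
      rfl
    rw [this]
  constructor
  · rintro ⟨s, hs, h1⟩
    exact (key s hs).1 h1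
  · intro hχ
    obtain ⟨s, hs⟩ := ((tendsto_sub_nhdsNE (r : ℂ)).eventually h.eventually_resolvent).exists
    exact ⟨s, ⟨_, hs.2⟩, (key s ⟨_, hs.2⟩).2 hχ⟩

lemma isResonanceVector_iff (h : IsCore H V lam P S B C n M) (r : ℝ) (χ : E) :
    IsResonanceVector H V lam r χ ↔ χ ∈ chainSpace (1 - P) C (n + 1) := by
  constructor
  · rintro ⟨k, -, hk⟩
    exact h.laurent.chainSpace_le ((h.resonanceEq_iff r k χ).1 hk)
  · exact fun hχ => ⟨n + 1, by omega, (h.resonanceEq_iff r _ χ).2 hχ⟩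

/-- With z = s - r, zA = z^{-(n+1)} · zM(z)C, so the residue is the nth coefficient of zM(z)C,
namely m_{n-1}C = -m_nQ, and for n = 0 both sides vanish. -/
lemma nilpotentA_eq (h : IsCore H V lam P S B C n M) (r : ℝ) :
    nilpotentA H V lam r = IsLaurentInverse.nil (1 - P) n (coeff M) := by
  let F : ℂ → E →L[ℂ] E := fun z => (z - 0) • (M z ∘L C)
  have hMC : AnalyticAt ℂ (fun z => M z ∘L C) 0 := h.analytic.mul analyticAt_const
  have hid : AnalyticAt ℂ (fun z : ℂ => z - 0) 0 := by fun_prop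
  have hF : AnalyticAt ℂ F 0 := hid.smul hMC
  have hFr : AnalyticAt ℂ (fun s : ℂ => F (s - r)) (r : ℂ) :=
    AnalyticAt.comp (g := F) (f := fun s : ℂ => s - (r : ℂ)) (by simpa using hF) (by fun_prop)
  have h1 : ∀ᶠ s in 𝓝[≠] (r : ℂ), (s - (r : ℂ)) • opA H V lam r s =
      ((s - r) ^ (n + 1))⁻¹ • F (s - r) := by
    filter_upwards [(tendsto_sub_nhdsNE (r : ℂ)).eventually h.eventually_resolvent] with s hs
    have h2 : opA H V lam r s = (((s - r) ^ (n + 1))⁻¹ • M (s - r)) ∘L C :=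
      (resolventMul_spec ⟨_, hs.2⟩).unique h.dense hs.2
    rw [h2]
    simp only [F, sub_zero]
    rw [smul_comm]
    rfl
  have h3 := eventually_circleIntegral_eq_taylorAt hFr h1
  have h4 : taylorAt ℂ (fun s : ℂ => F (s - r)) (r : ℂ) n = taylorAt ℂ F 0 n := by
    unfold taylorAt
    rw [iteratedDeriv_comp_sub_const]
    simp
  have h5 : taylorAt ℂ F 0 n = IsLaurentInverse.nil (1 - P) n (coeff M) := by
    have h6 : ∀ j, taylorAt ℂ (fun z => M z ∘L C) 0 j = coeff M j ∘L C := fun j =>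
      taylorAt_clm ((ContinuousLinearMap.compL ℂ E E E).flip C) h.analytic j
    cases n with
    | zero =>
      ext x
      simp only [F, taylorAt_zero, IsLaurentInverse.nil, sub_self, zero_smul]
      have h7 := h.laurent.right_zero x
      rw [coeff, taylorAt_zero] at h7
      change 0 = -(M 0 ((1 - P : E →L[ℂ] E) x))
      rw [h7, neg_zero]
    | succ j =>
      rw [taylorAt_sub_smul_succ hMC, h6]
      ext x
      change coeff M j (C x) = -(coeff M (j + 1) ((1 - P : E →L[ℂ] E) x))
      have := h.laurent.right_succ j x
      rw [if_neg (by omega)] at this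
      exact eq_neg_of_add_eq_zero_right this
  unfold nilpotentA
  refine Tendsto.limUnder_eq (tendsto_const_nhds.congr' ?_)
  filter_upwards [h3] with ε hε
  rw [hε, h4, h5]

end IsCore

end Core

/-! ### Orders, deep eigenvectors and analytic eigenpaths. -/

section Paths

variable {E : Type*} [NormedAddCommGroup E] [InnerProductSpace ℂ E] [CompleteSpace E]
variable {D : Submodule ℂ E}

namespace IsCore

variable {H V : D →ₗ[ℂ] E} {lam : ℝ} {P S B C : E →L[ℂ] E} {n : ℕ} {M : ℂ → E →L[ℂ] E}

open IsLaurentInverse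

lemma hasOrder (h : IsCore H V lam P S B C n M) (r : ℝ) {j : ℕ} {x : E}
    (hx : x ∈ chainSpace (1 - P) C (j + 1)) (hx0 : (nil (1 - P) n (coeff M) ^ j) x ≠ 0) :
    HasOrder H V lam r x (j + 1) := by
  refine ⟨(h.resonanceEq_iff r _ x).2 hx, fun k hk => ?_⟩
  by_contra! hlt
  obtain ⟨i, rfl⟩ := Nat.exists_eq_add_of_le' (Nat.lt_succ_iff.1 hlt)
  apply hx0
  have h1 := (h.laurent.mem_chainSpace_iff hx k).1 ((h.resonanceEq_iff r k x).1 hk)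
  rw [pow_add]
  change (nil (1 - P) n (coeff M) ^ i) ((nil (1 - P) n (coeff M) ^ k) x) = 0
  rw [h1, map_zero]

/-- The competitor n + 1 shows that the set defining the order is nonempty, so the infimum is not
the default value 0. -/
lemma le_directionOrder (h : IsCore H V lam P S B C n M) {r : ℝ} {j : ℕ} {x : E}
    (hx : HasOrder H V lam r x (j + 1)) : j + 1 ≤ directionOrder H V lam r := by
  refine le_csInf ⟨n + 1, by omega, fun χ hχ => ?_⟩ fun d hd => ?_
  · exact (h.resonanceEq_iff r _ χ).2 ((h.isResonanceVector_iff r χ).1 hχ)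
  · exact hx.2 (hd.2 x ⟨j + 1, by omega, hx.1⟩)

lemma mem_chainSpace_one_iff (h : IsCore H V lam P S B C n M) (x : E) :
    x ∈ chainSpace (1 - P) C 1 ↔ InEigenspace H lam x := by
  rw [mem_chainSpace_one]
  exact h.inv.ker_iff x

lemma mem_deepEigenvectors_iff (h : IsCore H V lam P S B C n M) {r : ℝ} {k : ℕ} {χ : E} :
    χ ∈ deepEigenvectors H V lam r k ↔ χ ≠ 0 ∧ InEigenspace H lam χ ∧
      ∃ f ∈ chainSpace (1 - P) C (n + 1), (nil (1 - P) n (coeff M) ^ k) f = χ := by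
  refine and_congr_right fun h0 => and_congr_right fun h1 => ?_
  have h2 := h.laurent.chainSpace_le ((h.mem_chainSpace_one_iff χ).2 h1)
  unfold DepthAtLeast
  rw [h.nilpotentA_eq, h.isResonanceVector_iff]
  constructor
  · rintro ⟨-, f, hf⟩
    exact h.laurent.exists_mem_nil_pow_eq h2 hf
  · rintro ⟨f, -, hf⟩
    exact ⟨h2, f, hf⟩

/-- The pole is at least as deep as any eigenvector. -/
lemma le_of_mem_deepEigenvectors (h : IsCore H V lam P S B C n M) {r : ℝ} {k : ℕ} {χ : E}
    (hχ : χ ∈ deepEigenvectors H V lam r k) : k ≤ n := by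
  obtain ⟨h0, -, f, hf, rfl⟩ := h.mem_deepEigenvectors_iff.1 hχ
  by_contra! hlt
  exact h0 (h.laurent.nil_pow_eq_zero hf hlt)

/-- Start from a resonance vector not killed by 𝐀^k and take the last nonzero iterate: it is an
eigenvector, and it lies in the range of 𝐀^k. -/
lemma deepEigenvectors_nonempty (h : IsCore H V lam P S B C n M) (hres : IsResonant H lam)
    {r : ℝ} {k : ℕ} (hk : k + 1 ≤ directionOrder H V lam r) :
    (deepEigenvectors H V lam r k).Nonempty := by
  set A := nil (1 - P) n (coeff M) with hA
  obtain ⟨x, hx, hxk⟩ : ∃ x ∈ chainSpace (1 - P) C (n + 1), (A ^ k) x ≠ 0 := by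
    -- Minimality of the order says nothing about d = 0, so k = 0 uses an eigenvector of `H`
    -- directly.
    rcases Nat.eq_zero_or_pos k with rfl | hk0
    · obtain ⟨χ, hχ, hχ'⟩ := hres
      exact ⟨χ, h.laurent.chainSpace_le ((h.mem_chainSpace_one_iff χ).2 hχ'), hχ⟩
    · by_contra! hcon
      have : directionOrder H V lam r ≤ k := Nat.sInf_le ⟨hk0, fun χ hχ => by
        have h1 := (h.isResonanceVector_iff r χ).1 hχ
        exact (h.resonanceEq_iff r k χ).2 ((h.laurent.mem_chainSpace_iff h1 k).2 (hcon χ h1))⟩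
      omega
  obtain ⟨m, hm1, hm2⟩ : ∃ m, (A ^ (k + m)) x ≠ 0 ∧ (A ^ (k + m + 1)) x = 0 := by
    by_contra! hcon
    have hall : ∀ m, (A ^ (k + m)) x ≠ 0 := fun m => by
      induction m with
      | zero => exact hxk
      | succ m ih => exact hcon m ih
    exact hall (n + 1) (h.laurent.nil_pow_eq_zero hx (by omega))
  refine ⟨(A ^ (k + m)) x, h.mem_deepEigenvectors_iff.2 ⟨hm1, ?_, (A ^ m) x,
    h.laurent.nil_pow_mem hx m, ?_⟩⟩
  · rw [← h.mem_chainSpace_one_iff, h.laurent.mem_chainSpace_iff (h.laurent.nil_pow_mem hx _)]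
    rw [pow_succ'] at hm2
    simpa using hm2
  · rw [pow_add]
    rfl

end IsCore

namespace IsPencil

variable {T H V : D →ₗ[ℂ] E} {lam r : ℝ} {P S B C : E →L[ℂ] E}

/-- The Taylor coefficients of an eigenpath of a path that stays close to a reparametrised line. -/
lemma eigenpath_relation (h : IsPencil H V lam P S B C) (hT : SymmOn T) {Q : ℝ → D →ₗ[ℂ] E}
    {p : ℝ → ℝ} (hp : AnalyticAt ℝ p r) (hp0 : p r = 0) (hQ : ∀ᶠ s in 𝓝 r, SymmOn (Q s)) {k : ℕ}
    (hest : ∃ K : ℝ, ∀ᶠ s in 𝓝 r, ∀ x : D,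
      ‖Q s x - (H x + p s • V x)‖ ≤ K * |s - r| ^ k * (‖(x : E)‖ + ‖T x‖))
    {η : ℝ → E} (hη : IsResonantEigenpath Q lam r η) {i : ℕ} (hi : i < k) :
    (1 - P) (taylorAt ℝ η r i) +
      ∑ j ∈ Finset.range i, taylorAt ℝ p r (j + 1) • C (taylorAt ℝ η r (i - (j + 1))) = 0 := by
  obtain ⟨K, hK⟩ := hest
  obtain ⟨hηa, hη⟩ := hη
  obtain ⟨TS, hTS⟩ := exists_clm_comp h.dense hT S h.inv.mem
  let F : ℝ → E := fun s => (1 - P) (η s) + p s • C (η s)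
  have hCa : AnalyticAt ℝ (fun s => C (η s)) r := ((C.restrictScalars ℝ).analyticAt _).comp hηa
  have hPa : AnalyticAt ℝ (fun s => (1 - P) (η s)) r :=
    (((1 - P).restrictScalars ℝ).analyticAt _).comp hηa
  have hpC : AnalyticAt ℝ (fun s => p s • C (η s)) r := hp.smul hCa
  have hF : AnalyticAt ℝ F r := hPa.add hpC
  have hbd : ∀ᶠ s in 𝓝 r, ‖η s‖ ≤ ‖η r‖ + 1 :=
    (hηa.continuousAt.norm.eventually_lt continuousAt_const (by linarith)).mono fun s hs => hs.le
  have hO : F =O[𝓝 r] fun s => (s - r) ^ k := by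
    refine Asymptotics.IsBigO.of_bound ((‖η r‖ + 1) * |K| * (‖S‖ + ‖TS‖)) ?_
    filter_upwards [hK, hη, hQ, hbd] with s hs ⟨_, hm, he⟩ hsym hb
    let Δ : D →ₗ[ℂ] E := Q s - (H + p s • V)
    have hΔ : SymmOn Δ := hsym.sub (h.symmH.add (h.symmV.smul _))
    set w := S (Δ ⟨η s, hm⟩) with hw
    have hFw : F s = -w := by
      have h1 := h.inv.inv_shift ⟨η s, hm⟩
      have h2 := h.left ⟨η s, hm⟩
      have h3 : Δ ⟨η s, hm⟩ = (lam : ℂ) • η s - (H ⟨η s, hm⟩ + (p s : ℂ) • V ⟨η s, hm⟩) := by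
        rw [← he]
        simp [Δ]
      have h4 : F s = η s - P (η s) + (p s : ℂ) • C (η s) := by
        simp [F]
      simp only at h1 h2
      rw [h4, ← h1, h2, hw, h3]
      simp only [map_sub, map_add, map_smul]
      abel
    -- Estimate by duality: only the norm of η(s) in the Hilbert space is controlled, not its graph
    -- norm, so the error Δ is moved onto Sw, whose graph norm is bounded by ‖w‖.
    have h5 : ‖w‖ ^ 2 ≤ (‖η s‖ * (|K| * |s - r| ^ k * (‖S‖ + ‖TS‖))) * ‖w‖ := by
      have h6 : inner ℂ w w = inner ℂ (η s) (Δ ⟨S w, h.inv.mem w⟩) := by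
        nth_rewrite 1 [hw]
        rw [h.inv.symm]
        exact hΔ ⟨η s, hm⟩ ⟨S w, h.inv.mem w⟩
      calc ‖w‖ ^ 2 = RCLike.re (inner ℂ w w) := (inner_self_eq_norm_sq (𝕜 := ℂ) w).symm
        _ ≤ ‖inner ℂ w w‖ := RCLike.re_le_norm _
        _ ≤ ‖η s‖ * ‖Δ ⟨S w, h.inv.mem w⟩‖ := by
          rw [h6]
          exact norm_inner_le_norm _ _
        _ ≤ ‖η s‖ * (|K| * |s - r| ^ k * (‖S‖ * ‖w‖ + ‖TS‖ * ‖w‖)) := by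
          gcongr
          refine (hs ⟨S w, h.inv.mem w⟩).trans ?_
          gcongr
          · exact le_abs_self K
          · exact S.le_opNorm w
          · rw [← hTS]
            exact TS.le_opNorm w
        _ = _ := by ring
    have h7 : ‖w‖ ≤ ‖η s‖ * (|K| * |s - r| ^ k * (‖S‖ + ‖TS‖)) := by
      rcases (norm_nonneg w).eq_or_lt with h8 | h8
      · rw [← h8]
        positivity
      · rw [pow_two] at h5
        exact le_of_mul_le_mul_right h5 h8
    rw [hFw, norm_neg, norm_pow, Real.norm_eq_abs]
    calc ‖w‖ ≤ _ := h7
      _ ≤ (‖η r‖ + 1) * (|K| * |s - r| ^ k * (‖S‖ + ‖TS‖)) := by gcongr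
      _ = _ := by ring
  have h0 := taylorAt_eq_zero_of_isBigO hF hO hi
  have h1 : taylorAt ℝ F r i = (1 - P) (taylorAt ℝ η r i) +
      ∑ j ∈ Finset.range (i + 1), taylorAt ℝ p r j • C (taylorAt ℝ η r (i - j)) := by
    rw [taylorAt_add hPa hpC, taylorAt_smul hp hCa]
    refine congrArg₂ (· + ·) (taylorAt_clm ((1 - P).restrictScalars ℝ) hηa i) ?_
    refine Finset.sum_congr rfl fun j _ => ?_
    exact congrArg _ (taylorAt_clm (C.restrictScalars ℝ) hηa _)
  rw [h1, Finset.sum_range_succ', taylorAt_zero, hp0, zero_smul, add_zero] at h0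
  exact h0

/-- Write (Q(s) - λ)S = U(s) - P with U(r) = 1. An eigenvector Sx satisfies x = U(s)⁻¹Px, so it is
determined by the finitely many coordinates of Px, and analytic elimination selects these
analytically and without a common zero at r. -/
lemma exists_eigenpath (h : IsPencil H V lam P S B C) (hT : SymmOn T) {Q : ℝ → D →ₗ[ℂ] E}
    (hQa : IsAnalyticPathAt T Q r) (hQr : Q r = H) (hQ : ∀ᶠ s in 𝓝 r, IsResonant (Q s) lam) :
    ∃ χ, IsResonantEigenpath Q lam r χ := by
  obtain ⟨B₀, hB₀, hB₀Q⟩ := hQa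
  obtain ⟨TS, hTS⟩ := exists_clm_comp h.dense hT S h.inv.mem
  obtain ⟨n, e, φ, he, hP⟩ := h.inv.exists_coordinates
  let U : ℝ → E →L[ℂ] E := fun s => B₀ s * (TS - Complex.I • S) - (lam : ℂ) • S + P
  have hUs : ∀ᶠ s in 𝓝 r, ∀ x, U s x - P x = Q s ⟨S x, h.inv.mem x⟩ - (lam : ℂ) • S x := by
    filter_upwards [hB₀Q] with s hs x
    have := hs ⟨S x, h.inv.mem x⟩
    rw [← hTS] at this
    rw [← this]
    change B₀ s (TS x - Complex.I • S x) - (lam : ℂ) • S x + P x - P x = _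
    abel
  have hUr : U r = 1 := by
    ext x
    have h1 := hUs.self_of_nhds x
    have h2 := h.inv.shift_inv h.symmH x
    rw [hQr, h2] at h1
    exact sub_left_injective h1
  have hUa : AnalyticAt ℝ U r :=
    ((hB₀.mul analyticAt_const).sub analyticAt_const).add analyticAt_const
  have hU1 : IsUnit (U r) := hUr ▸ isUnit_one
  let Y : ℝ → E →L[ℂ] E := fun s => Ring.inverse (U s)
  have hYa : AnalyticAt ℝ Y r := analyticAt_ringInverse hUa hU1
  have hYx : ∀ {f : ℝ → E}, AnalyticAt ℝ f r → AnalyticAt ℝ (fun s => Y s (f s)) r := by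
    intro f hf
    have h1 : AnalyticAt ℝ (fun s => ((ContinuousLinearMap.restrictScalarsL ℂ E E ℝ ℝ) (Y s))) r :=
      ((ContinuousLinearMap.restrictScalarsL ℂ E E ℝ ℝ).analyticAt _).comp hYa
    exact ((ContinuousLinearMap.id ℝ (E →L[ℝ] E)).analyticAt_bilinear
      ((Y r).restrictScalars ℝ, f r)).comp₂ h1 hf
  have hunit : ∀ᶠ s in 𝓝 r, IsUnit (U s) :=
    hUa.continuousAt.eventually (Units.isOpen.mem_nhds hU1)
  have hYU : ∀ᶠ s in 𝓝 r, (∀ x, Y s (U s x) = x) ∧ ∀ x, U s (Y s x) = x := by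
    filter_upwards [hunit] with s hs
    exact ⟨fun x => congrArg (fun T : E →L[ℂ] E => T x) (Ring.inverse_mul_cancel _ hs),
      fun x => congrArg (fun T : E →L[ℂ] E => T x) (Ring.mul_inverse_cancel _ hs)⟩
  let m : Fin n → ℝ → E := fun i s => e i - P (Y s (e i))
  have hm : ∀ i, AnalyticAt ℝ (m i) r := fun i =>
    analyticAt_const.sub (((P.restrictScalars ℝ).analyticAt _).comp (hYx analyticAt_const))
  have hsum : ∀ s (v : Fin n → ℂ), ∑ i, v i • m i s =
      (∑ i, v i • e i) - P (Y s (∑ i, v i • e i)) := fun s v => by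
    simp [m, smul_sub, Finset.sum_sub_distrib]
  obtain ⟨v, hva, ⟨i₀, hi₀⟩, hv⟩ := exists_analytic_relation n m hm (by
    refine Filter.Eventually.filter_mono nhdsWithin_le_nhds ?_
    filter_upwards [hUs, hYU, hQ] with s h1 h2 ⟨χ, hχ, hχm, hχe⟩
    obtain ⟨x, rfl⟩ : ∃ x, S x = χ := ⟨_, h.inv.left ⟨χ, hχm⟩⟩
    have h3 : U s x = P x := by
      rw [← sub_eq_zero, h1, hχe, sub_self]
    have h4 : Y s (P x) = x := by rw [← h3, h2.1]
    refine ⟨fun i => φ i x, fun h0 => hχ ?_, ?_⟩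
    · have h5 : P x = 0 := by
        rw [hP]
        exact Finset.sum_eq_zero fun i _ => by rw [congrFun h0 i, Pi.zero_apply, zero_smul]
      rw [← h4, h5, map_zero, map_zero]
    · rw [hsum, ← hP, h4, sub_self])
  let x : ℝ → E := fun s => Y s (∑ i, v i s • e i)
  have hxa : AnalyticAt ℝ x r :=
    hYx (Finset.analyticAt_fun_sum _ fun i _ => (hva i).smul analyticAt_const)
  have hχa : AnalyticAt ℝ (fun s => S (x s)) r := ((S.restrictScalars ℝ).analyticAt _).comp hxa
  refine ⟨fun s => S (x s), hχa, ?_⟩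
  have hr0 : S (x r) ≠ 0 := fun h0 => by
    have h1 := h.inv_injective h0
    have h2 := hYU.self_of_nhds.2 (∑ i, v i r • e i)
    change U r (x r) = _ at h2
    rw [h1, map_zero] at h2
    exact hi₀ (congrFun (he _ h2.symm) i₀)
  filter_upwards [hχa.continuousAt.eventually_ne hr0, hUs, hYU, hv] with s h1 h2 h3 h4
  refine ⟨h1, h.inv.mem _, ?_⟩
  rw [← sub_eq_zero, ← h2, h3.2]
  rwa [hsum] at h4

end IsPencil

end Paths

/-! ### Taylor expansions along tangent paths. -/

section Tangency

variable {E : Type*} [NormedAddCommGroup E] [InnerProductSpace ℂ E] [CompleteSpace E]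
variable {D : Submodule ℂ E}

lemma factorial_smul_taylorAt {F : Type*} [NormedAddCommGroup F] [NormedSpace ℝ F] (f : ℝ → F)
    (r : ℝ) (n : ℕ) : iteratedDeriv n f r = (n.factorial : ℝ) • taylorAt ℝ f r n := by
  unfold taylorAt
  rw [smul_smul, mul_inv_cancel₀ (by positivity), one_smul]

/-- The reparametrisation of the line in the definition of tangency. -/
def tangentPoly (r : ℝ) (k : ℕ) (c : ℕ → ℝ) (s : ℝ) : ℝ :=
  (s - r) + ∑ j ∈ Finset.Ico 2 k, (s - r) ^ j • c j

lemma analyticAt_tangentPoly (r : ℝ) (k : ℕ) (c : ℕ → ℝ) : AnalyticAt ℝ (tangentPoly r k c) r := by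
  unfold tangentPoly
  fun_prop

lemma tangentPoly_self (r : ℝ) (k : ℕ) (c : ℕ → ℝ) : tangentPoly r k c r = 0 := by
  unfold tangentPoly
  rw [Finset.sum_eq_zero, sub_self, add_zero]
  intro j hj
  rw [sub_self, zero_pow (by have := (Finset.mem_Ico.1 hj).1; omega), zero_smul]

lemma taylorAt_tangentPoly (r : ℝ) (k : ℕ) (c : ℕ → ℝ) (i : ℕ) :
    taylorAt ℝ (tangentPoly r k c) r i =
      (if i = 1 then 1 else 0) + if i ∈ Finset.Ico 2 k then c i else 0 := by
  unfold tangentPoly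
  rw [taylorAt_add (by fun_prop) (by fun_prop), taylorAt_sub_const,
    taylorAt_sum _ (fun j _ => by fun_prop)]
  simp only [taylorAt_pow_smul, Finset.sum_ite_eq]

lemma isTangentPath_iff {T H V : D →ₗ[ℂ] E} {r : ℝ} {k : ℕ} {c : ℕ → ℝ} {Q : ℝ → D →ₗ[ℂ] E} :
    IsTangentPath T H V r k c Q ↔ ∃ K : ℝ, ∀ᶠ s in 𝓝 r, ∀ x : D,
      ‖Q s x - (H x + tangentPoly r k c s • V x)‖ ≤ K * |s - r| ^ k * (‖(x : E)‖ + ‖T x‖) := by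
  have : ∀ (s : ℝ) (x : D), H x + tangentPoly r k c s • V x =
      H x + (s - r) • V x + ∑ j ∈ Finset.Ico 2 k, (c j * (s - r) ^ j) • V x := fun s x => by
    rw [tangentPoly, add_smul, ← add_assoc, Finset.sum_smul]
    simp only [smul_eq_mul, mul_comm]
  simp only [this]
  rfl

lemma IsTangentPath.apply_self {T H V : D →ₗ[ℂ] E} {r : ℝ} {k : ℕ} {c : ℕ → ℝ}
    {Q : ℝ → D →ₗ[ℂ] E} (hQ : IsTangentPath T H V r k c Q) (hk : 1 ≤ k) : Q r = H := by
  obtain ⟨K, hK⟩ := isTangentPath_iff.1 hQ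
  ext x
  have h := hK.self_of_nhds x
  rw [tangentPoly_self, sub_self, abs_zero, zero_pow (by omega), mul_zero, zero_mul, zero_smul,
    add_zero] at h
  exact sub_eq_zero.1 (norm_le_zero_iff.1 h)

/-- Testing at χ itself suffices: the error there is b(a)‖χ‖²χ. -/
lemma isBigO_of_isTangentToCurve {T H V : D →ₗ[ℂ] E} {χ : E} {b : ℝ → ℝ} {r : ℝ} {k : ℕ}
    (hχ : χ ≠ 0) (hχD : χ ∈ D) (h : IsTangentToCurve T H V χ b r k) :
    b =O[𝓝 0] fun a => a ^ k := by
  obtain ⟨K, hK⟩ := h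
  have h1 : ∀ᶠ a in 𝓝 (0 : ℝ), |b a| * ‖χ‖ ^ 3 ≤ K * |a| ^ k * (‖χ‖ + ‖T ⟨χ, hχD⟩‖) := by
    have ht : Tendsto (fun a : ℝ => a + r) (𝓝 0) (𝓝 r) := by
      have := (continuous_add_const r).tendsto (0 : ℝ)
      rwa [zero_add] at this
    filter_upwards [ht.eventually hK] with a ha
    have h2 := ha ⟨χ, hχD⟩
    have h3 : curvePath H V χ b (fun s => s - r) (a + r) ⟨χ, hχD⟩ - (H ⟨χ, hχD⟩ +
        (a + r - r) • V ⟨χ, hχD⟩ + ∑ j ∈ Finset.Ico 2 k,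
          ((0 : ℕ → ℝ) j * (a + r - r) ^ j) • V ⟨χ, hχD⟩) = b a • (inner ℂ χ χ • χ) := by
      simp [curvePath, planePoint, rankOne]
    rw [h3, norm_smul, norm_smul, inner_self_eq_norm_sq_to_K, norm_pow, RCLike.norm_ofReal,
      abs_norm, add_sub_cancel_right, Real.norm_eq_abs] at h2
    calc _ = _ := by ring
      _ ≤ _ := h2
  refine Asymptotics.IsBigO.of_bound (K * (‖χ‖ + ‖T ⟨χ, hχD⟩‖) / ‖χ‖ ^ 3) ?_
  filter_upwards [h1] with a ha
  have : 0 < ‖χ‖ ^ 3 := by positivity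
  rw [div_mul_eq_mul_div, le_div_iff₀ this, Real.norm_eq_abs, norm_pow, Real.norm_eq_abs]
  calc _ ≤ _ := ha
    _ = _ := by ring

lemma curvePath_estimate {H V : D →ₗ[ℂ] E} (T : D →ₗ[ℂ] E) (χ : E) {b α : ℝ → ℝ} {r : ℝ} {k : ℕ}
    (hb : (fun s => b (α s)) =O[𝓝 r] fun s => (s - r) ^ k) :
    ∃ K : ℝ, ∀ᶠ s in 𝓝 r, ∀ x : D, ‖curvePath H V χ b α s x - (H x + α s • V x)‖ ≤
      K * |s - r| ^ k * (‖(x : E)‖ + ‖T x‖) := by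
  obtain ⟨c, hc, hb⟩ := hb.exists_nonneg
  refine ⟨c * ‖χ‖ ^ 2, ?_⟩
  filter_upwards [hb.bound] with s hs x
  have h1 : curvePath H V χ b α s x - (H x + α s • V x) = b (α s) • (inner ℂ χ (x : E) • χ) := by
    simp [curvePath, planePoint, rankOne]
  rw [norm_pow, Real.norm_eq_abs (s - r)] at hs
  rw [h1, norm_smul, norm_smul]
  calc ‖b (α s)‖ * (‖inner ℂ χ (x : E)‖ * ‖χ‖)
      ≤ (c * |s - r| ^ k) * ((‖χ‖ * ‖(x : E)‖) * ‖χ‖) := by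
        gcongr
        exact norm_inner_le_norm _ _
    _ = c * ‖χ‖ ^ 2 * |s - r| ^ k * ‖(x : E)‖ := by ring
    _ ≤ _ := by
      gcongr
      linarith [norm_nonneg (T x)]

lemma isTangentToCurve_of_isBigO {T H V : D →ₗ[ℂ] E} {χ : E} {b : ℝ → ℝ} {r : ℝ} {k : ℕ}
    (hb : b =O[𝓝 0] fun a => a ^ k) : IsTangentToCurve T H V χ b r k := by
  have ht : Tendsto (fun s : ℝ => s - r) (𝓝 r) (𝓝 0) := by
    have := (continuous_sub_right r).tendsto r
    rwa [sub_self] at this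
  obtain ⟨K, hK⟩ := curvePath_estimate (H := H) (V := V) T χ (α := fun s => s - r)
    (hb.comp_tendsto ht)
  refine ⟨K, hK.mono fun s hs x => ?_⟩
  simpa using hs x

lemma symmOn_planePoint {H V : D →ₗ[ℂ] E} (hH : SymmOn H) (hV : SymmOn V) (χ : E) (a t : ℝ) :
    SymmOn (planePoint H V χ a t) :=
  (hH.add (hV.smul a)).add ((symmOn_rankOne χ).smul t)

namespace IsCore

variable {H V : D →ₗ[ℂ] E} {lam r : ℝ} {P S B C : E →L[ℂ] E} {n : ℕ} {M : ℂ → E →L[ℂ] E}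

open IsLaurentInverse

lemma hasOrder_smul (h : IsCore H V lam P S B C n M) {j : ℕ} {x : E} {a : ℝ} (ha : a ≠ 0)
    (hx : x ∈ chainSpace (1 - P) C (j + 1)) (hx0 : (nil (1 - P) n (coeff M) ^ j) x ≠ 0) :
    HasOrder H V lam r (a • x) (j + 1) := by
  rw [← Complex.coe_smul]
  refine h.hasOrder r (Submodule.smul_mem _ _ hx) ?_
  rw [map_smul]
  exact smul_ne_zero (by exact_mod_cast ha) hx0

/-- Common to tangent paths, where p is `tangentPoly`, and reparametrised curves, where p is α; only
p'(r) ≠ 0 is needed for the orders to be exact. -/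
lemma eigenpath_coeff (h : IsCore H V lam P S B C n M) {T : D →ₗ[ℂ] E} (hT : SymmOn T)
    {Q : ℝ → D →ₗ[ℂ] E} {p : ℝ → ℝ} (hp : AnalyticAt ℝ p r) (hp0 : p r = 0)
    (hp1 : taylorAt ℝ p r 1 ≠ 0) (hQ : ∀ᶠ s in 𝓝 r, SymmOn (Q s)) {k : ℕ}
    (hest : ∃ K : ℝ, ∀ᶠ s in 𝓝 r, ∀ x : D,
      ‖Q s x - (H x + p s • V x)‖ ≤ K * |s - r| ^ k * (‖(x : E)‖ + ‖T x‖))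
    {η : ℝ → E} (hη : IsResonantEigenpath Q lam r η) {i : ℕ} (hi : i < k) :
    taylorAt ℝ η r i ∈ chainSpace (1 - P) C (i + 1) ∧
    (nil (1 - P) n (coeff M) ^ i) (taylorAt ℝ η r i) = taylorAt ℝ p r 1 ^ i • η r ∧
    (nil (1 - P) n (coeff M) ^ i) (taylorAt ℝ η r i) ≠ 0 ∧
    nil (1 - P) n (coeff M) (taylorAt ℝ η r i) =
      ∑ j ∈ Finset.range i, taylorAt ℝ p r (j + 1) • taylorAt ℝ η r (i - (j + 1)) := by
  have h1 := h.laurent.of_triangular (c := taylorAt ℝ p r) (x := taylorAt ℝ η r) (k := k)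
    fun i hi => h.toIsPencil.eigenpath_relation hT hp hp0 hQ hest hη hi
  have h2 := (nil_pow_triangular (k := k) (fun i hi => (h1 i hi).2) i hi).1
  rw [taylorAt_zero] at h2
  refine ⟨(h1 i hi).1, h2, ?_, (h1 i hi).2⟩
  rw [h2]
  exact smul_ne_zero (pow_ne_zero _ hp1) hη.2.self_of_nhds.1

theorem tangent_resonantPath (h : IsCore H V lam P S B C n M) {T : D →ₗ[ℂ] E} (hT : SymmOn T)
    {Q : ℝ → D →ₗ[ℂ] E} {k : ℕ} (hk : 1 ≤ k) {c : ℕ → ℝ} (hQa : IsAnalyticPathAt T Q r)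
    (hQs : ∀ᶠ s in 𝓝 r, SymmOn (Q s)) (hQr : ∀ᶠ s in 𝓝 r, IsResonant (Q s) lam)
    (hQ : IsTangentPath T H V r k c Q) :
    (∃ χ : ℝ → E, IsResonantEigenpath Q lam r χ) ∧
      k ≤ directionOrder H V lam r ∧
      ∀ χ : ℝ → E, IsResonantEigenpath Q lam r χ →
        (∀ j < k, HasOrder H V lam r (iteratedDeriv j χ r) (j + 1)) ∧
        (∀ n < k, nilpotentA H V lam r (iteratedDeriv n χ r) =
          (n : ℝ) • iteratedDeriv (n - 1) χ r +
            ∑ j ∈ Finset.Icc 2 n,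
              ((j.factorial : ℝ) * (n.choose j : ℝ) * c j) • iteratedDeriv (n - j) χ r) ∧
        DepthAtLeast H V lam r (k - 1) (χ r) := by
  have hp1 : taylorAt ℝ (tangentPoly r k c) r 1 = 1 := by
    rw [taylorAt_tangentPoly]
    simp
  have key := fun {χ : ℝ → E} (hχ : IsResonantEigenpath Q lam r χ) {i : ℕ} (hi : i < k) =>
    h.eigenpath_coeff hT (analyticAt_tangentPoly r k c) (tangentPoly_self r k c)
      (hp1 ▸ one_ne_zero) hQs (isTangentPath_iff.1 hQ) hχ hi
  have hord : ∀ χ : ℝ → E, IsResonantEigenpath Q lam r χ → ∀ j < k,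
      HasOrder H V lam r (iteratedDeriv j χ r) (j + 1) := fun χ hχ j hj => by
    rw [factorial_smul_taylorAt]
    exact h.hasOrder_smul (by positivity) (key hχ hj).1 (key hχ hj).2.2.1
  have hex := h.toIsPencil.exists_eigenpath hT hQa (hQ.apply_self hk) hQr
  refine ⟨hex, ?_, fun χ hχ => ⟨hord χ hχ, fun N hN => ?_, ?_⟩⟩
  · obtain ⟨χ, hχ⟩ := hex
    have := h.le_directionOrder (hord χ hχ (k - 1) (by omega))
    omega
  · have hfac : ∀ j ≤ N, (N.factorial : ℝ) • taylorAt ℝ χ r (N - j) =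
        ((j.factorial : ℝ) * (N.choose j : ℝ)) • iteratedDeriv (N - j) χ r := fun j hj => by
      rw [factorial_smul_taylorAt χ r (N - j), smul_smul]
      congr 1
      have := Nat.choose_mul_factorial_mul_factorial hj
      rw [← this]
      push_cast
      ring
    rw [factorial_smul_taylorAt, h.nilpotentA_eq, ← Complex.coe_smul, map_smul, (key hχ hN).2.2.2,
      Complex.coe_smul]
    cases N with
    | zero => simp
    | succ N =>
      -- The term with p₁ = 1 is split off and becomes nχ^{(n-1)}; the remaining coefficients are
      -- the c_j.
      rw [Finset.sum_range_succ', hp1, one_smul, smul_add, Finset.smul_sum,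
        zero_add, hfac 1 (by omega)]
      refine (add_comm _ _).trans (congrArg₂ (· + ·) ?_ ?_)
      · simp
      · have hIcc : Finset.Icc 2 (N + 1) = Finset.Ico 2 (N + 2) := by
          ext
          simp
          omega
        rw [hIcc, Finset.sum_Ico_eq_sum_range]
        refine Finset.sum_congr rfl fun j hj => ?_
        have hj' := Finset.mem_range.1 hj
        rw [smul_comm, hfac _ (by omega), smul_smul, taylorAt_tangentPoly, if_neg (by omega),
          if_pos (Finset.mem_Ico.2 ⟨by omega, by omega⟩), zero_add, add_comm 2 j]
        congr 1
        ring
  · have h1 := key hχ (i := k - 1) (by omega)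
    refine ⟨⟨1, le_rfl, ?_⟩, taylorAt ℝ χ r (k - 1), ?_⟩
    · exact (hord χ hχ 0 (by omega)).1
    · rw [h.nilpotentA_eq, h1.2.1, hp1, one_pow, one_smul]

/-- Resonance vectors lie in the domain. -/
lemma mem_of_mem_chainSpace (h : IsCore H V lam P S B C n M) {N : ℕ} {x : E}
    (hx : x ∈ chainSpace (1 - P) C N) : x ∈ D := by
  induction N generalizing x with
  | zero =>
    rw [(Submodule.mem_bot ℂ).1 hx]
    exact zero_mem _
  | succ N ih =>
    obtain ⟨g, hg, hx⟩ := mem_chainSpace_succ.1 hx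
    have h1 : x = P x + C g := by
      rw [hx]
      change x = P x + (x - P x)
      abel
    rw [h1, h.left ⟨g, ih hg⟩]
    exact add_mem (mem_eigenSub.1 (h.inv.proj_mem x)).1 (h.inv.mem _)

/-- The chain relation `(H - λ) f = -V (𝐀 f)`, and the orthogonality that it entails. -/
lemma shift_chain (h : IsCore H V lam P S B C n M) {f : E} (hf : f ∈ chainSpace (1 - P) C (n + 1)) :
    H ⟨f, h.mem_of_mem_chainSpace hf⟩ - (lam : ℂ) • f =
        -V ⟨_, h.mem_of_mem_chainSpace (h.laurent.nil_mem f)⟩ ∧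
      ∀ ψ, InEigenspace H lam ψ →
        inner ℂ ψ (V ⟨_, h.mem_of_mem_chainSpace (h.laurent.nil_mem f)⟩) = 0 := by
  set g : D := ⟨_, h.mem_of_mem_chainSpace (h.laurent.nil_mem f)⟩ with hg
  have h1 : f - P f = -S (V g) := by
    have := (h.laurent.nil_mem_pred hf).2
    rw [← h.left]
    exact this
  have hPV : P (V g) = 0 := by
    have h2 : P (f - P f) = 0 := by rw [map_sub, h.inv.proj_proj, sub_self]
    rw [h1, map_neg, h.inv.proj_inv h.symmH, neg_eq_zero] at h2
    exact h2
  have horth : ∀ ψ, InEigenspace H lam ψ → inner ℂ ψ (V g) = 0 := fun ψ hψ => by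
    rw [← h.inv.proj_eq ψ (mem_eigenSub.2 hψ), h.inv.proj_symm, hPV, inner_zero_right]
  refine ⟨?_, horth⟩
  obtain ⟨hm, he⟩ := mem_eigenSub.1 (h.inv.proj_mem f)
  have h2 : (⟨f, h.mem_of_mem_chainSpace hf⟩ : D) = ⟨P f, hm⟩ - ⟨S (V g), h.inv.mem _⟩ := by
    refine Subtype.ext ?_
    change f = P f - S (V g)
    rw [sub_eq_add_neg, ← h1]
    abel
  have h3 := h.inv.shift_inv h.symmH (V g)
  rw [hPV, sub_zero] at h3
  have h4 : f = P f - S (V g) := congrArg Subtype.val h2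
  rw [h2, map_sub, he]
  nth_rewrite 2 [h4]
  rw [smul_sub]
  nth_rewrite 4 [← h3]
  abel

theorem curve_eigenpath (h : IsCore H V lam P S B C n M) {T : D →ₗ[ℂ] E} (hT : SymmOn T)
    {k : ℕ} {χ : E} (hχ : χ ≠ 0) (hχe : InEigenspace H lam χ) {b : ℝ → ℝ}
    (hb : IsTangentToCurve T H V χ b r k) {α : ℝ → ℝ} (hα : AnalyticAt ℝ α r) (hα0 : α r = 0)
    (hα1 : deriv α r ≠ 0) {η : ℝ → E} (hη : IsResonantEigenpath (curvePath H V χ b α) lam r η) :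
    (∀ j < k, HasOrder H V lam r (taylorCoeff η r j) (j + 1)) ∧
    (∀ j < k, nilpotentA H V lam r (taylorCoeff η r j) ∈
      Submodule.span ℂ (taylorCoeff η r '' {i | i < j})) ∧
    (IsTangentPath T H V r k 0 (curvePath H V χ b α) →
      ∀ j, j + 1 < k → nilpotentA H V lam r (taylorCoeff η r (j + 1)) = taylorCoeff η r j) ∧
    (∀ j, j + 1 < k → DepthAtLeast H V lam r 1 (taylorCoeff η r j) ∧
      ∃ h : taylorCoeff η r j ∈ D, ∀ ψ : E, InEigenspace H lam ψ →
        inner ℂ ψ (V ⟨taylorCoeff η r j, h⟩) = 0) := by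
  have htc : ∀ j, taylorCoeff η r j = taylorAt ℝ η r j := fun j => rfl
  simp only [h.nilpotentA_eq, DepthAtLeast]
  have hsymm : ∀ᶠ s in 𝓝 r, SymmOn (curvePath H V χ b α s) :=
    Eventually.of_forall fun s => symmOn_planePoint h.symmH h.symmV χ _ _
  have hα1' : taylorAt ℝ α r 1 ≠ 0 := by simpa [taylorAt] using hα1
  have hαt : Tendsto α (𝓝 r) (𝓝 0) := hα0 ▸ hα.continuousAt
  have hαO : α =O[𝓝 r] fun s => (s - r) ^ 1 := by
    refine isBigO_of_taylorAt_eq_zero hα fun i hi => ?_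
    obtain rfl : i = 0 := by omega
    rw [taylorAt_zero, hα0]
  simp only [pow_one] at hαO
  -- Since α(s) = O(s - r), b(α(s)) = O((s-r)^k): in this parametrisation the curve stays close to H
  -- + α(s)V.
  have hest := curvePath_estimate (H := H) (V := V) T χ (α := α)
    (((isBigO_of_isTangentToCurve hχ hχe.1 hb).comp_tendsto hαt).trans (hαO.pow k))
  have key := fun {i : ℕ} (hi : i < k) => h.eigenpath_coeff hT hα hα0 hα1' hsymm hest hη hi
  have hres : ∀ j < k, IsResonanceVector H V lam r (taylorCoeff η r j) := fun j hj =>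
    (h.isResonanceVector_iff r _).2 (h.laurent.chainSpace_le (key hj).1)
  -- In the formula for 𝐀η_{j+1} the vector η_j has coefficient α'(r) ≠ 0, and all other terms lie
  -- in the range by induction.
  have hrange : ∀ j, j + 1 < k → ∃ f, nil (1 - P) n (coeff M) f = taylorCoeff η r j := by
    intro j
    induction j using Nat.strong_induction_on with
    | _ j ih =>
      intro hj
      have h1 := (key hj).2.2.2
      rw [Finset.sum_range_succ', zero_add, Nat.add_sub_cancel] at h1
      have h2 : taylorAt ℝ α r 1 • taylorAt ℝ η r j ∈
          LinearMap.range (nil (1 - P) n (coeff M) : E →ₗ[ℂ] E) := by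
        rw [← sub_eq_iff_eq_add'.2 h1]
        refine sub_mem ⟨_, rfl⟩ (sum_mem fun i hi => ?_)
        rw [← Complex.coe_smul]
        have hi' := Finset.mem_range.1 hi
        exact Submodule.smul_mem _ _ (ih _ (by omega) (by omega))
      rw [← Complex.coe_smul] at h2
      exact (Submodule.smul_mem_iff _ (by exact_mod_cast hα1')).1 h2
  refine ⟨fun j hj => h.hasOrder r (key hj).1 (key hj).2.2.1, fun j hj => ?_, fun hstd j hj => ?_,
    fun j hj => ⟨⟨hres j (by omega), by simpa using hrange j hj⟩, ?_⟩⟩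
  · rw [htc, (key hj).2.2.2]
    refine sum_mem fun i hi => ?_
    rw [← Complex.coe_smul]
    have hi' := Finset.mem_range.1 hi
    exact Submodule.smul_mem _ _ (Submodule.subset_span ⟨j - (i + 1), by simp; omega, rfl⟩)
  -- A standard path is compared with H + (s-r)V instead of H + α(s)V, which leaves a single term in
  -- the triangular system.
  · have hp1 : taylorAt ℝ (tangentPoly r k 0) r 1 = 1 := by
      rw [taylorAt_tangentPoly]
      simp
    have h1 := h.eigenpath_coeff hT (analyticAt_tangentPoly r k 0) (tangentPoly_self r k 0)
      (hp1 ▸ one_ne_zero) hsymm (isTangentPath_iff.1 hstd) hη hj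
    rw [htc, h1.2.2.2, Finset.sum_range_succ', zero_add, hp1, one_smul, Nat.add_sub_cancel,
      Finset.sum_eq_zero, zero_add, htc]
    intro i _
    rw [taylorAt_tangentPoly]
    simp
  · obtain ⟨f, hf⟩ := hrange j hj
    obtain ⟨f', hf'm, hf'⟩ := h.laurent.exists_mem_nil_eq f
    rw [← hf, ← hf']
    exact ⟨_, (h.shift_chain hf'm).2⟩

end IsCore

end Tangency

/-! ### Resonance curves of rank-one directions. -/

section Curves

variable {E : Type*} [NormedAddCommGroup E] [InnerProductSpace ℂ E] [CompleteSpace E]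
variable {D : Submodule ℂ E}

lemma IsResolvent.symm {T : D →ₗ[ℂ] E} (hT : SymmOn T) {lam : ℝ} {R : E →L[ℂ] E}
    (h : IsResolvent T lam R) (x y : E) : inner ℂ (R x) y = inner ℂ x (R y) := by
  obtain ⟨hx, hx'⟩ := h.1 x
  obtain ⟨hy, hy'⟩ := h.1 y
  have := inner_shift_symm (lam := lam) hT ⟨R x, hx⟩ ⟨R y, hy⟩
  rw [hx', hy'] at this
  exact this.symm

/-- Rank one perturbations of an operator whose resolvent exists. -/
lemma isResonant_planePoint_iff {H V : D →ₗ[ℂ] E} {lam a : ℝ} {R : E →L[ℂ] E}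
    (h : IsResolvent (H + a • V) lam R) (χ : E) (t : ℝ) :
    IsResonant (planePoint H V χ a t) lam ↔ 1 + (t : ℂ) * inner ℂ χ (R χ) = 0 := by
  have hpt : ∀ u : D, planePoint H V χ a t u =
      (H + a • V) u + ((t : ℂ) * inner ℂ χ (u : E)) • χ := fun u => by
    rw [mul_smul, Complex.coe_smul]
    rfl
  constructor
  · rintro ⟨u, hu, hm, he⟩
    rw [hpt] at he
    have h1 := h.2 ⟨u, hm⟩
    have h2 : (H + a • V) ⟨u, hm⟩ - (lam : ℂ) • u = -(((t : ℂ) * inner ℂ χ u) • χ) := by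
      rw [← he]
      abel
    simp only at h1
    rw [h2, map_neg, map_smul] at h1
    have h3 : inner ℂ χ u ≠ 0 := fun h0 => by
      rw [h0, mul_zero, zero_smul, neg_zero] at h1
      exact hu h1.symm
    have h4 := congrArg (inner ℂ χ) h1
    rw [inner_neg_right, inner_smul_right] at h4
    refine mul_right_cancel₀ h3 ?_
    rw [zero_mul, add_mul, one_mul]
    nth_rewrite 1 [← h4]
    ring
  · intro h0
    obtain ⟨hm, he⟩ := h.1 χ
    refine ⟨R χ, fun hR => ?_, hm, ?_⟩
    · rw [hR, inner_zero_right, mul_zero, add_zero] at h0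
      exact one_ne_zero h0
    · rw [hpt, eq_add_of_sub_eq he]
      simp only
      rw [eq_neg_of_add_eq_zero_right h0, neg_smul, one_smul]
      abel

lemma add_ofReal_smul (H V : D →ₗ[ℂ] E) (a : ℝ) : H + (a : ℂ) • V = H + a • V := by
  ext x
  simp

lemma tendsto_ofReal_nhdsNE :
    Tendsto (fun a : ℝ => (a : ℂ)) (𝓝[≠] (0 : ℝ)) (𝓝[≠] (0 : ℂ)) := by
  refine tendsto_nhdsWithin_iff.2 ⟨?_, ?_⟩
  · exact (Complex.continuous_ofReal.tendsto' 0 0 Complex.ofReal_zero).mono_left nhdsWithin_le_nhds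
  · filter_upwards [self_mem_nhdsWithin] with a ha
    simpa using ha

namespace IsCore

variable {H V : D →ₗ[ℂ] E} {lam r : ℝ} {P S B C : E →L[ℂ] E} {n : ℕ} {M : ℂ → E →L[ℂ] E}

open IsLaurentInverse

/-- For real parameters near `0` the regularised resolvent `M(a) S` is symmetric. -/
lemma eventually_symm (h : IsCore H V lam P S B C n M) :
    ∀ᶠ a : ℝ in 𝓝[≠] (0 : ℝ), ∀ x y, inner ℂ (M a (S x)) y = inner ℂ x (M a (S y)) := by
  filter_upwards [tendsto_ofReal_nhdsNE.eventually h.eventually_resolvent, self_mem_nhdsWithin]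
    with a ha ha0 x y
  have h1 := ha.1
  rw [add_ofReal_smul] at h1
  have h2 := h1.symm (h.symmH.add (h.symmV.smul a)) x y
  change inner ℂ (((a : ℂ) ^ (n + 1))⁻¹ • M a (S x)) y =
    inner ℂ x (((a : ℂ) ^ (n + 1))⁻¹ • M a (S y)) at h2
  rw [inner_smul_left, inner_smul_right, map_inv₀, map_pow, Complex.conj_ofReal] at h2
  refine mul_left_cancel₀ (inv_ne_zero (pow_ne_zero _ ?_)) h2
  exact_mod_cast ha0

/-- Limit of the symmetric operators a^{n+1}(H + aV - λ)⁻¹ as real a tends to 0. -/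
lemma leading_symm (h : IsCore H V lam P S B C n M) (x y : E) :
    inner ℂ (M 0 (S x)) y = inner ℂ x (M 0 (S y)) := by
  have hc : ∀ x, Tendsto (fun a : ℝ => M a (S x)) (𝓝[≠] 0) (𝓝 (M 0 (S x))) := fun x => by
    have h1 : ContinuousAt (fun z => M z (S x)) 0 :=
      h.analytic.continuousAt.clm_apply continuousAt_const
    exact (h1.tendsto.mono_left nhdsWithin_le_nhds).comp tendsto_ofReal_nhdsNE
  refine tendsto_nhds_unique ((hc x).inner tendsto_const_nhds)
    ((Tendsto.inner tendsto_const_nhds (hc y)).congr' ?_)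
  filter_upwards [h.eventually_symm] with a ha using (ha x y).symm

/-- The form whose non-vanishing guarantees that the resonance curve exists. -/
def _root_.Resonance.leadingForm (S : E →L[ℂ] E) (M : ℂ → E →L[ℂ] E) (χ : E) : ℂ :=
  inner ℂ χ (M 0 (S χ))

/-- The eigenvalue condition is linear in t, with coefficient ⟨χ, M(a)Sχ⟩/a^{n+1}, real for real a ≠
0. Solving for t needs only that the form be nonzero at a = 0. -/
lemma exists_isResonanceCurve (h : IsCore H V lam P S B C n M) {χ : E} (hq : leadingForm S M χ ≠ 0) :
    ∃ b : ℝ → ℝ, IsResonanceCurve H V lam χ b ∧ b =O[𝓝 0] fun a => a ^ (n + 1) := by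
  let m : ℝ → ℂ := fun a => inner ℂ χ (M a (S χ))
  have hma : AnalyticAt ℝ m 0 := by
    have h1 : AnalyticAt ℝ (fun a : ℝ => M a) 0 :=
      AnalyticAt.comp (g := M) (f := fun a : ℝ => (a : ℂ))
        (by simpa using h.analytic.restrictScalars) (Complex.ofRealCLM.analyticAt 0)
    have h2 := (((innerSL ℂ χ).comp (ContinuousLinearMap.apply ℂ E (S χ))).restrictScalars
      ℝ).analyticAt (M ((0 : ℝ) : ℂ))
    exact AnalyticAt.comp (f := fun a : ℝ => M a) h2 h1
  let m' : ℝ → ℝ := fun a => (m a).re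
  have hm'a : AnalyticAt ℝ m' 0 := (Complex.reCLM.analyticAt _).comp hma
  have hreal : ∀ᶠ a : ℝ in 𝓝[≠] (0 : ℝ), m a = m' a := by
    filter_upwards [h.eventually_symm] with a ha
    refine (Complex.conj_eq_iff_re.1 ?_).symm
    change starRingEnd ℂ (inner ℂ χ (M a (S χ))) = inner ℂ χ (M a (S χ))
    rw [inner_conj_symm, ha]
  have hreal0 : m 0 = m' 0 := by
    refine (Complex.conj_eq_iff_re.1 ?_).symm
    change starRingEnd ℂ (inner ℂ χ (M ((0 : ℝ) : ℂ) (S χ))) = inner ℂ χ (M ((0 : ℝ) : ℂ) (S χ))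
    rw [inner_conj_symm, Complex.ofReal_zero, h.leading_symm]
  have hm0 : m' 0 ≠ 0 := fun h0 => by
    rw [h0] at hreal0
    exact hq (by simpa [m, leadingForm] using hreal0)
  let b : ℝ → ℝ := fun a => -(a ^ (n + 1) / m' a)
  have hba : AnalyticAt ℝ b 0 := ((analyticAt_id.pow (n + 1)).div hm'a hm0).neg
  refine ⟨b, ⟨hba, by simp [b], ?_⟩, ?_⟩
  · have h1 : ∀ᶠ a in 𝓝 (0 : ℝ), a ≠ 0 → ∀ t : ℝ,
        (IsResonant (planePoint H V χ a t) lam ↔ t = b a) := by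
      refine eventually_nhdsWithin_iff.1 ?_
      filter_upwards [tendsto_ofReal_nhdsNE.eventually h.eventually_resolvent, hreal,
        self_mem_nhdsWithin, (hm'a.continuousAt.eventually_ne hm0).filter_mono nhdsWithin_le_nhds]
        with a ha har ha0 hma0 t
      have h1 := ha.1
      rw [add_ofReal_smul] at h1
      rw [isResonant_planePoint_iff h1]
      have h2 : inner ℂ χ ((((a : ℂ) ^ (n + 1))⁻¹ • M a ∘L S) χ) =
          ((a ^ (n + 1))⁻¹ * m' a : ℝ) := by
        change inner ℂ χ (((a : ℂ) ^ (n + 1))⁻¹ • M a (S χ)) = _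
        rw [inner_smul_right]
        push_cast
        rw [← har]
      have ha0' : a ^ (n + 1) ≠ 0 := pow_ne_zero _ ha0
      have h3 : 1 + (t : ℂ) * inner ℂ χ ((((a : ℂ) ^ (n + 1))⁻¹ • M a ∘L S) χ) =
          ((1 + t * ((a ^ (n + 1))⁻¹ * m' a) : ℝ) : ℂ) := by
        rw [h2]
        push_cast
        rfl
      change 1 + (t : ℂ) * inner ℂ χ ((((a : ℂ) ^ (n + 1))⁻¹ • M a ∘L S) χ) = 0 ↔ _
      rw [h3, Complex.ofReal_eq_zero]
      have hma0' : m' a ≠ 0 := hma0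
      change _ ↔ t = -(a ^ (n + 1) / m' a)
      constructor
      · intro h4
        field_simp at h4 ⊢
        linarith
      · rintro rfl
        field_simp
        ring
    have h2 : ∀ᶠ p : ℝ × ℝ in 𝓝 (0 : ℝ × ℝ), p.1 ≠ 0 → ∀ t : ℝ,
        (IsResonant (planePoint H V χ p.1 t) lam ↔ t = b p.1) :=
      (continuous_fst.tendsto' (0 : ℝ × ℝ) 0 rfl).eventually h1
    filter_upwards [h2] with p hp hp0 using hp hp0 p.2
  · have h1 : (fun a => (m' a)⁻¹) =O[𝓝 0] fun _ => (1 : ℝ) :=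
      (hm'a.continuousAt.inv₀ hm0).tendsto.isBigO_one ℝ
    have h2 := ((Asymptotics.isBigO_refl (fun a : ℝ => a ^ (n + 1)) (𝓝 0)).mul h1).neg_left
    simpa [b, div_eq_mul_inv] using h2

/-- Let N = M(0)S, symmetric. If the form vanished on the range of N, then ⟨N³x, x⟩ = 0 for all x,
so N³ = 0 by polarisation, then N = 0 by symmetry, and M(0) = 0 because the range of `S` is dense.
-/
lemma exists_leadingForm_ne_zero (h : IsCore H V lam P S B C n M) :
    ∃ x, leadingForm S M (M 0 (S x)) ≠ 0 := by
  by_contra! hcon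
  have hs := h.leading_symm
  have h3 : ∀ x, M 0 (S (M 0 (S (M 0 (S x))))) = 0 := by
    have h1 : ((M 0 ∘L S ∘L M 0 ∘L S ∘L M 0 ∘L S : E →L[ℂ] E) : E →ₗ[ℂ] E) = 0 := by
      refine (inner_map_self_eq_zero _).1 fun x => ?_
      change inner ℂ (M 0 (S (M 0 (S (M 0 (S x)))))) x = 0
      rw [hs]
      have := hcon x
      rw [leadingForm, ← hs] at this
      exact this
    exact fun x => congrArg (fun L : E →ₗ[ℂ] E => L x) h1
  have h2 : ∀ x, M 0 (S (M 0 (S x))) = 0 := fun x => by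
    rw [← inner_self_eq_zero (𝕜 := ℂ), hs, h3, inner_zero_right]
  have h1 : ∀ x, M 0 (S x) = 0 := fun x => by
    rw [← inner_self_eq_zero (𝕜 := ℂ), hs, h2, inner_zero_right]
  refine h.ne_zero (ext_clm_dense h.dense fun u => ?_)
  rw [← h.inv.left u, h1]
  rfl

/-- Values of M(0) are eigenvectors or zero and equal 𝐀^k m_k x, so adding them preserves the depth.
-/
lemma leading_mem_deepEigenvectors (h : IsCore H V lam P S B C n M) {k : ℕ} (hk : k ≤ n) {χ : E}
    (hχ : χ ∈ deepEigenvectors H V lam r k) (c : ℂ) (x : E) (h0 : χ + c • M 0 x ≠ 0) :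
    χ + c • M 0 x ∈ deepEigenvectors H V lam r k := by
  obtain ⟨-, h1, f, hf, hfχ⟩ := h.mem_deepEigenvectors_iff.1 hχ
  have hc : ∀ x, coeff M 0 x = M 0 x := fun x => by rw [coeff, taylorAt_zero]
  refine h.mem_deepEigenvectors_iff.2 ⟨h0, ?_, f + c • coeff M k x, ?_, ?_⟩
  · rw [← h.mem_chainSpace_one_iff] at h1 ⊢
    rw [← hc]
    exact add_mem h1 (Submodule.smul_mem _ _ (h.laurent.coeff_mem (Nat.zero_le _) x))
  · exact add_mem hf (Submodule.smul_mem _ _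
      (h.laurent.chainSpace_le (h.laurent.coeff_mem hk x)))
  · have := h.laurent.nil_pow_coeff (i := 0) (j := k) (by omega) x
    rw [zero_add, hc] at this
    rw [map_add, map_smul, hfχ, this]

lemma deepEigenvectors_subset_closure (h : IsCore H V lam P S B C n M) (k : ℕ) :
    deepEigenvectors H V lam r k ⊆
      closure (deepEigenvectors H V lam r k ∩ {χ | leadingForm S M χ ≠ 0}) := by
  intro χ hχ
  by_cases hq : leadingForm S M χ = 0
  swap
  · exact subset_closure ⟨hχ, hq⟩
  obtain ⟨x, hx⟩ := h.exists_leadingForm_ne_zero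
  set u := M 0 (S x) with hu
  let β : ℂ := inner ℂ χ (M 0 (S u)) + inner ℂ u (M 0 (S χ))
  -- The form at χ vanishes, so along this real line it is ε times an affine function whose slope is
  -- the nonzero value at u.
  have hform : ∀ ε : ℝ, leadingForm S M (χ + (ε : ℂ) • u) = ε * (β + ε * leadingForm S M u) := by
    intro ε
    unfold leadingForm at hq ⊢
    simp only [map_add, map_smul, inner_add_left, inner_add_right, inner_smul_left,
      inner_smul_right, Complex.conj_ofReal, hq, β]
    ring
  have hne : ∀ᶠ ε : ℝ in 𝓝[≠] (0 : ℝ), leadingForm S M (χ + (ε : ℂ) • u) ≠ 0 := by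
    have h1 : ∀ᶠ ε : ℝ in 𝓝[≠] (0 : ℝ), β + (ε : ℂ) * leadingForm S M u ≠ 0 := by
      by_cases hβ : β = 0
      · filter_upwards [self_mem_nhdsWithin] with ε hε
        rw [hβ, zero_add]
        exact mul_ne_zero (by exact_mod_cast hε) hx
      · have hc : ContinuousAt (fun ε : ℝ => β + (ε : ℂ) * leadingForm S M u) 0 := by fun_prop
        exact (hc.eventually_ne (by simpa using hβ)).filter_mono nhdsWithin_le_nhds
    filter_upwards [h1, self_mem_nhdsWithin] with ε h1 hε
    rw [hform]
    exact mul_ne_zero (by exact_mod_cast hε) h1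
  have hlim : Tendsto (fun ε : ℝ => χ + (ε : ℂ) • u) (𝓝[≠] 0) (𝓝 χ) := by
    have hc : Continuous fun ε : ℝ => χ + (ε : ℂ) • u := by fun_prop
    exact (hc.tendsto' 0 χ (by simp)).mono_left nhdsWithin_le_nhds
  refine mem_closure_of_tendsto hlim (hne.mono fun ε hε => ⟨?_, hε⟩)
  refine h.leading_mem_deepEigenvectors (h.le_of_mem_deepEigenvectors hχ) hχ _ _ fun h0 => hε ?_
  rw [leadingForm, hu, h0, inner_zero_left]

theorem generic_curve (h : IsCore H V lam P S B C n M) (T : D →ₗ[ℂ] E) {k : ℕ} {χ : E}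
    (hχ : χ ∈ deepEigenvectors H V lam r (k - 1)) (hq : leadingForm S M χ ≠ 0) :
    ∃ b : ℝ → ℝ, IsResonanceCurve H V lam χ b ∧ IsTangentToCurve T H V χ b r k := by
  obtain ⟨b, hb, hbO⟩ := h.exists_isResonanceCurve hq
  have hk := h.le_of_mem_deepEigenvectors hχ
  refine ⟨b, hb, isTangentToCurve_of_isBigO (hbO.trans ?_)⟩
  have h1 : (fun a : ℝ => a ^ (n + 1 - k)) =O[𝓝 0] fun _ => (1 : ℝ) :=
    (continuous_pow (n + 1 - k)).continuousAt.tendsto.isBigO_one ℝ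
  have h2 := (Asymptotics.isBigO_refl (fun a : ℝ => a ^ k) (𝓝 0)).mul h1
  simp only [mul_one, ← pow_add] at h2
  rwa [Nat.add_sub_cancel' (by omega)] at h2

/-- Density provides one deep eigenvector with nonzero form; on a one-dimensional eigenspace the
form only scales by |c|². -/
theorem simple_curve (h : IsCore H V lam P S B C n M) (T : D →ₗ[ℂ] E) {k : ℕ}
    (hfin : Module.finrank ℂ (LinearMap.ker (shift H (lam : ℂ))) = 1) {χ : E}
    (hχ : χ ∈ deepEigenvectors H V lam r (k - 1)) :
    ∃ b : ℝ → ℝ, IsResonanceCurve H V lam χ b ∧ IsTangentToCurve T H V χ b r k := by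
  obtain ⟨χ', hχ', hq⟩ := closure_nonempty_iff.1 ⟨χ, h.deepEigenvectors_subset_closure (k - 1) hχ⟩
  refine h.generic_curve T hχ fun h0 => hq ?_
  obtain ⟨hχ0, ⟨hm, he⟩, -⟩ := hχ
  obtain ⟨-, ⟨hm', he'⟩, -⟩ := hχ'
  have hker : ∀ (x : E) (hm : x ∈ D), H ⟨x, hm⟩ = (lam : ℂ) • x →
      (⟨x, hm⟩ : D) ∈ LinearMap.ker (shift H (lam : ℂ)) := fun x hm he => by
    rw [LinearMap.mem_ker]
    change H ⟨x, hm⟩ - (lam : ℂ) • x = 0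
    rw [he, sub_self]
  obtain ⟨c, hc⟩ := (finrank_eq_one_iff_of_nonzero' (⟨⟨χ, hm⟩, hker χ hm he⟩ :
    LinearMap.ker (shift H (lam : ℂ))) fun h0 => hχ0 (congrArg
      (fun v : LinearMap.ker (shift H (lam : ℂ)) => ((v : D) : E)) h0)).1 hfin
    ⟨⟨χ', hm'⟩, hker χ' hm' he'⟩
  have hc' : c • χ = χ' := congrArg
    (fun v : LinearMap.ker (shift H (lam : ℂ)) => ((v : D) : E)) hc
  rw [leadingForm] at h0
  rw [leadingForm, ← hc', map_smul, map_smul, inner_smul_left, inner_smul_right, h0, mul_zero,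
    mul_zero]

/-- A chain gives a family of approximate eigenvectors along the line. -/
lemma exists_approximate_eigenvectors (h : IsCore H V lam P S B C n M) (k : ℕ) {f : E}
    (hf : f ∈ chainSpace (1 - P) C (n + 1)) (hk : (nil (1 - P) n (coeff M) ^ (k + 1)) f = 0) :
    ∃ y : ℝ → D, Continuous (fun a => (y a : E)) ∧ (y 0 : E) = (nil (1 - P) n (coeff M) ^ k) f ∧
      ∀ a : ℝ, (H + a • V) (y a) - (lam : ℂ) • (y a : E) =
        a ^ (k + 1) • V ⟨f, h.mem_of_mem_chainSpace hf⟩ := by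
  induction k generalizing f with
  | zero =>
    refine ⟨fun _ => ⟨f, h.mem_of_mem_chainSpace hf⟩, continuous_const, rfl, fun a => ?_⟩
    have h1 := (h.shift_chain hf).1
    have h2 : (⟨_, h.mem_of_mem_chainSpace (h.laurent.nil_mem f)⟩ : D) = 0 := Subtype.ext
      (by simpa using hk)
    rw [h2, map_zero, neg_zero, sub_eq_zero] at h1
    change H _ + a • V _ - (lam : ℂ) • f = _
    rw [h1, zero_add, pow_one, add_sub_cancel_left]
  | succ k ih =>
    have hg := h.laurent.nil_mem f
    obtain ⟨y, hy, hy0, hya⟩ := ih hg (by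
      rw [pow_succ] at hk
      exact hk)
    -- By the chain relation (H - λ)f = -V𝐀f, the term a^{k+1}f cancels the error left by the family
    -- for 𝐀f and creates one of the next order.
    refine ⟨fun a => y a + (a : ℂ) ^ (k + 1) • ⟨f, h.mem_of_mem_chainSpace hf⟩, ?_, ?_, fun a => ?_⟩
    · have : Continuous fun a : ℝ => (y a : E) + (a : ℂ) ^ (k + 1) • f := by fun_prop
      exact this
    · change (y 0 : E) + ((0 : ℝ) : ℂ) ^ (k + 1) • f = _
      rw [hy0, Complex.ofReal_zero, zero_pow (by omega), zero_smul, add_zero, pow_succ]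
      rfl
    · have h1 := hya a
      have h2 := eq_add_of_sub_eq (h.shift_chain hf).1
      set d : D := ⟨f, h.mem_of_mem_chainSpace hf⟩ with hd
      have h3 : (H + a • V) (y a + (a : ℂ) ^ (k + 1) • d) -
          (lam : ℂ) • ((y a : E) + (a : ℂ) ^ (k + 1) • f) =
          ((H + a • V) (y a) - (lam : ℂ) • (y a : E)) +
            (a : ℂ) ^ (k + 1) • (H d + (a : ℂ) • V d - (lam : ℂ) • f) := by
        rw [map_add, map_smul, smul_add, smul_comm (lam : ℂ), smul_sub, ← add_ofReal_smul]
        change _ + _ • (H d + (a : ℂ) • V d) - _ = _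
        abel
      change (H + a • V) (y a + (a : ℂ) ^ (k + 1) • d) -
          (lam : ℂ) • ((y a : E) + (a : ℂ) ^ (k + 1) • f) = _
      rw [h3, h1, h2, ← Complex.coe_smul, ← Complex.coe_smul, Complex.ofReal_pow,
        Complex.ofReal_pow, pow_succ _ (k + 1), mul_smul, ← smul_add]
      congr 1
      abel

/-- Symmetry of H + aV - λ is applied to the eigenpath η and the approximate eigenvectors y. It
gives b(a)⟨η,χ⟩⟨χ,y⟩ = -a^k⟨η,v⟩, and collinearity keeps the factor on the left away from 0. -/
theorem collinear_curve (h : IsCore H V lam P S B C n M) (T : D →ₗ[ℂ] E) {k : ℕ} (hk : 1 ≤ k) {χ : E}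
    (hχ : χ ∈ deepEigenvectors H V lam r (k - 1)) {b : ℝ → ℝ}
    {η : ℝ → E} (hη : IsResonantEigenpath (curvePath H V χ b fun s => s - r) lam r η)
    {z : ℂ} (hz : η r = z • χ) : IsTangentToCurve T H V χ b r k := by
  obtain ⟨hχ0, hχe, f, hf, hfχ⟩ := h.mem_deepEigenvectors_iff.1 hχ
  obtain ⟨y, hy, hy0, hya⟩ := h.exists_approximate_eigenvectors (k - 1) hf (by
    have h1 := h.laurent.chainSpace_le ((h.mem_chainSpace_one_iff χ).2 hχe)
    have h2 := (h.laurent.mem_chainSpace_iff h1 1).1 ((h.mem_chainSpace_one_iff χ).2 hχe)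
    rw [pow_succ']
    change nil (1 - P) n (coeff M) ((nil (1 - P) n (coeff M) ^ (k - 1)) f) = 0
    rw [hfχ]
    simpa using h2)
  rw [Nat.sub_add_cancel hk] at hya
  rw [hfχ] at hy0
  set v := V ⟨f, h.mem_of_mem_chainSpace hf⟩ with hv
  have ht : Tendsto (fun a : ℝ => a + r) (𝓝 0) (𝓝 r) := by
    have := (continuous_add_const r).tendsto (0 : ℝ)
    rwa [zero_add] at this
  let g : ℝ → ℂ := fun a => inner ℂ (η (a + r)) χ * inner ℂ χ (y a : E)
  have hηc : ContinuousAt (fun a : ℝ => η (a + r)) 0 := by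
    refine ContinuousAt.comp (g := η) ?_ (by fun_prop)
    rw [zero_add]
    exact hη.1.continuousAt
  have hgc : ContinuousAt g 0 := (hηc.inner continuousAt_const).mul
    (continuousAt_const.inner hy.continuousAt)
  have hg0 : g 0 ≠ 0 := by
    have hz0 : z ≠ 0 := fun h0 => hη.2.self_of_nhds.1 (by rw [hz, h0, zero_smul])
    have h1 : inner ℂ χ χ ≠ (0 : ℂ) := inner_self_ne_zero.2 hχ0
    simp only [g, zero_add, hz, hy0, inner_smul_left]
    exact mul_ne_zero (mul_ne_zero (by simpa using hz0) h1) h1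
  have hpair : ∀ᶠ a : ℝ in 𝓝 (0 : ℝ), (b a : ℂ) * g a = -(a : ℂ) ^ k * inner ℂ (η (a + r)) v := by
    filter_upwards [ht.eventually hη.2] with a ⟨_, hm, he⟩
    have h1 : (H + a • V) ⟨η (a + r), hm⟩ - (lam : ℂ) • η (a + r) =
        -((b a : ℂ) * inner ℂ χ (η (a + r))) • χ := by
      rw [← he, neg_smul, mul_smul, Complex.coe_smul]
      change _ - ((H + (a + r - r) • V) ⟨η (a + r), hm⟩ +
        b (a + r - r) • (inner ℂ χ (η (a + r)) • χ)) = _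
      rw [add_sub_cancel_right]
      abel
    have h2 := inner_shift_symm (lam := lam) (h.symmH.add (h.symmV.smul a)) ⟨η (a + r), hm⟩ (y a)
    simp only at h2
    rw [h1, hya, ← Complex.coe_smul, inner_smul_left, inner_smul_right, map_neg, map_mul,
      Complex.conj_ofReal, inner_conj_symm, Complex.ofReal_pow] at h2
    simp only [g]
    linear_combination -h2
  have hO : (fun a => (b a : ℂ)) =O[𝓝 0] fun a : ℝ => (a : ℂ) ^ k := by
    have h1 : (fun a => -(inner ℂ (η (a + r)) v) * (g a)⁻¹) =O[𝓝 0] fun _ => (1 : ℂ) :=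
      ((hηc.inner continuousAt_const).neg.mul (hgc.inv₀ hg0)).tendsto.isBigO_one ℂ
    have h2 := (Asymptotics.isBigO_refl (fun a : ℝ => (a : ℂ) ^ k) (𝓝 0)).mul h1
    simp only [mul_one] at h2
    refine h2.congr' ?_ EventuallyEq.rfl
    filter_upwards [hpair, hgc.eventually_ne hg0] with a ha hga
    rw [← mul_assoc, mul_neg, ← neg_mul, ← ha, mul_assoc, mul_inv_cancel₀ hga, mul_one]
  refine isTangentToCurve_of_isBigO (Asymptotics.IsBigO.of_norm_norm ?_)
  have := hO.norm_norm
  simpa using this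

end IsCore

end Curves

/-! ### Resonance curves as analytic resonant paths. -/

section Existence

variable {E : Type*} [NormedAddCommGroup E] [InnerProductSpace ℂ E] [CompleteSpace E]
variable {D : Submodule ℂ E}

lemma isResonantPath_curvePath {T H V : D →ₗ[ℂ] E} {A₀ : Submodule ℝ (D →ₗ[ℂ] E)} {lam r : ℝ}
    (hD : Dense (D : Set E)) (hHs : SymmOn H) (hVs : SymmOn V) {R : E →L[ℂ] E}
    (hR : IsResolvent T Complex.I R) (hH : H - T ∈ A₀) (hV : V ∈ A₀) {χ : E}
    (hχ : rankOne D χ ∈ A₀) (hres : IsResonant H lam) {b : ℝ → ℝ}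
    (hb : IsResonanceCurve H V lam χ b) :
    IsResonantPath T A₀ lam r (curvePath H V χ b fun s => s - r) := by
  obtain ⟨hba, hb0, hb⟩ := hb
  have hmem : ∀ x, R x ∈ D := fun x => (hR.1 x).1
  constructor
  · obtain ⟨HR, hHR⟩ := exists_clm_comp hD hHs R hmem
    obtain ⟨VR, hVR⟩ := exists_clm_comp hD hVs R hmem
    obtain ⟨WR, hWR⟩ := exists_clm_comp hD (symmOn_rankOne χ) R hmem
    refine ⟨fun s => HR + (s - r) • VR + b (s - r) • WR, ?_, Eventually.of_forall fun s x => ?_⟩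
    · have h1 : AnalyticAt ℝ (fun s : ℝ => s - r) r := by fun_prop
      have h2 : AnalyticAt ℝ (fun s : ℝ => b (s - r)) r :=
        AnalyticAt.comp (g := b) (f := fun s : ℝ => s - r) (by simpa using hba) h1
      exact (analyticAt_const.add (h1.smul analyticAt_const)).add (h2.smul analyticAt_const)
    · set w := T x - Complex.I • (x : E) with hw
      have h1 : (⟨R w, hmem w⟩ : D) = x := Subtype.ext (hR.2 x)
      change HR w + (s - r) • VR w + b (s - r) • WR w = H x + (s - r) • V x + b (s - r) • rankOne D χ x
      rw [hHR, hVR, hWR, h1]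
  · have ht : Tendsto (fun s : ℝ => (s - r, b (s - r))) (𝓝 r) (𝓝 (0 : ℝ × ℝ)) := by
      have h1 : ContinuousAt (fun s : ℝ => (s - r, b (s - r))) r := by
        refine ContinuousAt.prodMk (by fun_prop) ?_
        refine ContinuousAt.comp (g := b) (f := fun s : ℝ => s - r) ?_ (by fun_prop)
        rw [sub_self]
        exact hba.continuousAt
      have h2 := h1.tendsto
      rwa [sub_self, hb0] at h2
    filter_upwards [ht.eventually hb] with s hs
    constructor
    · have h1 : curvePath H V χ b (fun s => s - r) s - T =
          (H - T) + (s - r) • V + b (s - r) • rankOne D χ := by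
        simp only [curvePath, planePoint]
        abel
      rw [h1]
      exact A₀.add_mem (A₀.add_mem hH (A₀.smul_mem _ hV)) (A₀.smul_mem _ hχ)
    -- The definition of the curve is silent at a = 0; there the path passes through `H`, which is
    -- resonant.
    · by_cases hsr : s - r = 0
      · have h1 : curvePath H V χ b (fun s => s - r) s = H := by
          simp [curvePath, planePoint, hsr, hb0]
        rwa [h1]
      · exact (hs hsr).2 rfl

end Existence

end Resonance

end

theorem mainTheorem9 {E : Type*} [NormedAddCommGroup E] [InnerProductSpace ℂ E] [CompleteSpace E]
    (H₀ : E →ₗ.[ℂ] E) (hdense : Dense (H₀.domain : Set E)) (hsa : IsSelfAdjoint H₀)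
    (A₀ : Submodule ℝ (H₀.domain →ₗ[ℂ] E))
    (hA₀ : ∀ V ∈ A₀, Resonance.IsDirection H₀.toFun V)
    (lam : ℝ) (hlam : (lam : ℂ) ∉ Resonance.essentialSpectrum H₀.toFun)
    (H : H₀.domain →ₗ[ℂ] E) (hH : H - H₀.toFun ∈ A₀) (hres : Resonance.IsResonant H lam)
    (V : H₀.domain →ₗ[ℂ] E) (hV : V ∈ A₀) (hreg : Resonance.IsRegular H V lam)
    (r : ℝ) (k : ℕ) (hk : 1 ≤ k) :
    -- resonant paths tangent to `V` to order at least `k`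
    (∀ (P : ℝ → H₀.domain →ₗ[ℂ] E) (c : ℕ → ℝ),
      Resonance.IsResonantPath H₀.toFun A₀ lam r P →
      Resonance.IsTangentPath H₀.toFun H V r k c P →
      (∃ χ : ℝ → E, Resonance.IsResonantEigenpath P lam r χ) ∧
      k ≤ Resonance.directionOrder H V lam r ∧
      ∀ χ : ℝ → E, Resonance.IsResonantEigenpath P lam r χ →
        (∀ j < k, Resonance.HasOrder H V lam r (iteratedDeriv j χ r) (j + 1)) ∧
        (∀ n < k, Resonance.nilpotentA H V lam r (iteratedDeriv n χ r) =
          (n : ℝ) • iteratedDeriv (n - 1) χ r +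
            ∑ j ∈ Finset.Icc 2 n,
              ((j.factorial : ℝ) * (n.choose j : ℝ) * c j) • iteratedDeriv (n - j) χ r) ∧
        Resonance.DepthAtLeast H V lam r (k - 1) (χ r)) ∧
    -- tangency to order at least `k` is equivalent to order at least `k`
    ((∀ χ : E, Resonance.InEigenspace H lam χ → Resonance.rankOne H₀.domain χ ∈ A₀) →
      (Resonance.IsTangentToOrder H₀.toFun A₀ H V lam r k ↔
        k ≤ Resonance.directionOrder H V lam r)) ∧
    -- generic eigenvectors of depth at least `k - 1` have a resonance curve tangent to order `k`
    (∃ O : Set E, IsOpen O ∧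
      Resonance.deepEigenvectors H V lam r (k - 1) ⊆
        closure (Resonance.deepEigenvectors H V lam r (k - 1) ∩ O) ∧
      ∀ χ ∈ Resonance.deepEigenvectors H V lam r (k - 1) ∩ O, ∃ b : ℝ → ℝ,
        Resonance.IsResonanceCurve H V lam χ b ∧
        Resonance.IsTangentToCurve H₀.toFun H V χ b r k) ∧
    -- if the eigenvalue is simple, all of them do
    (Module.finrank ℂ (LinearMap.ker (Resonance.shift H (lam : ℂ))) = 1 →
      ∀ χ ∈ Resonance.deepEigenvectors H V lam r (k - 1), ∃ b : ℝ → ℝ,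
        Resonance.IsResonanceCurve H V lam χ b ∧
        Resonance.IsTangentToCurve H₀.toFun H V χ b r k) ∧
    -- so does each of them that has a resonance curve whose eigenpath starts along it
    (∀ χ ∈ Resonance.deepEigenvectors H V lam r (k - 1), ∀ b : ℝ → ℝ,
      Resonance.IsResonanceCurve H V lam χ b →
      (∃ η : ℝ → E, Resonance.IsResonantEigenpath
          (Resonance.curvePath H V χ b fun s => s - r) lam r η ∧
        ∃ z : ℂ, η r = z • χ) →
      Resonance.IsTangentToCurve H₀.toFun H V χ b r k) ∧
    -- the eigenpath along a resonance curve to which `V` is tangent to order at least `k`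
    (∀ χ : E, χ ≠ 0 → Resonance.InEigenspace H lam χ → ∀ b : ℝ → ℝ,
      Resonance.IsResonanceCurve H V lam χ b →
      Resonance.IsTangentToCurve H₀.toFun H V χ b r k →
      ∀ α : ℝ → ℝ, AnalyticAt ℝ α r → α r = 0 → deriv α r ≠ 0 →
      ∀ η : ℝ → E, Resonance.IsResonantEigenpath (Resonance.curvePath H V χ b α) lam r η →
        (∀ j < k, Resonance.HasOrder H V lam r (Resonance.taylorCoeff η r j) (j + 1)) ∧
        (∀ j < k, Resonance.nilpotentA H V lam r (Resonance.taylorCoeff η r j) ∈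
          Submodule.span ℂ (Resonance.taylorCoeff η r '' {i | i < j})) ∧
        (Resonance.IsTangentPath H₀.toFun H V r k 0 (Resonance.curvePath H V χ b α) →
          ∀ j, j + 1 < k → Resonance.nilpotentA H V lam r (Resonance.taylorCoeff η r (j + 1)) =
            Resonance.taylorCoeff η r j) ∧
        (∀ j, j + 1 < k → Resonance.DepthAtLeast H V lam r 1 (Resonance.taylorCoeff η r j) ∧
          ∃ h : Resonance.taylorCoeff η r j ∈ H₀.domain,
            ∀ ψ : E, Resonance.InEigenspace H lam ψ →
              inner ℂ ψ (V ⟨Resonance.taylorCoeff η r j, h⟩) = 0)) := by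
  have hT := Resonance.isSelfAdjointOn_of_isSelfAdjoint hdense hsa
  obtain ⟨P₀, G, hG⟩ := Resonance.exists_reducedInverse_of_notMem_essentialSpectrum hT hlam
  have hpencil : ∀ H', H' - H₀.toFun ∈ A₀ → ∃ P S B C, Resonance.IsPencil H' V lam P S B C :=
    fun H' hH' => Resonance.exists_isPencil hdense hT.symm hG (hA₀ _ hH') (hA₀ V hV).1
  obtain ⟨P, S, B, C, hp⟩ := hpencil H hH
  -- The connectedness argument re-expands at every real point of the line, so each of these
  -- operators needs its own pencil.
  have hunit := hp.eventually_isUnit hreg fun a => hpencil _ (by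
    rw [add_sub_right_comm]
    exact A₀.add_mem hH (A₀.smul_mem a hV))
  obtain ⟨n, M, h⟩ := Resonance.exists_isCore hp hunit hres
  have hsymm : ∀ {Q}, Resonance.IsResonantPath H₀.toFun A₀ lam r Q →
      ∀ᶠ s in 𝓝 r, Resonance.SymmOn (Q s) := fun hQ => hQ.2.mono fun s hs => by
    have h1 := hT.symm.add (hA₀ _ hs.1).1
    rwa [add_sub_cancel] at h1
  have hpart := fun (Q : ℝ → H₀.domain →ₗ[ℂ] E) (c : ℕ → ℝ)
      (hQ : Resonance.IsResonantPath H₀.toFun A₀ lam r Q)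
      (hQt : Resonance.IsTangentPath H₀.toFun H V r k c Q) =>
    h.tangent_resonantPath hT.symm hk hQ.1 (hsymm hQ) (hQ.2.mono fun s hs => hs.2) hQt
  refine ⟨hpart, fun hW => ⟨fun ⟨Q, c, hQ, hQt⟩ => (hpart Q c hQ hQt).2.1, fun hord => ?_⟩,
    ⟨{χ | Resonance.leadingForm S M χ ≠ 0}, ?_, h.deepEigenvectors_subset_closure (k - 1),
      fun χ hχ => h.generic_curve H₀.toFun hχ.1 hχ.2⟩,
    fun hfin χ hχ => h.simple_curve H₀.toFun hfin hχ,
    fun χ hχ b _ ⟨η, hη, z, hz⟩ => h.collinear_curve H₀.toFun hk hχ hη hz,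
    fun χ hχ hχe b _ hbt α hα hα0 hα1 η hη => h.curve_eigenpath hT.symm hχ hχe hbt hα hα0 hα1 hη⟩
  -- Order at least k gives an eigenvector of depth k - 1, and density one with nonzero form; its
  -- curve is even a standard tangent path.
  · obtain ⟨χ₀, hχ₀⟩ := h.deepEigenvectors_nonempty (r := r) (k := k - 1) hres (by omega)
    obtain ⟨χ, hχ, hq⟩ := closure_nonempty_iff.1
      ⟨χ₀, h.deepEigenvectors_subset_closure (k - 1) hχ₀⟩
    obtain ⟨b, hb, hbt⟩ := h.generic_curve H₀.toFun hχ hq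
    obtain ⟨R, hR⟩ := Resonance.exists_resolvent_I hT hG
    exact ⟨_, 0, Resonance.isResonantPath_curvePath hdense h.symmH h.symmV hR hH hV
      (hW χ hχ.2.1) hres hb, hbt⟩
  · refine isOpen_ne_fun ?_ continuous_const
    unfold Resonance.leadingForm
    fun_prop
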